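/- Let $N\in\{2,3\}$, let $\Omega\subset\mathbb{R}^N$ be a bounded connected open set with boundary of class $C^2$, let $\omega\subset\Omega$ be a nonempty open set, let $T>0$, and put $Q=\Omega\times(0,T)$, $\Sigma=\partial\Omega\times(0,T)$. Let $$\mathbf H=\{\mathbf u\in L^2(\Omega)^N:\nabla\cdot\mathbf u=0\text{ in }\Omega,\ \mathbf u\cdot\mathbf n=0\text{ on }\partial\Omega\},\qquad \mathbf V=\{\mathbf u\in H^1_0(\Omega)^N:\nabla\cdot\mathbf u=0\text{ in }\Omega\}.$$ For $\alpha>0$, $\mathbf y_0\in\mathbf H$ and $\mathbf v\in L^\infty(0,T;L^2(\omega)^N)$ consider the controlled Leray-$\alpha$ system $$\begin{cases}\mathbf y_t-\Delta\mathbf y+(\mathbf z\cdot\nabla)\mathbf y+\nabla p=\mathbf v1_\omega,\quad \mathbf z-\alpha^2\Delta\mathbf z+\nabla\pi=\mathbf y,\quad \nabla\cdot\mathbf y=\nabla\cdot\mathbf z=0&\text{in }Q,\\ \mathbf y=\mathbf z=\mathbf 0\ \text{ on }\Sigma,\qquad \mathbf y(0)=\mathbf y_0\ \text{ in }\Omega,\end{cases}$$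 whose state $(\mathbf y,p,\mathbf z,\pi)$ is understood in the weak sense, with $\mathbf y\in L^2(0,T;\mathbf V)\cap C^0([0,T];\mathbf H)$, $\mathbf z\in L^2(0,T;\mathbf V)$ and distributions $p,\pi$ on $Q$; and the controlled Navier–Stokes system $$\begin{cases}\mathbf y_t-\Delta\mathbf y+(\mathbf y\cdot\nabla)\mathbf y+\nabla p=\mathbf v1_\omega,\quad \nabla\cdot\mathbf y=0&\text{in }Q,\\ \mathbf y=\mathbf 0\ \text{ on }\Sigma,\qquad \mathbf y(0)=\mathbf y_0\ \text{ in }\Omega,\end{cases}$$ whose states $(\mathbf y,p)$ are understood in the weak sense, with $\mathbf y\in L^2(0,T;\mathbf V)$ weakly continuous from $[0,T]$ into $\mathbf H$ (hence bounded in $\mathbf H$) and $p$ a distribution on $Q$. Let $\mathbf y_0\in\mathbf H$ and $C\in\mathbb{R}$. Let $\alpha_n>0$ with $\alpha_n\to0$ and, for each $n$, let $\mathbf v_{n}\in L^\infty(0,T;L^2(\omega)^N)$ be a control with $\|\mathbf v_{n}\|_{L^\infty(0,T;L^2(\omega)^N)}\le C$ which is a null control for the Leray-$\alpha_n$ system with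 initial datum $\mathbf y_0$, i.e. an associated state $(\mathbf y_{n},p_{n},\mathbf z_{n},\pi_{n})$ satisfies $\mathbf y_{n}(T)=\mathbf 0$. Then there are a subsequence $(n_k)$, a control $\mathbf v\in L^\infty(0,T;L^2(\omega)^N)$ and a pair $(\mathbf y,p)$ such that, as $k\to\infty$, $$\mathbf v_{n_k}\to\mathbf v\ \text{ weakly-}*\text{ in }L^\infty(0,T;L^2(\omega)^N),\qquad \mathbf z_{n_k}\to\mathbf y\ \text{ and }\ \mathbf y_{n_k}\to\mathbf y\ \text{ strongly in }L^2(Q)^N,$$ and $(\mathbf y,p)$ is a state of the Navier–Stokes system associated with the control $\mathbf v$ and the initial datum $\mathbf y_0$, with $\mathbf y(T)=\mathbf 0$. (By the local null controllability of the Leray-$\alpha$ system, uniform in $\alpha$, such controls exist, with $C$ independent of $\alpha$, whenever $\|\mathbf y_0\|_{L^2(\Omega)^N}\le\varepsilon$ for a suitable $\varepsilon>0$.) -/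

import Mathlib

open MeasureTheory Set Filter Topology TopologicalSpace
open scoped ENNReal Distributions LineDeriv InnerProductSpace

noncomputable section

namespace LerayAlpha

/-- The Euclidean space `ℝᴺ`. -/
abbrev E (N : ℕ) := EuclideanSpace ℝ (Fin N)

/-- The `i`-th vector of the canonical basis of `ℝᴺ`. -/
abbrev e {N : ℕ} (i : Fin N) : E N := EuclideanSpace.single i (1 : ℝ)

/-- The boundary of `Ω` is of class `C²`: near each boundary point, `Ω` is the sublevel set
`{g < 0}` of a `C²` function `g` whose differential does not vanish at that point. -/
def HasC2Boundary {N : ℕ} (Ω : Opens (E N)) : Prop :=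
  ∀ x ∈ frontier (Ω : Set (E N)), ∃ g : E N → ℝ, ∃ U ∈ 𝓝 x,
    ContDiff ℝ 2 g ∧ fderiv ℝ g x ≠ 0 ∧ ∀ y ∈ U, y ∈ Ω ↔ g y < 0

/-- The space `L²(Ω)ᴺ` of square integrable vector fields on `Ω`. -/
abbrev L2 {N : ℕ} (Ω : Opens (E N)) := Lp (E N) 2 (volume.restrict (Ω : Set (E N)))

/-- Lebesgue measure on the time interval `(0, T)`. -/
abbrev timeMeasure (T : ℝ) : Measure ℝ := volume.restrict (Ioo 0 T)

/-- The space of controls `L^∞(0, T; L²(ω)ᴺ)`. -/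
abbrev Control {N : ℕ} (T : ℝ) (ω : Opens (E N)) := Lp (L2 ω) ∞ (timeMeasure T)

/-- The space-time cylinder `Q`, with the time variable first: `Q = (0, T) × Ω`. -/
def cylinder {N : ℕ} (T : ℝ) (Ω : Opens (E N)) : Opens (ℝ × E N) :=
  ⟨Ioo 0 T ×ˢ (Ω : Set (E N)), isOpen_Ioo.prod Ω.isOpen⟩

/-- The space `H = {u ∈ L²(Ω)ᴺ : ∇ · u = 0 in Ω, u · n = 0 on ∂Ω}`. The two conditions are taken
together in their weak form: by the definition of the normal trace of a square integrable
divergence free field through Green's formula, they say that `∫_Ω u · ∇q = 0` for all `q` that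
are smooth up to the boundary. -/
def H {N : ℕ} (Ω : Opens (E N)) : Set (L2 Ω) :=
  {u | ∀ q : E N → ℝ, ContDiff ℝ (⊤ : ℕ∞) q → HasCompactSupport q →
    ∫ x in (Ω : Set (E N)), ⟪u x, gradient q x⟫_ℝ = 0}

/-- Pairs consisting of a vector field `u` and of a family of `N` vector fields (the candidates for
`∂₁u, …, ∂_N u`), with the norm `(‖u‖² + ∑ᵢ ‖∂ᵢu‖²)^{1/2}` of `H¹(Ω)ᴺ`. -/
abbrev H1Pair {N : ℕ} (Ω : Opens (E N)) := WithLp 2 (L2 Ω × PiLp 2 (fun _ : Fin N => L2 Ω))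

/-- The space `H¹₀(Ω)ᴺ`: the closure, for the norm of `H¹`, of the smooth vector fields with
compact support in `Ω`. An element of it is recorded together with its weak gradient. -/
def H10 {N : ℕ} (Ω : Opens (E N)) : Submodule ℝ (H1Pair Ω) :=
  (Submodule.span ℝ {P : H1Pair Ω | ∃ φ : 𝓓(Ω, E N),
    (∀ᵐ x ∂(volume.restrict (Ω : Set (E N))), P.fst x = φ x) ∧
    ∀ i, ∀ᵐ x ∂(volume.restrict (Ω : Set (E N))), P.snd i x = (∂_{e i} φ) x}).topologicalClosure

/-- The space `V = {u ∈ H¹₀(Ω)ᴺ : ∇ · u = 0 in Ω}`, with the norm of `H¹`. -/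
def V {N : ℕ} (Ω : Opens (E N)) : Submodule ℝ (H1Pair Ω) where
  carrier := {P | P ∈ H10 Ω ∧
    ∀ᵐ x ∂(volume.restrict (Ω : Set (E N))), ∑ i : Fin N, P.snd i x i = 0}
  zero_mem' := by
    refine ⟨zero_mem _, ?_⟩
    have h : ∀ i : Fin N, ∀ᵐ x ∂(volume.restrict (Ω : Set (E N))),
        (0 : H1Pair Ω).snd i x = 0 := fun i => Lp.coeFn_zero _ _ _
    filter_upwards [ae_all_iff.2 h] with x hx
    simp only [hx]
    simp
  add_mem' := by
    rintro P R ⟨hP, hP'⟩ ⟨hR, hR'⟩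
    refine ⟨add_mem hP hR, ?_⟩
    have h : ∀ i : Fin N, ∀ᵐ x ∂(volume.restrict (Ω : Set (E N))),
        (P + R).snd i x = P.snd i x + R.snd i x := fun i => Lp.coeFn_add _ _
    filter_upwards [ae_all_iff.2 h, hP', hR'] with x hx h1 h2
    simp only [hx, PiLp.add_apply, Finset.sum_add_distrib, h1, h2, add_zero]
  smul_mem' := by
    rintro c P ⟨hP, hP'⟩
    refine ⟨Submodule.smul_mem _ c hP, ?_⟩
    have h : ∀ i : Fin N, ∀ᵐ x ∂(volume.restrict (Ω : Set (E N))),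
        (c • P).snd i x = c • P.snd i x := fun i => Lp.coeFn_smul _ _
    filter_upwards [ae_all_iff.2 h, hP'] with x hx h1
    simp only [hx, PiLp.smul_apply, smul_eq_mul, ← Finset.mul_sum, h1, mul_zero]

namespace V

variable {N : ℕ} {Ω : Opens (E N)}

/-- The vector field underlying an element of `V`. -/
def field (u : V Ω) : L2 Ω := u.1.fst

/-- The weak partial derivative `∂ᵢu` of an element of `V`. -/
def partialDeriv (u : V Ω) (i : Fin N) : L2 Ω := u.1.snd i

/-- The scalar product `(∇u, ∇w) = ∑ᵢ (∂ᵢu, ∂ᵢw)`. -/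
def gradInner (u w : V Ω) : ℝ := ∑ i, ⟪partialDeriv u i, partialDeriv w i⟫_ℝ

end V

/-- `((z · ∇)u, w) = ∫_Ω ∑ᵢ zᵢ ∂ᵢu · w dx`. -/
def convection {N : ℕ} {Ω : Opens (E N)} (z : L2 Ω) (u w : V Ω) : ℝ :=
  ∫ x in (Ω : Set (E N)), ∑ i, z x i * ⟪V.partialDeriv u i x, V.field w x⟫_ℝ

/-- `y ∈ L²(0, T; V)`, with `Y` the corresponding square integrable map into `V`. -/
def IsL2V {N : ℕ} {Ω : Opens (E N)} (T : ℝ) (y : ℝ → L2 Ω) (Y : ℝ → V Ω) : Prop :=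
  MemLp Y 2 (timeMeasure T) ∧ ∀ᵐ t ∂(timeMeasure T), V.field (Y t) = y t

/-- The momentum equation `y_t - Δy + (z · ∇)y + ∇p = v 1_ω` for a velocity field
`y ∈ L²(0, T; V)`, where `Y` is `y` as a map into `V`, and a pressure `p ∈ 𝓓'(Q)`. The first part is
the equation in `V'`, in the sense of distributions on `(0, T)`; the second part is the equation
with its pressure, component by component, in the sense of distributions on `Q`. -/
def MomentumEquation {N : ℕ} (T : ℝ) (Ω ω : Opens (E N)) (y : ℝ → L2 Ω) (Y : ℝ → V Ω)
    (z : ℝ → L2 Ω) (p : 𝓓'(cylinder T Ω, ℝ)) (v : Control T ω) : Prop :=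
  (∀ w : V Ω, ∀ ψ : ℝ → ℝ, ContDiff ℝ (⊤ : ℕ∞) ψ → HasCompactSupport ψ → tsupport ψ ⊆ Ioo 0 T →
    ∫ t in Ioo 0 T, (-(deriv ψ t * ⟪y t, V.field w⟫_ℝ)
        + ψ t * (V.gradInner (Y t) w + convection (z t) (Y t) w))
      = ∫ t in Ioo 0 T, ψ t * ∫ x in (ω : Set (E N)), ⟪v t x, V.field w x⟫_ℝ) ∧
  (∀ j : Fin N, ∀ φ : 𝓓(cylinder T Ω, ℝ),
    (∫ t in Ioo 0 T, ∫ x in (Ω : Set (E N)),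
        (-(y t x j * (∂_{((1 : ℝ), (0 : E N))} φ) (t, x))
          + ∑ i, V.partialDeriv (Y t) i x j * (∂_{((0 : ℝ), (e i : E N))} φ) (t, x)
          + (∑ i, z t x i * V.partialDeriv (Y t) i x j) * φ (t, x)))
        + (∂_{((0 : ℝ), (e j : E N))} p) φ
      = ∫ t in Ioo 0 T, ∫ x in (ω : Set (E N)), v t x j * φ (t, x))

/-- The filter equation `z - α²Δz + ∇π = y` for `z ∈ L²(0, T; V)`, where `Z` is `z` as a map into
`V`, and `π ∈ 𝓓'(Q)`: the equation in `V'` for almost all times, and the equation with its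
pressure, component by component, in the sense of distributions on `Q`. -/
def FilterEquation {N : ℕ} (T : ℝ) (Ω : Opens (E N)) (α : ℝ) (y z : ℝ → L2 Ω) (Z : ℝ → V Ω)
    (π : 𝓓'(cylinder T Ω, ℝ)) : Prop :=
  (∀ᵐ t ∂(timeMeasure T), ∀ w : V Ω,
    ⟪z t, V.field w⟫_ℝ + α ^ 2 * V.gradInner (Z t) w = ⟪y t, V.field w⟫_ℝ) ∧
  (∀ j : Fin N, ∀ φ : 𝓓(cylinder T Ω, ℝ),
    (∫ t in Ioo 0 T, ∫ x in (Ω : Set (E N)),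
        (z t x j * φ (t, x)
          + α ^ 2 * ∑ i, V.partialDeriv (Z t) i x j * (∂_{((0 : ℝ), (e i : E N))} φ) (t, x)))
        + (∂_{((0 : ℝ), (e j : E N))} π) φ
      = ∫ t in Ioo 0 T, ∫ x in (Ω : Set (E N)), y t x j * φ (t, x))

/-- `(y, p, z, π)` is the state of the controlled Leray-`α` system
`y_t - Δy + (z · ∇)y + ∇p = v 1_ω`, `z - α²Δz + ∇π = y`, `∇ · y = ∇ · z = 0` in `Q`,
`y = z = 0` on `∂Ω × (0, T)`, `y(0) = y₀`, associated with the control `v`: a weak solution with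
`y ∈ L²(0, T; V) ∩ C⁰([0, T]; H)` and `z ∈ L²(0, T; V)`. -/
structure IsLerayState {N : ℕ} (T : ℝ) (Ω ω : Opens (E N)) (α : ℝ) (y₀ : L2 Ω) (v : Control T ω)
    (y : ℝ → L2 Ω) (p : 𝓓'(cylinder T Ω, ℝ)) (z : ℝ → L2 Ω) (π : 𝓓'(cylinder T Ω, ℝ)) : Prop where
  continuousOn : ContinuousOn y (Icc 0 T)
  mem_H : ∀ t ∈ Icc 0 T, y t ∈ H Ω
  initial : y 0 = y₀
  equations : ∃ Y Z : ℝ → V Ω, IsL2V T y Y ∧ IsL2V T z Z ∧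
    MomentumEquation T Ω ω y Y z p v ∧ FilterEquation T Ω α y z Z π

/-- `(y, p)` is a state of the controlled Navier–Stokes system
`y_t - Δy + (y · ∇)y + ∇p = v 1_ω`, `∇ · y = 0` in `Q`, `y = 0` on `∂Ω × (0, T)`, `y(0) = y₀`,
associated with the control `v`: a weak solution with `y ∈ L²(0, T; V)` that is weakly continuous
from `[0, T]` into `H` (hence bounded in `H`). -/
structure IsNavierStokesState {N : ℕ} (T : ℝ) (Ω ω : Opens (E N)) (y₀ : L2 Ω) (v : Control T ω)
    (y : ℝ → L2 Ω) (p : 𝓓'(cylinder T Ω, ℝ)) : Prop where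
  weaklyContinuousOn : ∀ h : L2 Ω, ContinuousOn (fun t => ⟪y t, h⟫_ℝ) (Icc 0 T)
  mem_H : ∀ t ∈ Icc 0 T, y t ∈ H Ω
  initial : y 0 = y₀
  equations : ∃ Y : ℝ → V Ω, IsL2V T y Y ∧ MomentumEquation T Ω ω y Y y p v

/-- Weak-* convergence in `L^∞(0, T; L²(ω)ᴺ)`, the dual space of `L¹(0, T; L²(ω)ᴺ)`. -/
def TendstoWeakStar {N : ℕ} {T : ℝ} {ω : Opens (E N)} (v : ℕ → Control T ω) (v' : Control T ω) :
    Prop :=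
  ∀ g : Lp (L2 ω) 1 (timeMeasure T),
    Tendsto (fun n => ∫ t in Ioo 0 T, ⟪v n t, g t⟫_ℝ) atTop
      (𝓝 (∫ t in Ioo 0 T, ⟪v' t, g t⟫_ℝ))

/-- Strong convergence in `L²(Q)ᴺ = L²(0, T; L²(Ω)ᴺ)`. -/
def TendstoL2 {N : ℕ} {Ω : Opens (E N)} (T : ℝ) (y : ℕ → ℝ → L2 Ω) (y' : ℝ → L2 Ω) : Prop :=
  Tendsto (fun n => eLpNorm (fun t => y n t - y' t) 2 (timeMeasure T)) atTop (𝓝 0)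

end LerayAlpha

end

noncomputable section

namespace LerayAlpha

/-! ### Weak compactness in Hilbert spaces -/

/-! The argument is compactness, with bounds uniform in `α`. Testing the momentum equation with `y`
removes the convection term, because the transport field is divergence free (`convForm_self`); the
energy then bounds `y_n` in `L^∞(L²) ∩ L²(V)` by the datum, the control bound and `T`. The energy
equality (`energy_equality`) requires `y_t ∈ L²(V')`, which holds for each fixed `α` because the
filter puts `z` in `L^∞(V)`; that bound degenerates as `α → 0` but is used only qualitatively.
Testing the filter equation with `z` and with `y` (`filter_estimates`) gives `‖z‖_V ≤ ‖y‖_V` and `|z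
- y| ≤ α ‖y‖_V`, so `z_n` and `y_n` have the same strong limit in `L²(Q)`.

For compactness in time no bound of `y_t` in a dual space is used. Given `w ∈ V`, its `L⁴`
representative is approximated by a bounded field (`exists_convV_approx`). The convection term
tested with `w` is then at most a multiple of `|z| ‖y‖_V` plus `δ ‖y‖_V²`, so the derivative of
`(y_n, w)` is dominated by `K_δ + δ ‖y_n‖_V²`, and the functions `(y_n, w)` are equicontinuous
(`weaklyEquicontinuous_of_integral`). With a diagonal extraction at rational times, `y_n(t)`
converges weakly for every `t ∈ [0, T]`, which carries both the initial condition and the null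
condition at `T` to the limit. An inequality of Ehrling type, in which averages over small balls
play the role of the compact operator, turns this into strong convergence in `L²(Q)`
(`tendsto_eLpNorm_of_compactness`).

In the equation `z_n` converges strongly in `L²` and `∇y_n` weakly, so the convection term passes to
the limit against bounded test fields; test fields in `V` are reached by the same approximation,
with an error uniform in `n` (`MomentumLimit.weak`).

The pressures need not converge, since they are determined only up to distributions in time; their
gradients do converge. On a connected domain a test function minus its spatial mean times a fixed
bump is a divergence, locally by averaging translations (`GradLim.exists_localAt`) and globally by
gluing (`GradLim.exists_limLe`). Hence the pressures converge on such differences, and their limit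
is a distribution with the required gradient (`GradLim.exists_distribution`). -/

/-- A countable product of compact intervals is compact and metrizable, which replaces an explicit
diagonal argument. -/
theorem exists_subseq_forall_tendsto {ι : Type*} [Countable ι] (a : ι → ℕ → ℝ)
    (ha : ∀ i, ∃ C, ∀ n, |a i n| ≤ C) :
    ∃ φ : ℕ → ℕ, StrictMono φ ∧ ∀ i, ∃ l, Tendsto (fun n => a i (φ n)) atTop (𝓝 l) := by
  choose C hC using ha
  have hK : IsCompact (Set.pi univ fun i => Icc (-C i) (C i)) :=
    isCompact_univ_pi fun i => isCompact_Icc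
  obtain ⟨l, -, φ, hφ, h⟩ := hK.tendsto_subseq (x := fun n i => a i n)
    (fun n i _ => abs_le.1 (hC i n))
  exact ⟨φ, hφ, fun i => ⟨l i, (tendsto_pi_nhds.1 h) i⟩⟩

/-- The vectors against which `x n` has Cauchy inner products form a closed subspace, hence contain
the closed span `W` of `S`. As `x n ∈ W`, an arbitrary `h` matters only through its projection onto
`W`, so separability of `X` plays no role. The limit functional is bounded by `C`, and Riesz
represents it. -/
theorem exists_weak_limit {X : Type*} [NormedAddCommGroup X] [InnerProductSpace ℝ X]
    [CompleteSpace X] {x : ℕ → X} {C : ℝ} (hC : ∀ n, ‖x n‖ ≤ C) {S : Set X}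
    (hS : ∀ h ∈ S, ∃ l, Tendsto (fun n => ⟪x n, h⟫_ℝ) atTop (𝓝 l))
    (hx : ∀ n, x n ∈ (Submodule.span ℝ S).topologicalClosure) :
    ∃ x', ∀ h, Tendsto (fun n => ⟪x n, h⟫_ℝ) atTop (𝓝 ⟪x', h⟫_ℝ) := by
  have hC0 : 0 ≤ C := (norm_nonneg _).trans (hC 0)
  let G : Submodule ℝ X :=
    { carrier := {h | CauchySeq fun n => ⟪x n, h⟫_ℝ}
      zero_mem' := by
        have : (fun n => ⟪x n, (0 : X)⟫_ℝ) = fun _ => (0 : ℝ) := by simp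
        simp only [mem_ofPred_eq, this]
        exact tendsto_const_nhds.cauchySeq
      add_mem' := fun {a b} ha hb => by
        have : (fun n => ⟪x n, a + b⟫_ℝ) = fun n => ⟪x n, a⟫_ℝ + ⟪x n, b⟫_ℝ := by
          ext n; rw [inner_add_right]
        simp only [mem_ofPred_eq, this]
        exact CauchySeq.add ha hb
      smul_mem' := fun c a ha => by
        obtain ⟨l, hl⟩ := cauchySeq_tendsto_of_complete ha
        have : (fun n => ⟪x n, c • a⟫_ℝ) = fun n => c * ⟪x n, a⟫_ℝ := by
          ext n; rw [real_inner_smul_right]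
        simp only [mem_ofPred_eq, this]
        exact (hl.const_mul c).cauchySeq }
  have hGc : IsClosed (G : Set X) := by
    refine isClosed_of_closure_subset fun h hh => ?_
    change CauchySeq fun n => ⟪x n, h⟫_ℝ
    refine Metric.cauchySeq_iff.2 fun ε hε => ?_
    obtain ⟨g, hg, hgh⟩ := Metric.mem_closure_iff.1 hh (ε / (3 * (C + 1))) (by positivity)
    obtain ⟨N, hN⟩ := Metric.cauchySeq_iff.1 (show CauchySeq fun n => ⟪x n, g⟫_ℝ from hg)
      (ε / 3) (by positivity)
    refine ⟨N, fun m hm n hn => ?_⟩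
    have key : ∀ n, |⟪x n, h⟫_ℝ - ⟪x n, g⟫_ℝ| ≤ ε / 3 := fun n => by
      rw [← inner_sub_right]
      refine (abs_real_inner_le_norm _ _).trans ?_
      rw [dist_eq_norm] at hgh
      calc ‖x n‖ * ‖h - g‖ ≤ (C + 1) * (ε / (3 * (C + 1))) := by
            gcongr
            linarith [hC n]
        _ = ε / 3 := by field_simp
    have h1 := hN m hm n hn
    rw [Real.dist_eq] at h1 ⊢
    have h2 := abs_le.1 (key m)
    have h3 := abs_le.1 (key n)
    have h4 := abs_lt.1 h1
    rw [abs_lt]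
    constructor <;> linarith
  have hSG : (Submodule.span ℝ S).topologicalClosure ≤ G :=
    Submodule.topologicalClosure_minimal _ (Submodule.span_le.2 fun h hh => by
      obtain ⟨l, hl⟩ := hS h hh
      exact hl.cauchySeq) hGc
  set W := (Submodule.span ℝ S).topologicalClosure with hW
  have : CompleteSpace W := (Submodule.isClosed_topologicalClosure _).completeSpace_coe
  have hall : ∀ h, ∃ l, Tendsto (fun n => ⟪x n, h⟫_ℝ) atTop (𝓝 l) := fun h => by
    have h1 : ∀ n, ⟪x n, h⟫_ℝ = ⟪x n, (W.orthogonalProjectionOnto h : X)⟫_ℝ := fun n => by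
      have h2 := W.sub_starProjection_mem_orthogonal h
      have h3 := (Submodule.mem_orthogonal W _).1 h2 (x n) (hx n)
      rw [inner_sub_right, sub_eq_zero] at h3
      exact h3
    simp_rw [h1]
    exact cauchySeq_tendsto_of_complete (hSG (W.orthogonalProjectionOnto h).2)
  choose L hL using hall
  let ℓ : X →ₗ[ℝ] ℝ :=
    { toFun := L
      map_add' := fun a b => tendsto_nhds_unique (hL (a + b)) (by
        simp_rw [inner_add_right]; exact (hL a).add (hL b))
      map_smul' := fun c a => tendsto_nhds_unique (hL (c • a)) (by
        simp_rw [real_inner_smul_right]; exact (hL a).const_mul c) }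
  let ℓ' : X →L[ℝ] ℝ := ℓ.mkContinuous C fun h =>
    le_of_tendsto (hL h).norm (Eventually.of_forall fun n =>
      (norm_inner_le_norm (𝕜 := ℝ) (x n) h).trans (by gcongr; exact hC n))
  refine ⟨(InnerProductSpace.toDual ℝ X).symm ℓ', fun h => ?_⟩
  rw [InnerProductSpace.toDual_symm_apply]
  exact hL h

/-- If all the inner products of a bounded sequence with its own terms converge, then the
sequence converges weakly. -/
theorem exists_weak_limit_of_self {X : Type*} [NormedAddCommGroup X] [InnerProductSpace ℝ X]
    [CompleteSpace X] {x : ℕ → X} {C : ℝ} (hC : ∀ n, ‖x n‖ ≤ C) {ξ : ℕ → X}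
    (hS : ∀ m, ∃ l, Tendsto (fun n => ⟪x n, ξ m⟫_ℝ) atTop (𝓝 l))
    (hx : ∀ n, x n ∈ range ξ) :
    ∃ x', ∀ h, Tendsto (fun n => ⟪x n, h⟫_ℝ) atTop (𝓝 ⟪x', h⟫_ℝ) :=
  exists_weak_limit hC (S := range ξ) (by rintro _ ⟨m, rfl⟩; exact hS m)
    fun n => Submodule.le_topologicalClosure _ (Submodule.subset_span (hx n))

/-! ### Weak convergence of square integrable maps -/

section WeakL2

variable {α X : Type*} [MeasurableSpace α] {μ : Measure α}
  [NormedAddCommGroup X] [NormedSpace ℝ X]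

theorem integrable_clm_apply {ℓ : α → X →L[ℝ] ℝ} {Y : α → X} (hℓ : MemLp ℓ 2 μ)
    (hY : MemLp Y 2 μ) : Integrable (fun t => ℓ t (Y t)) μ :=
  memLp_one_iff_integrable.1
    ((ContinuousLinearMap.id ℝ (X →L[ℝ] ℝ)).memLp_of_bilin 1 hℓ hY)

theorem abs_integral_clm_apply_le {ℓ : α → X →L[ℝ] ℝ} {Y : α → X} (hℓ : MemLp ℓ 2 μ)
    (hY : MemLp Y 2 μ) :
    |∫ t, ℓ t (Y t) ∂μ| ≤ (eLpNorm ℓ 2 μ).toReal * (eLpNorm Y 2 μ).toReal := by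
  have h1 : eLpNorm (fun t => ℓ t (Y t)) 1 μ ≤ eLpNorm ℓ 2 μ * eLpNorm Y 2 μ := by
    have := eLpNorm_le_eLpNorm_mul_eLpNorm_of_nnnorm (p := 2) (q := 2) (r := 1) hℓ.1 hY.1
      (fun l x => l x) 1 (Eventually.of_forall fun t => by
        simpa using (ℓ t).le_opNNNorm (Y t))
    simpa using this
  rw [← ENNReal.toReal_mul, ← Real.norm_eq_abs]
  have hi := integrable_clm_apply hℓ hY
  refine (norm_integral_le_integral_norm _).trans ?_
  rw [integral_norm_eq_lintegral_enorm hi.1, ← eLpNorm_one_eq_lintegral_enorm]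
  exact ENNReal.toReal_mono (ENNReal.mul_ne_top hℓ.2.ne hY.2.ne) h1

/-- Weak convergence in `L²(μ; X)`, expressed on functions. -/
def WeakTendsto (μ : Measure α) (Y : ℕ → α → X) (Y' : α → X) : Prop :=
  ∀ ℓ : α → X →L[ℝ] ℝ, MemLp ℓ 2 μ →
    Tendsto (fun n => ∫ t, ℓ t (Y n t) ∂μ) atTop (𝓝 (∫ t, ℓ t (Y' t) ∂μ))

/-- Strong times weak: split `ℓ n = (ℓ n - ℓ') + ℓ'` and use the uniform bound `M` on the first
part. This is what passes the convection term to the limit. -/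
theorem WeakTendsto.tendsto_integral {Y : ℕ → α → X} {Y' : α → X} (h : WeakTendsto μ Y Y')
    {M : ℝ≥0∞} (hM : M ≠ ∞) (hY : ∀ n, MemLp (Y n) 2 μ) (hYM : ∀ n, eLpNorm (Y n) 2 μ ≤ M)
    {ℓ : ℕ → α → X →L[ℝ] ℝ} {ℓ' : α → X →L[ℝ] ℝ} (hℓ : ∀ n, MemLp (ℓ n) 2 μ)
    (hℓ' : MemLp ℓ' 2 μ)
    (hℓℓ : Tendsto (fun n => eLpNorm (fun t => ℓ n t - ℓ' t) 2 μ) atTop (𝓝 0)) :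
    Tendsto (fun n => ∫ t, ℓ n t (Y n t) ∂μ) atTop (𝓝 (∫ t, ℓ' t (Y' t) ∂μ)) := by
  have h1 : ∀ n, ∫ t, ℓ n t (Y n t) ∂μ
      = ∫ t, (ℓ n t - ℓ' t) (Y n t) ∂μ + ∫ t, ℓ' t (Y n t) ∂μ := fun n => by
    have h2 := integral_add (integrable_clm_apply ((hℓ n).sub hℓ') (hY n))
      (integrable_clm_apply hℓ' (hY n))
    simp only [Pi.sub_apply] at h2
    rw [← h2]
    simp
  simp_rw [h1]
  have h2 : Tendsto (fun n => ∫ t, (ℓ n t - ℓ' t) (Y n t) ∂μ) atTop (𝓝 0) := by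
    have h3 : Tendsto (fun n => (eLpNorm (fun t => ℓ n t - ℓ' t) 2 μ).toReal * M.toReal) atTop
        (𝓝 0) := by
      have := ((ENNReal.tendsto_toReal ENNReal.zero_ne_top).comp hℓℓ).mul_const M.toReal
      simpa using this
    refine squeeze_zero_norm (fun n => ?_) h3
    refine (abs_integral_clm_apply_le ((hℓ n).sub hℓ') (hY n)).trans ?_
    exact mul_le_mul_of_nonneg_left (ENNReal.toReal_mono hM (hYM n)) ENNReal.toReal_nonneg
  simpa using h2.add (h ℓ' hℓ')

end WeakL2

/-- The Riesz isomorphism turns a square integrable family of functionals into an element of `L²(μ;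
X)`. -/
theorem weakTendsto_of_inner {α X : Type*} [MeasurableSpace α] {μ : Measure α}
    [NormedAddCommGroup X] [InnerProductSpace ℝ X] [CompleteSpace X] {Y : ℕ → α → X}
    {Y' : Lp X 2 μ} (hY : ∀ n, MemLp (Y n) 2 μ)
    (h : ∀ g : Lp X 2 μ, Tendsto (fun n => ⟪(hY n).toLp (Y n), g⟫_ℝ) atTop (𝓝 ⟪Y', g⟫_ℝ)) :
    WeakTendsto μ Y Y' := by
  intro ℓ hℓ
  let r : α → X := fun t => (InnerProductSpace.toDual ℝ X).symm (ℓ t)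
  have hr : MemLp r 2 μ := by
    refine hℓ.of_le ((InnerProductSpace.toDual ℝ X).symm.continuous.comp_aestronglyMeasurable hℓ.1)
      (Eventually.of_forall fun t => ?_)
    simp [r]
  have h1 := h (hr.toLp r)
  have h2 : ∀ n, ⟪(hY n).toLp (Y n), hr.toLp r⟫_ℝ = ∫ t, ℓ t (Y n t) ∂μ := fun n => by
    rw [L2.inner_def]
    refine integral_congr_ae ?_
    filter_upwards [(hY n).coeFn_toLp, hr.coeFn_toLp] with t h1 h2
    rw [h1, h2, real_inner_comm]
    exact InnerProductSpace.toDual_symm_apply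
  have h3 : ⟪Y', hr.toLp r⟫_ℝ = ∫ t, ℓ t (Y' t) ∂μ := by
    rw [L2.inner_def]
    refine integral_congr_ae ?_
    filter_upwards [hr.coeFn_toLp] with t h2
    rw [h2, real_inner_comm]
    exact InnerProductSpace.toDual_symm_apply
  simp_rw [h2, h3] at h1
  exact h1

/-! ### Weak derivatives in time -/

/-- The du Bois-Reymond lemma: `u` minus the primitive of `G` is continuous with zero weak
derivative, hence constant on `(0, T)`, and on `[0, T]` by continuity. -/
theorem intervalIntegral_eq_of_weak_deriv {T : ℝ} (hT : 0 < T) {u G : ℝ → ℝ}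
    (hu : ContinuousOn u (Icc 0 T)) (hG : IntegrableOn G (Ioo 0 T))
    (h : ∀ ψ : ℝ → ℝ, ContDiff ℝ (⊤ : ℕ∞) ψ → HasCompactSupport ψ → tsupport ψ ⊆ Ioo 0 T →
      -∫ t in Ioo 0 T, deriv ψ t * u t = ∫ t in Ioo 0 T, ψ t * G t)
    {s t : ℝ} (hs : s ∈ Icc 0 T) (ht : t ∈ Icc 0 T) :
    u t - u s = ∫ τ in s..t, G τ := by
  have hGi : IntervalIntegrable G volume 0 T :=
    (intervalIntegrable_iff_integrableOn_Ioo_of_le hT.le).2 hG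
  have hioo : ∀ f : ℝ → ℝ, ∫ t in Ioo 0 T, f t = ∫ t in (0 : ℝ)..T, f t := fun f => by
    rw [intervalIntegral.integral_of_le hT.le, integral_Ioc_eq_integral_Ioo]
  set P : ℝ → ℝ := fun t => ∫ τ in (0 : ℝ)..t, G τ with hP
  have hPac : AbsolutelyContinuousOnInterval P 0 T :=
    hGi.absolutelyContinuousOnInterval_intervalIntegral (by simp)
  have hPc : ContinuousOn P (Icc 0 T) := by
    have := hPac.continuousOn
    rwa [uIcc_of_le hT.le] at this
  set U : ℝ → ℝ := fun t => u t - P t with hU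
  have hUc : ContinuousOn U (Icc 0 T) := hu.sub hPc
  have hint : ∀ ψ : ℝ → ℝ, Continuous ψ → ∀ f : ℝ → ℝ, ContinuousOn f (Icc 0 T) →
      Integrable (fun t => ψ t * f t) (volume.restrict (Ioo 0 T)) := fun ψ hψ f hf =>
    ((hψ.continuousOn.mul hf).integrableOn_Icc).mono_set Ioo_subset_Icc_self
  have key : ∀ ψ : ℝ → ℝ, ContDiff ℝ (⊤ : ℕ∞) ψ → HasCompactSupport ψ → tsupport ψ ⊆ Ioo 0 T →
      ∫ t in Ioo 0 T, deriv ψ t * U t = 0 := by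
    intro ψ h1 h2 h3
    have hd : Continuous (deriv ψ) := h1.continuous_deriv (by simp)
    have hψ0 : ψ 0 = 0 := image_eq_zero_of_notMem_tsupport fun h => (h3 h).1.false
    have hψT : ψ T = 0 := image_eq_zero_of_notMem_tsupport fun h => (h3 h).2.false
    have hψac : AbsolutelyContinuousOnInterval ψ 0 T :=
      (h1.of_le (by norm_cast)).contDiffOn.absolutelyContinuousOnInterval
    have e1 := hψac.integral_mul_deriv_eq_deriv_mul hPac
    have e2 : ∫ x in (0 : ℝ)..T, ψ x * deriv P x = ∫ x in (0 : ℝ)..T, ψ x * G x := by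
      refine intervalIntegral.integral_congr_ae ?_
      filter_upwards [hGi.ae_hasDerivAt_integral] with x hx hx'
      rw [(hx (uIoc_subset_uIcc hx') 0 (by simp)).deriv]
    rw [e2, hψ0, hψT, ← hioo, ← hioo, ← h ψ h1 h2 h3] at e1
    have e3 : ∫ t in Ioo 0 T, deriv ψ t * U t
        = (∫ t in Ioo 0 T, deriv ψ t * u t) - ∫ t in Ioo 0 T, deriv ψ t * P t := by
      rw [← integral_sub (hint _ hd _ hu) (hint _ hd _ hPc)]
      simp [hU, mul_sub]
    rw [e3]
    linarith
  -- a fixed bump function of integral one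
  let η : ContDiffBump (T / 2) := ⟨T / 8, T / 4, by positivity, by linarith⟩
  have hηs : tsupport (η.normed volume) ⊆ Ioo 0 T := by
    rw [η.tsupport_normed_eq]
    intro x hx
    rw [Metric.mem_closedBall, Real.dist_eq, abs_le] at hx
    have h1 : η.rOut = T / 4 := rfl
    constructor <;> linarith [hx.1, hx.2]
  have hηd : ContDiff ℝ (⊤ : ℕ∞) (η.normed volume) := η.contDiff_normed
  -- The mean of `U` against the normalized bump is the only possible value of the constant.
  set c : ℝ := ∫ t in Ioo 0 T, η.normed volume t * U t with hc
  have hφ : ∀ φ : ℝ → ℝ, ContDiff ℝ (⊤ : ℕ∞) φ → HasCompactSupport φ → tsupport φ ⊆ Ioo 0 T →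
      ∫ t, φ t • (U t - c) = 0 := by
    intro φ h1 h2 h3
    set m : ℝ := ∫ t, φ t with hm
    -- Subtracting `m` times the bump makes the integral zero, so that the primitive of `θ` has
    -- compact support and is admissible in `key`.
    set θ : ℝ → ℝ := fun t => φ t - m * η.normed volume t with hθ
    have hθd : ContDiff ℝ (⊤ : ℕ∞) θ := h1.sub (contDiff_const.mul hηd)
    set K := tsupport φ ∪ tsupport (η.normed volume) with hK
    have hKc : IsCompact K := h2.isCompact.union η.hasCompactSupport_normed.isCompact
    have hKs : K ⊆ Ioo 0 T := union_subset h3 hηs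
    have hKn : K.Nonempty := by
      refine ⟨T / 2, Or.inr ?_⟩
      rw [η.tsupport_normed_eq]
      exact Metric.mem_closedBall_self η.rOut_pos.le
    -- The convex hull `[a, b]` of `K` is needed because the primitive of `θ` may be nonzero in the
    -- gaps of `K`.
    set a := sInf K
    set b := sSup K
    have ha : a ∈ K := hKc.sInf_mem hKn
    have hb : b ∈ K := hKc.sSup_mem hKn
    have hθ0 : ∀ t, t ∉ Icc a b → θ t = 0 := by
      intro t ht
      have : t ∉ K := fun h' => ht ⟨csInf_le hKc.bddBelow h', le_csSup hKc.bddAbove h'⟩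
      rw [hK, mem_union, not_or] at this
      simp [hθ, image_eq_zero_of_notMem_tsupport this.1, image_eq_zero_of_notMem_tsupport this.2]
    have hθi : ∫ t, θ t = 0 := by
      rw [hθ, integral_sub (h1.continuous.integrable_of_hasCompactSupport h2)
        ((hηd.continuous.integrable_of_hasCompactSupport η.hasCompactSupport_normed).const_mul m),
        integral_const_mul, η.integral_normed]
      simp [hm]
    set ψ : ℝ → ℝ := fun t => ∫ τ in (0 : ℝ)..t, θ τ with hψ
    have hψd : ∀ t, HasDerivAt ψ (θ t) t := fun t =>
      intervalIntegral.integral_hasDerivAt_right (hθd.continuous.intervalIntegrable _ _)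
        hθd.continuous.stronglyMeasurable.stronglyMeasurableAtFilter hθd.continuous.continuousAt
    have hψ' : deriv ψ = θ := funext fun t => (hψd t).deriv
    have hψs : ContDiff ℝ (⊤ : ℕ∞) ψ := by
      refine contDiff_infty_iff_deriv.2 ⟨fun t => (hψd t).differentiableAt, ?_⟩
      rw [hψ']; exact hθd
    have hψ0 : ∀ t, t ∉ Icc a b → ψ t = 0 := by
      intro t ht
      rcases lt_or_ge t a with hta | hta
      · rw [hψ]
        refine (intervalIntegral.integral_congr fun x hx => ?_).trans
          intervalIntegral.integral_zero
        refine hθ0 x fun hx' => ?_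
        rcases le_total 0 t with h0 | h0
        · rw [uIcc_of_le h0] at hx; linarith [hx.2, hx'.1]
        · rw [uIcc_of_ge h0] at hx; linarith [hx.2, hx'.1, (hKs ha).1]
      · have htb : b < t := by
          by_contra hcon
          exact ht ⟨hta, not_lt.1 hcon⟩
        rw [← hθi]
        refine intervalIntegral.integral_eq_integral_of_support_subset fun x hx => ?_
        have hx' : x ∈ Icc a b := by
          by_contra hcon
          exact hx (hθ0 x hcon)
        exact ⟨(hKs ha).1.trans_le hx'.1, (hx'.2.trans_lt htb).le⟩
    have hψt : tsupport ψ ⊆ Icc a b :=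
      closure_minimal (fun x hx => by by_contra hcon; exact hx (hψ0 x hcon)) isClosed_Icc
    have e := key ψ hψs (isCompact_Icc.of_isClosed_subset (isClosed_tsupport _) hψt)
      (hψt.trans fun x hx => ⟨(hKs ha).1.trans_le hx.1, hx.2.trans_lt (hKs hb).2⟩)
    rw [hψ'] at e
    have e1 : ∫ t in Ioo 0 T, θ t * U t = (∫ t in Ioo 0 T, φ t * U t) - m * c := by
      rw [hc, ← integral_const_mul, ← integral_sub (hint _ h1.continuous _ hUc)
        ((hint _ hηd.continuous _ hUc).const_mul m)]
      simp [hθ, sub_mul, mul_assoc]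
    have e2 : ∫ t, φ t • (U t - c) = ∫ t in Ioo 0 T, φ t * (U t - c) := by
      rw [setIntegral_eq_integral_of_forall_compl_eq_zero]
      · rfl
      · intro x hx
        rw [image_eq_zero_of_notMem_tsupport fun h' => hx (h3 h'), zero_mul]
    have e3 : ∫ t in Ioo 0 T, φ t = m := by
      rw [setIntegral_eq_integral_of_forall_compl_eq_zero]
      intro x hx
      rw [image_eq_zero_of_notMem_tsupport fun h' => hx (h3 h')]
    rw [e2]
    simp_rw [mul_sub]
    rw [integral_sub (hint _ h1.continuous _ hUc) (hint _ h1.continuous _ continuousOn_const),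
      integral_mul_const, e3]
    linarith
  have hloc : LocallyIntegrableOn (fun t => U t - c) (Ioo 0 T) := by
    refine IntegrableOn.locallyIntegrableOn ?_
    exact ((hUc.sub continuousOn_const).integrableOn_Icc).mono_set Ioo_subset_Icc_self
  have hae := isOpen_Ioo.ae_eq_zero_of_integral_contDiff_smul_eq_zero hloc hφ
  have hUconst : ∀ x ∈ Icc 0 T, U x = c := by
    have h1 : ∀ x ∈ Ioo 0 T, U x = c := by
      have h2 := Measure.eqOn_open_of_ae_eq (μ := volume) (f := U) (g := fun _ => c)
        ((ae_restrict_iff' measurableSet_Ioo).2 (by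
          filter_upwards [hae] with x hx hx'
          exact sub_eq_zero.1 (hx hx'))) isOpen_Ioo (hUc.mono Ioo_subset_Icc_self)
        continuousOn_const
      exact h2
    have h3 : EqOn U (fun _ => c) (closure (Ioo 0 T)) := by
      refine EqOn.of_subset_closure h1 ?_ continuousOn_const subset_closure subset_rfl
      rwa [closure_Ioo hT.ne]
    rw [closure_Ioo hT.ne] at h3
    exact h3
  have e1 := hUconst s hs
  have e2 := hUconst t ht
  have hsub : ∀ {x : ℝ}, x ∈ Icc 0 T → IntervalIntegrable G volume 0 x := fun {x} hx =>
    hGi.mono_set (by rw [uIcc_of_le hT.le, uIcc_of_le hx.1]; exact Icc_subset_Icc_right hx.2)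
  rw [← intervalIntegral.integral_interval_sub_left (hsub ht) (hsub hs)]
  simp only [hU, hP] at e1 e2
  linarith

end LerayAlpha

end

noncomputable section

namespace LerayAlpha

/-! ### The energy equality -/

theorem memLp_indicator {α E : Type*} [MeasurableSpace α] {μ : Measure α} [NormedAddCommGroup E]
    {s : Set α} (hs : MeasurableSet s) {f : α → E} {p : ℝ≥0∞} (hf : MemLp f p (μ.restrict s)) :
    MemLp (s.indicator f) p μ :=
  (memLp_indicator_iff_restrict hs).2 hf

section Energy

variable {X Y : Type*} [NormedAddCommGroup X] [NormedSpace ℝ X]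

/-- Correlations of square integrable functions on the line depend continuously on the shift. -/
theorem continuous_integral_apply_shift {G : ℝ → X →L[ℝ] ℝ} {F : ℝ → X} (hG : MemLp G 2)
    (hF : MemLp F 2) : Continuous fun a : ℝ => ∫ s, G s (F (s + a)) := by
  let g : ℝ → C(ℝ, ℝ) := (ContinuousMap.mk (fun p : ℝ × ℝ => p.2 + p.1) (by fun_prop)).curry
  have hg : Continuous g := ContinuousMap.continuous _
  have hgm : ∀ a, MeasurePreserving (g a) volume volume := fun a =>
    measurePreserving_add_right volume a
  have h1 : Continuous fun a => Lp.compMeasurePreserving (g a) (hgm a) (hF.toLp F) :=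
    continuous_const.compMeasurePreservingLp hg hgm (by simp)
  let B := (ContinuousLinearMap.id ℝ (X →L[ℝ] ℝ)).lpPairing (volume : Measure ℝ) 2 2
  have h2 : ∀ a, ∫ s, G s (F (s + a))
      = B (hG.toLp G) (Lp.compMeasurePreserving (g a) (hgm a) (hF.toLp F)) := fun a => by
    rw [ContinuousLinearMap.lpPairing_eq_integral]
    refine integral_congr_ae ?_
    filter_upwards [hG.coeFn_toLp, Lp.coeFn_compMeasurePreserving (hF.toLp F) (hgm a),
      (hgm a).quasiMeasurePreserving.ae_eq_comp hF.coeFn_toLp] with s h1 h2 h3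
    rw [h1, h2, h3]
    rfl
  simp_rw [h2]
  exact (B (hG.toLp G)).continuous.comp h1

/-- Fubini after the substitution `τ = r - a`; integrability of the double integrand is that of the
convolution of `F` with the reflection of `G`. -/
theorem integral_integral_apply_shift {G : ℝ → X →L[ℝ] ℝ} {F : ℝ → X} (hG : Integrable G)
    (hF : Integrable F) {h : ℝ} (hh : 0 ≤ h) :
    ∫ a in (-h)..h, ∫ s, G s (F (s + a)) = ∫ r, ∫ τ in (r - h)..(r + h), G τ (F r) := by
  have hG' : Integrable (fun s => G (-s)) := hG.comp_neg
  have hi := Integrable.convolution_integrand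
    (ContinuousLinearMap.id ℝ (X →L[ℝ] ℝ)).flip hF hG'
  have h1 : ∀ a, ∫ s, G s (F (s + a)) = ∫ r, G (-(a - r)) (F r) := fun a => by
    rw [← integral_add_right_eq_self (fun r => G (-(a - r)) (F r)) a]
    simp
  rw [intervalIntegral.integral_of_le (by linarith)]
  simp_rw [h1]
  have hi' : Integrable (Function.uncurry fun a r => G (-(a - r)) (F r))
      ((volume.restrict (Ioc (-h) h)).prod volume) := by
    refine Integrable.mono_measure hi ?_
    exact Measure.prod_mono Measure.restrict_le_self le_rfl
  rw [integral_integral_swap hi']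
  refine integral_congr_ae (Eventually.of_forall fun r => ?_)
  simp only
  rw [← intervalIntegral.integral_of_le (by linarith)]
  have h2 := intervalIntegral.integral_comp_sub_left (a := -h) (b := h) (fun τ => G τ (F r)) r
  simp only [neg_sub, sub_neg_eq_add] at h2 ⊢
  exact h2

variable [NormedAddCommGroup Y] [InnerProductSpace ℝ Y]

/-- The energy equality: if `y` is continuous with values in `Y`, square integrable with values
in `X`, and its derivative is a square integrable function with values in the dual of `X`, then
`|y|²` is the primitive of twice the duality product of `y'` and `y`. -/
theorem energy_equality {T : ℝ} (hT : 0 < T) (ι : X →L[ℝ] Y) {y : ℝ → Y}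
    (hy : ContinuousOn y (Icc 0 T)) {F : ℝ → X} (hF : MemLp F 2 (timeMeasure T))
    (hFy : ∀ᵐ t ∂(timeMeasure T), ι (F t) = y t) {G : ℝ → X →L[ℝ] ℝ}
    (hG : MemLp G 2 (timeMeasure T))
    (h : ∀ w, ∀ s ∈ Icc 0 T, ∀ t ∈ Icc 0 T, ⟪y t - y s, ι w⟫_ℝ = ∫ τ in s..t, G τ w) :
    ‖y T‖ ^ 2 - ‖y 0‖ ^ 2 = 2 * ∫ t in Ioo 0 T, G t (F t) := by
  set S := Ioo 0 T with hS
  have hSm : MeasurableSet S := measurableSet_Ioo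
  set F' : ℝ → X := S.indicator F with hF'
  set G' : ℝ → X →L[ℝ] ℝ := S.indicator G with hG'
  have hF2 : MemLp F' 2 volume := memLp_indicator hSm hF
  have hG2 : MemLp G' 2 volume := memLp_indicator hSm hG
  have hF1 : Integrable F' := memLp_one_iff_integrable.1
    (memLp_indicator hSm (hF.mono_exponent (by norm_num)))
  have hG1 : Integrable G' := memLp_one_iff_integrable.1
    (memLp_indicator hSm (hG.mono_exponent (by norm_num)))
  -- Rather than regularizing `y`, the correlation `c` of `G'` with the shifts of `F'` is integrated
  -- over `[-h', h']`. The result can be computed from `y` alone, and since `c` is continuous its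
  -- derivative at `h' = 0` recovers `2 c(0)`.
  set c : ℝ → ℝ := fun a => ∫ s, G' s (F' (s + a)) with hc
  have hcc : Continuous c := continuous_integral_apply_shift hG2 hF2
  have hc0 : c 0 = ∫ t in Ioo 0 T, G t (F t) := by
    rw [← integral_indicator hSm]
    simp only [hc, add_zero]
    congr 1
    ext s
    by_cases hs : s ∈ S <;> simp [hF', hG', hs]
  -- extend `y` by constants
  set p : ℝ → ℝ := fun s => max 0 (min T s) with hp
  have hpm : ∀ s, p s ∈ Icc 0 T := fun s => ⟨le_max_left _ _, max_le hT.le (min_le_left _ _)⟩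
  have hpid : ∀ s ∈ Icc 0 T, p s = s := fun s hs => by simp [hp, hs.1, hs.2]
  have hpc : Continuous p := by fun_prop
  set z : ℝ → Y := fun s => y (p s) with hz
  have hzc : Continuous z := hy.comp_continuous hpc hpm
  -- Clamping `r ± h'` to `[0, T]` corresponds exactly to the vanishing of `G'` outside `(0, T)`, so
  -- the integrated equation applies with `w = F r`.
  have hK : ∀ h' : ℝ, 0 ≤ h' → ∀ᵐ r ∂volume, (∫ τ in (r - h')..(r + h'), G' τ (F' r))
      = S.indicator (fun r => ⟪z (r + h') - z (r - h'), z r⟫_ℝ) r := by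
    intro h' hh'
    filter_upwards [(ae_restrict_iff' hSm).1 hFy] with r hr
    by_cases hrS : r ∈ S
    · have hr1 : r ∈ Icc 0 T := Ioo_subset_Icc_self hrS
      rw [indicator_of_mem hrS, hz]
      simp only
      rw [hpid r hr1, ← hr hrS, h (F r) _ (hpm _) _ (hpm _), hF', indicator_of_mem hrS]
      have hle : p (r - h') ≤ p (r + h') := by
        simp only [hp]
        gcongr
        linarith
      rw [intervalIntegral.integral_of_le (by linarith), intervalIntegral.integral_of_le hle,
        integral_Ioc_eq_integral_Ioo, integral_Ioc_eq_integral_Ioo,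
        ← integral_indicator measurableSet_Ioo, ← integral_indicator measurableSet_Ioo]
      congr 1
      ext τ
      have hiff : (τ ∈ Ioo (r - h') (r + h') ∧ τ ∈ S) ↔ τ ∈ Ioo (p (r - h')) (p (r + h')) := by
        have h1 : p (r + h') = min T (r + h') := by
          simp only [hp]; exact max_eq_right (le_min hT.le (by linarith [hr1.1]))
        have h2 : p (r - h') = max 0 (r - h') := by
          simp only [hp]; rw [min_eq_right (by linarith [hr1.2])]
        rw [h1, h2, hS]
        simp only [mem_Ioo, max_lt_iff, lt_min_iff]
        tauto
      by_cases hτ : τ ∈ Ioo (p (r - h')) (p (r + h'))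
      · have h3 := hiff.2 hτ
        rw [indicator_of_mem h3.1, indicator_of_mem hτ, hG', indicator_of_mem h3.2]
      · rw [indicator_of_notMem hτ]
        by_cases h4 : τ ∈ Ioo (r - h') (r + h')
        · rw [indicator_of_mem h4, hG', indicator_of_notMem fun h5 => hτ (hiff.1 ⟨h4, h5⟩)]
          simp
        · rw [indicator_of_notMem h4]
    · simp [hF', hrS]
  -- After a shift by `h'` in the term containing `z (r - h')`, the symmetry of the inner product
  -- makes the two integrals cancel except over end intervals of length `h'`.
  have hav : ∀ h' : ℝ, 0 ≤ h' → ∫ a in (-h')..h', c a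
      = (∫ r in (T - h')..T, ⟪z (r + h'), z r⟫_ℝ) - ∫ r in (-h')..0, ⟪z (r + h'), z r⟫_ℝ := by
    intro h' hh'
    rw [hc, integral_integral_apply_shift hG1 hF1 hh', integral_congr_ae (hK h' hh'),
      integral_indicator hSm, hS, ← integral_Ioc_eq_integral_Ioo,
      ← intervalIntegral.integral_of_le hT.le]
    have hcont : Continuous fun r => ⟪z (r + h'), z r⟫_ℝ := by fun_prop
    have hcont' : Continuous fun r => ⟪z (r - h'), z r⟫_ℝ := by fun_prop
    simp_rw [inner_sub_left]
    rw [intervalIntegral.integral_sub (hcont.intervalIntegrable _ _)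
      (hcont'.intervalIntegrable _ _)]
    have e1 := intervalIntegral.integral_comp_sub_right (a := 0) (b := T)
      (fun r => ⟪z (r + h'), z r⟫_ℝ) h'
    simp only [sub_add_cancel, zero_sub] at e1
    have e2 : ∫ r in (0 : ℝ)..T, ⟪z (r - h'), z r⟫_ℝ
        = ∫ r in (-h')..(T - h'), ⟪z (r + h'), z r⟫_ℝ := by
      rw [← e1]
      simp_rw [real_inner_comm]
    rw [e2]
    have i := fun a b => hcont.intervalIntegrable (μ := volume) a b
    have e3 := intervalIntegral.integral_add_adjacent_intervals (i (-h') 0) (i 0 (T - h'))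
    have e4 := intervalIntegral.integral_add_adjacent_intervals (i 0 (T - h')) (i (T - h') T)
    linarith
  -- On the end intervals the constant extension makes one of the factors equal to `y T` or `y 0`.
  have hav' : ∀ h' : ℝ, 0 ≤ h' → ∫ a in (-h')..h', c a
      = (∫ r in (T - h')..T, ⟪y T, z r⟫_ℝ) - ∫ r in (0 : ℝ)..h', ⟪z r, y 0⟫_ℝ := by
    intro h' hh'
    rw [hav h' hh']
    congr 1
    · refine intervalIntegral.integral_congr fun r hr => ?_
      rw [uIcc_of_le (by linarith)] at hr
      have : p (r + h') = T := by
        simp only [hp]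
        rw [min_eq_left (by linarith [hr.1]), max_eq_right hT.le]
      simp only [hz, this]
    · have e1 := intervalIntegral.integral_comp_add_right (a := -h') (b := 0)
        (fun r => ⟪z r, z (r - h')⟫_ℝ) h'
      simp only [add_sub_cancel_right, neg_add_cancel, zero_add] at e1
      rw [e1]
      refine intervalIntegral.integral_congr fun r hr => ?_
      rw [uIcc_of_le hh'] at hr
      have : p (r - h') = 0 := by
        simp only [hp]
        exact max_eq_left ((min_le_right _ _).trans (by linarith [hr.2]))
      simp only [hz, this]
  have hzT : z T = y T := by rw [hz]; simp only; rw [hpid T (right_mem_Icc.2 hT.le)]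
  have hz0 : z 0 = y 0 := by rw [hz]; simp only; rw [hpid 0 (left_mem_Icc.2 hT.le)]
  have hd : ∀ {f : ℝ → ℝ}, Continuous f → ∀ b, HasDerivAt (fun u => ∫ x in (0 : ℝ)..u, f x) (f b) b :=
    fun {f} hf b => intervalIntegral.integral_hasDerivAt_right (hf.intervalIntegrable _ _)
      hf.stronglyMeasurable.stronglyMeasurableAtFilter hf.continuousAt
  have hsplit : ∀ {f : ℝ → ℝ}, Continuous f → ∀ a b, ∫ x in a..b, f x
      = (∫ x in (0 : ℝ)..b, f x) - ∫ x in (0 : ℝ)..a, f x := fun {f} hf a b =>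
    (intervalIntegral.integral_interval_sub_left (hf.intervalIntegrable _ _)
      (hf.intervalIntegrable _ _)).symm
  have d1 : HasDerivAt (fun h' => ∫ a in (-h')..h', c a) (c 0 + c 0) 0 := by
    have e1 : HasDerivAt (fun h' : ℝ => ∫ x in (0 : ℝ)..(-h'), c x) (-c 0) 0 := by
      have := HasDerivAt.comp (0 : ℝ) (h₂ := fun u => ∫ x in (0 : ℝ)..u, c x) (h := fun x => -x)
        (by simpa using hd hcc (-0)) (hasDerivAt_neg (0 : ℝ))
      simpa [Function.comp_def] using this
    have := (hd hcc 0).sub e1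
    rw [sub_neg_eq_add] at this
    refine this.congr_of_eventuallyEq (Eventually.of_forall fun h' => ?_)
    exact hsplit hcc _ _
  have k1 : Continuous fun r => ⟪y T, z r⟫_ℝ := by fun_prop
  have k2 : Continuous fun r => ⟪z r, y 0⟫_ℝ := by fun_prop
  have d2 : HasDerivAt (fun h' => (∫ r in (T - h')..T, ⟪y T, z r⟫_ℝ)
      - ∫ r in (0 : ℝ)..h', ⟪z r, y 0⟫_ℝ) (‖y T‖ ^ 2 - ‖y 0‖ ^ 2) 0 := by
    have e1 : HasDerivAt (fun h' : ℝ => ∫ r in (0 : ℝ)..(T - h'), ⟪y T, z r⟫_ℝ)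
        (-‖y T‖ ^ 2) 0 := by
      have := HasDerivAt.comp (0 : ℝ) (h₂ := fun u => ∫ r in (0 : ℝ)..u, ⟪y T, z r⟫_ℝ)
        (h := fun x => T - x) (hd k1 (T - 0)) ((hasDerivAt_id (0 : ℝ)).const_sub T)
      simpa [Function.comp_def, hzT] using this
    have e2 := hd k2 0
    rw [hz0, real_inner_self_eq_norm_sq] at e2
    have e3 := (e1.const_sub (∫ r in (0 : ℝ)..T, ⟪y T, z r⟫_ℝ)).sub e2
    rw [neg_neg] at e3
    refine e3.congr_of_eventuallyEq (Eventually.of_forall fun h' => ?_)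
    simp only [Pi.sub_apply]
    rw [hsplit k1]
  -- The two expressions agree only for `h' ≥ 0`, so their derivatives at `0` are compared from the
  -- right.
  have d1' := (d1.hasDerivWithinAt (s := Ici 0)).congr_of_eventuallyEq_of_mem
    (f₁ := fun h' => (∫ r in (T - h')..T, ⟪y T, z r⟫_ℝ) - ∫ r in (0 : ℝ)..h', ⟪z r, y 0⟫_ℝ)
    (by filter_upwards [self_mem_nhdsWithin] with h' hh'; exact (hav' h' hh').symm) self_mem_Ici
  have := (uniqueDiffWithinAt_Ici (0 : ℝ)).eq_deriv _ d1' d2.hasDerivWithinAt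
  rw [← this, hc0]
  ring

end Energy

end LerayAlpha

end

noncomputable section

namespace LerayAlpha

/-! ### The spaces `H¹₀` and `V` -/

section Spaces

variable {N : ℕ} {Ω : Opens (E N)}

/-- Lebesgue measure on `Ω`. -/
abbrev dom (Ω : Opens (E N)) : Measure (E N) := volume.restrict (Ω : Set (E N))

/-- The first component of an element of `H1Pair`, as a continuous linear map. -/
def fstL : H1Pair Ω →L[ℝ] L2 Ω := WithLp.fstL 2 ℝ _ _

/-- The candidate for the `i`-th partial derivative, as a continuous linear map. -/
def sndL (i : Fin N) : H1Pair Ω →L[ℝ] L2 Ω := (PiLp.proj 2 _ i).comp (WithLp.sndL 2 ℝ _ _)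

@[simp] theorem fstL_apply (P : H1Pair Ω) : fstL P = P.fst := rfl

@[simp] theorem sndL_apply (i : Fin N) (P : H1Pair Ω) : sndL i P = P.snd i := rfl

theorem norm_sq_H1Pair (P : H1Pair Ω) : ‖P‖ ^ 2 = ‖P.fst‖ ^ 2 + ∑ i, ‖P.snd i‖ ^ 2 := by
  rw [WithLp.prod_norm_sq_eq_of_L2, PiLp.norm_sq_eq_of_L2]

theorem norm_fst_le (P : H1Pair Ω) : ‖P.fst‖ ≤ ‖P‖ := by
  refine le_of_sq_le_sq ?_ (norm_nonneg _)
  rw [norm_sq_H1Pair]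
  have : 0 ≤ ∑ i, ‖P.snd i‖ ^ 2 := by positivity
  linarith

theorem norm_snd_le (P : H1Pair Ω) (i : Fin N) : ‖P.snd i‖ ≤ ‖P‖ := by
  refine le_of_sq_le_sq ?_ (norm_nonneg _)
  rw [norm_sq_H1Pair]
  have := Finset.single_le_sum (f := fun i => ‖P.snd i‖ ^ 2) (fun i _ => by positivity)
    (Finset.mem_univ i)
  have h2 : 0 ≤ ‖P.fst‖ ^ 2 := by positivity
  simp only at this
  linarith

/-- The divergence, on pairs made of a field and of its candidate derivatives. -/
def divL : H1Pair Ω →L[ℝ] Lp ℝ 2 (dom Ω) :=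
  ∑ i : Fin N, ((EuclideanSpace.proj (𝕜 := ℝ) i).compLpL 2 (dom Ω)).comp (sndL i)

theorem coeFn_divL (P : H1Pair Ω) :
    ∀ᵐ x ∂(dom Ω), divL P x = ∑ i : Fin N, P.snd i x i := by
  have h1 : divL P = ∑ i : Fin N, (EuclideanSpace.proj (𝕜 := ℝ) i).compLpL 2 (dom Ω) (P.snd i) := by
    simp [divL]
  rw [h1]
  have h2 : ∀ i : Fin N, ∀ᵐ x ∂(dom Ω),
      (EuclideanSpace.proj (𝕜 := ℝ) i).compLpL 2 (dom Ω) (P.snd i) x = P.snd i x i := fun i =>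
    ContinuousLinearMap.coeFn_compLpL _ _
  filter_upwards [Lp.coeFn_fun_finsetSum Finset.univ
    (fun i => (EuclideanSpace.proj (𝕜 := ℝ) i).compLpL 2 (dom Ω) (P.snd i)), ae_all_iff.2 h2]
    with x h3 h4
  rw [h3]
  simp [h4]

/-- With the divergence condition read as the kernel of a bounded operator, `V` is closed, hence
complete. -/
theorem mem_V_iff (P : H1Pair Ω) : P ∈ V Ω ↔ P ∈ H10 Ω ∧ divL P = 0 := by
  change (P ∈ H10 Ω ∧ _) ↔ _
  refine and_congr_right fun _ => ?_
  rw [Lp.eq_zero_iff_ae_eq_zero]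
  constructor
  · intro h
    filter_upwards [h, coeFn_divL P] with x h1 h2
    rw [h2, h1]; rfl
  · intro h
    filter_upwards [h, coeFn_divL P] with x h1 h2
    rw [← h2, h1]; rfl

theorem isClosed_V : IsClosed (V Ω : Set (H1Pair Ω)) := by
  have : (V Ω : Set (H1Pair Ω)) = (H10 Ω : Set (H1Pair Ω)) ∩ divL ⁻¹' {0} := by
    ext P; exact mem_V_iff P
  rw [this]
  exact (Submodule.isClosed_topologicalClosure _).inter
    (isClosed_singleton.preimage divL.continuous)

instance : CompleteSpace (V Ω) := isClosed_V.completeSpace_coe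

/-- The inclusion of `V` into `H¹₀`. -/
def toH10 : V Ω →L[ℝ] H10 Ω :=
  (V Ω).subtypeL.codRestrict (H10 Ω) fun u => ((mem_V_iff _).1 u.2).1

@[simp] theorem coe_toH10 (u : V Ω) : ((toH10 u : H10 Ω) : H1Pair Ω) = u := rfl

/-- The velocity field of an element of `V`, as a continuous linear map. -/
def fieldL : V Ω →L[ℝ] L2 Ω := fstL.comp (V Ω).subtypeL

@[simp] theorem fieldL_apply (u : V Ω) : fieldL u = V.field u := rfl

/-- The partial derivatives of an element of `V`, as continuous linear maps. -/
def partialL (i : Fin N) : V Ω →L[ℝ] L2 Ω := (sndL i).comp (V Ω).subtypeL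

@[simp] theorem partialL_apply (i : Fin N) (u : V Ω) : partialL i u = V.partialDeriv u i := rfl

theorem norm_sq_V (u : V Ω) : ‖u‖ ^ 2 = ‖V.field u‖ ^ 2 + V.gradInner u u := by
  rw [Submodule.coe_norm, norm_sq_H1Pair, V.gradInner]
  simp only [real_inner_self_eq_norm_sq]
  rfl

/-- The form `(∇u, ∇w)` on `V`. -/
def gradForm : V Ω →L[ℝ] V Ω →L[ℝ] ℝ :=
  ∑ i, (((innerSL ℝ).comp (partialL i)).flip.comp (partialL i)).flip

theorem gradForm_apply (u w : V Ω) : gradForm u w = V.gradInner u w := by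
  simp [gradForm, V.gradInner]

attribute [irreducible] gradForm

theorem gradInner_self_nonneg (u : V Ω) : 0 ≤ V.gradInner u u :=
  Finset.sum_nonneg fun _ _ => real_inner_self_nonneg

theorem lineDerivOp_apply_eq_fderiv {E' F : Type*} [NormedAddCommGroup E'] [NormedSpace ℝ E']
    [NormedAddCommGroup F] [NormedSpace ℝ F] {U : Opens E'} (φ : 𝓓(U, F)) (v x : E') :
    (∂_{v} φ) x = fderiv ℝ φ x v := by
  rw [TestFunction.lineDerivOp_eq_lineDerivCLM ℝ, TestFunction.lineDerivCLM_eq_fderivCLM,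
    TestFunction.fderivCLM_apply_of_le _ (by simp)]

/-- The element of `H¹₀` given by a test function. -/
def testPair (φ : 𝓓(Ω, E N)) : H1Pair Ω :=
  WithLp.toLp 2 ((φ.continuous.memLp_of_hasCompactSupport φ.hasCompactSupport).toLp φ,
    WithLp.toLp 2 fun i : Fin N =>
      ((∂_{e i} φ).continuous.memLp_of_hasCompactSupport (∂_{e i} φ).hasCompactSupport).toLp _)

theorem testPair_fst (φ : 𝓓(Ω, E N)) : ∀ᵐ x ∂(dom Ω), (testPair φ).fst x = φ x :=
  (φ.continuous.memLp_of_hasCompactSupport φ.hasCompactSupport).coeFn_toLp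

theorem testPair_snd (φ : 𝓓(Ω, E N)) (i : Fin N) :
    ∀ᵐ x ∂(dom Ω), (testPair φ).snd i x = (∂_{e i} φ) x :=
  ((∂_{e i} φ).continuous.memLp_of_hasCompactSupport (∂_{e i} φ).hasCompactSupport).coeFn_toLp

theorem eq_testPair {P : H1Pair Ω} {φ : 𝓓(Ω, E N)} (h1 : ∀ᵐ x ∂(dom Ω), P.fst x = φ x)
    (h2 : ∀ i, ∀ᵐ x ∂(dom Ω), P.snd i x = (∂_{e i} φ) x) : P = testPair φ := by
  have e1 : P.fst = (testPair φ).fst := Lp.ext (by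
    filter_upwards [h1, testPair_fst φ] with x h3 h4
    rw [h3, h4])
  have e2 : ∀ i, P.snd i = (testPair φ).snd i := fun i => Lp.ext (by
    filter_upwards [h2 i, testPair_snd φ i] with x h3 h4
    rw [h3, h4])
  refine (WithLp.ofLp_injective 2) (Prod.ext e1 ?_)
  exact (WithLp.ofLp_injective 2) (funext e2)

theorem testPair_add (φ ψ : 𝓓(Ω, E N)) : testPair (φ + ψ) = testPair φ + testPair ψ := by
  refine (eq_testPair ?_ fun i => ?_).symm
  · filter_upwards [testPair_fst φ, testPair_fst ψ,
      Lp.coeFn_add (testPair φ).fst (testPair ψ).fst] with x h1 h2 h3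
    rw [WithLp.add_fst, h3]
    simp [h1, h2]
  · filter_upwards [testPair_snd φ i, testPair_snd ψ i,
      Lp.coeFn_add ((testPair φ).snd i) ((testPair ψ).snd i)] with x h1 h2 h3
    rw [WithLp.add_snd, PiLp.add_apply, h3, LineDeriv.lineDerivOp_add]
    simp [h1, h2]

theorem testPair_smul (c : ℝ) (φ : 𝓓(Ω, E N)) : testPair (c • φ) = c • testPair φ := by
  refine (eq_testPair ?_ fun i => ?_).symm
  · filter_upwards [testPair_fst φ, Lp.coeFn_smul c (testPair φ).fst] with x h1 h3
    rw [WithLp.smul_fst, h3]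
    simp [h1]
  · filter_upwards [testPair_snd φ i, Lp.coeFn_smul c ((testPair φ).snd i)] with x h1 h3
    rw [WithLp.smul_snd, PiLp.smul_apply, h3, LineDeriv.lineDerivOp_smul]
    simp [h1]

/-- To prove a closed property on `H¹₀`, it suffices to prove it for test functions. -/
theorem H10_induction {p : H1Pair Ω → Prop} (hc : IsClosed {P | p P})
    (h : ∀ φ : 𝓓(Ω, E N), p (testPair φ)) {P : H1Pair Ω} (hP : P ∈ H10 Ω) : p P := by
  refine (hc.closure_subset_iff (s := _)).2 ?_ hP
  intro R hR
  -- Test pairs already form a linear subspace, so the span in the definition of `H10` adds nothing.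
  have : ∃ φ : 𝓓(Ω, E N), R = testPair φ := by
    refine Submodule.span_induction (p := fun R _ => ∃ φ : 𝓓(Ω, E N), R = testPair φ)
      ?_ ?_ ?_ ?_ hR
    · rintro R ⟨φ, h1, h2⟩
      exact ⟨φ, eq_testPair h1 h2⟩
    · exact ⟨0, by rw [← zero_smul ℝ (0 : 𝓓(Ω, E N)), testPair_smul, zero_smul]⟩
    · rintro _ _ _ _ ⟨φ, rfl⟩ ⟨ψ, rfl⟩
      exact ⟨φ + ψ, (testPair_add φ ψ).symm⟩
    · rintro c _ _ ⟨φ, rfl⟩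
      exact ⟨c • φ, (testPair_smul c φ).symm⟩
  obtain ⟨φ, rfl⟩ := this
  exact h φ

theorem norm_fderiv_le_sum {F : Type*} [NormedAddCommGroup F] [NormedSpace ℝ F]
    (L : E N →L[ℝ] F) : ‖L‖ ≤ ∑ i, ‖L (e i)‖ := by
  refine L.opNorm_le_bound (by positivity) fun x => ?_
  have hx : x = ∑ i, x i • (e i : E N) := by
    ext j
    simp [Finset.sum_apply, e, Pi.single_apply]
  calc ‖L x‖ = ‖∑ i, x i • L (e i)‖ := by
        conv_lhs => rw [hx]
        simp
    _ ≤ ∑ i, ‖x i • L (e i)‖ := norm_sum_le _ _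
    _ ≤ ∑ i, ‖L (e i)‖ * ‖x‖ := by
        refine Finset.sum_le_sum fun i _ => ?_
        rw [norm_smul, mul_comm]
        gcongr
        exact PiLp.norm_apply_le x i
    _ = _ := by rw [Finset.sum_mul]

theorem support_fderiv_subset (φ : 𝓓(Ω, E N)) : Function.support (fderiv ℝ φ) ⊆ Ω :=
  (_root_.support_fderiv_subset ℝ).trans φ.tsupport_subset

theorem eLpNorm_fderiv_le (φ : 𝓓(Ω, E N)) :
    eLpNorm (fderiv ℝ φ) 2 (dom Ω) ≤ ENNReal.ofReal (N * ‖testPair φ‖) := by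
  have h1 : eLpNorm (fderiv ℝ φ) 2 (dom Ω)
      ≤ ∑ i : Fin N, eLpNorm ((testPair φ).snd i) 2 (dom Ω) := by
    calc eLpNorm (fderiv ℝ φ) 2 (dom Ω)
        ≤ eLpNorm (∑ i : Fin N, fun x => ‖(testPair φ).snd i x‖) 2 (dom Ω) := by
          refine eLpNorm_mono_ae_real ?_
          filter_upwards [ae_all_iff.2 fun i => testPair_snd φ i] with x hx
          simp only [Finset.sum_apply, hx, lineDerivOp_apply_eq_fderiv]
          exact norm_fderiv_le_sum _
      _ ≤ ∑ i : Fin N, eLpNorm (fun x => ‖(testPair φ).snd i x‖) 2 (dom Ω) :=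
          eLpNorm_sum_le (fun i _ => (Lp.aestronglyMeasurable _).norm) (by norm_num)
      _ = _ := by simp_rw [eLpNorm_norm]
  refine h1.trans ?_
  have h2 : ∀ i : Fin N, eLpNorm ((testPair φ).snd i) 2 (dom Ω)
      ≤ ENNReal.ofReal ‖testPair φ‖ := fun i => by
    rw [← Lp.enorm_def, ← ofReal_norm]
    exact ENNReal.ofReal_le_ofReal (norm_snd_le _ i)
  refine (Finset.sum_le_sum fun i _ => h2 i).trans ?_
  rw [Finset.sum_const, Finset.card_univ, Fintype.card_fin, nsmul_eq_mul,
    ENNReal.ofReal_mul (by positivity)]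
  simp

end Spaces

end LerayAlpha

end

noncomputable section

namespace LerayAlpha

set_option maxSynthPendingDepth 3

/-! ### The Sobolev embedding of `H¹₀` into `L⁴` -/

theorem eLpNorm_restrict_of_support_subset {α F : Type*} [MeasurableSpace α]
    [NormedAddCommGroup F] {μ : Measure α} {p : ℝ≥0∞} {s : Set α} {f : α → F}
    (h : Function.support f ⊆ s) : eLpNorm f p (μ.restrict s) = eLpNorm f p μ :=
  eLpNorm_restrict_eq_of_support_subset h

section Sobolev

variable {N : ℕ} {Ω : Opens (E N)}

instance : ENNReal.HolderTriple 4 4 2 where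
  inv_add_inv_eq_inv := by
    have h : (4 : ℝ≥0∞) = 2 * 2 := by norm_num
    rw [h, ENNReal.mul_inv (by simp) (by simp), ← mul_add, ENNReal.inv_two_add_inv_two, mul_one]

instance : Fact ((1 : ℝ≥0∞) ≤ 4) := ⟨by norm_num⟩

/-- A bounded operator into `Lᵖ` that is also bounded for the `L^q` norm, as an operator
into `L^q`. -/
def changeExponent {α X F : Type*} [MeasurableSpace α] {μ : Measure α} [NormedAddCommGroup X]
    [NormedSpace ℝ X] [NormedAddCommGroup F] [NormedSpace ℝ F] {p : ℝ≥0∞} [Fact (1 ≤ p)]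
    (L : X →L[ℝ] Lp F p μ) (q : ℝ≥0∞) [Fact (1 ≤ q)]
    (h : ∃ C : ℝ, 0 ≤ C ∧ ∀ x, eLpNorm (L x) q μ ≤ ENNReal.ofReal (C * ‖x‖)) :
    X →L[ℝ] Lp F q μ :=
  have hL : ∀ x, MemLp (L x) q μ := fun x => by
    obtain ⟨C, -, h⟩ := h
    exact ⟨Lp.aestronglyMeasurable _, (h x).trans_lt ENNReal.ofReal_lt_top⟩
  LinearMap.mkContinuousOfExistsBound
    { toFun := fun x => (hL x).toLp (L x)
      map_add' := fun x y => by
        rw [← MemLp.toLp_add, MemLp.toLp_eq_toLp_iff, map_add]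
        exact Lp.coeFn_add _ _
      map_smul' := fun c x => by
        rw [RingHom.id_apply, ← MemLp.toLp_const_smul, MemLp.toLp_eq_toLp_iff, map_smul]
        exact Lp.coeFn_smul _ _ } (by
    obtain ⟨C, hC, h⟩ := h
    refine ⟨C, fun x => ?_⟩
    simp only [LinearMap.coe_mk, AddHom.coe_mk]
    rw [Lp.norm_toLp]
    exact ENNReal.toReal_le_of_le_ofReal (by positivity) (h x))

theorem coeFn_changeExponent {α X F : Type*} [MeasurableSpace α] {μ : Measure α}
    [NormedAddCommGroup X] [NormedSpace ℝ X] [NormedAddCommGroup F] [NormedSpace ℝ F] {p : ℝ≥0∞}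
    [Fact (1 ≤ p)] (L : X →L[ℝ] Lp F p μ) (q : ℝ≥0∞) [Fact (1 ≤ q)]
    (h : ∃ C : ℝ, 0 ≤ C ∧ ∀ x, eLpNorm (L x) q μ ≤ ENNReal.ofReal (C * ‖x‖)) (x : X) :
    ∀ᵐ a ∂μ, changeExponent L q h x a = L x a := by
  have hL : MemLp (L x) q μ := by
    obtain ⟨C, -, h⟩ := h
    exact ⟨Lp.aestronglyMeasurable _, (h x).trans_lt ENNReal.ofReal_lt_top⟩
  exact hL.coeFn_toLp

/-- The Gagliardo–Nirenberg–Sobolev inequality from `L^{12/7}` gradients to `L⁴`. Since `7/12 - 1/4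
= 1/3 ≤ 1/N` and `12/7 < 2 ≤ N`, the same exponents serve both dimensions; Hölder on the bounded set
`Ω` passes from `12/7` to `2`. -/
theorem exists_eLpNorm_four_le (hN : N = 2 ∨ N = 3) (hΩ : Bornology.IsBounded (Ω : Set (E N))) :
    ∃ C : ℝ, 0 ≤ C ∧ ∀ P ∈ H10 Ω, eLpNorm P.fst 4 (dom Ω) ≤ ENNReal.ofReal (C * ‖P‖) := by
  have hfin : volume (Ω : Set (E N)) ≠ ∞ := hΩ.measure_lt_top.ne
  have : IsFiniteMeasure (dom Ω) := ⟨by simpa using hfin.lt_top⟩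
  set C₁ := eLpNormLESNormFDerivOfLeConst (E N) (volume : Measure (E N)) (Ω : Set (E N))
    (12 / 7) 4 with hC₁
  set C₂ := (dom Ω) univ ^ (1 / (ENNReal.toReal ((12 / 7 : NNReal) : ℝ≥0∞)) - 1 / ENNReal.toReal 2)
    with hC₂
  have hC₂t : C₂ ≠ ∞ := by
    refine ENNReal.rpow_ne_top_of_nonneg ?_ (measure_ne_top _ _)
    simp
    norm_num
  refine ⟨C₁ * C₂.toReal * N, by positivity, fun P hP => ?_⟩
  refine H10_induction (p := fun P => eLpNorm P.fst 4 (dom Ω)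
    ≤ ENNReal.ofReal (C₁ * C₂.toReal * N * ‖P‖)) ?_ (fun φ => ?_) hP
  -- Fatou along an almost everywhere convergent subsequence: lower semicontinuity of the `L⁴` norm
  -- suffices to make the inequality closed.
  · refine IsSeqClosed.isClosed fun u P hu hP => ?_
    have h1 : Tendsto (fun n => (u n).fst) atTop (𝓝 P.fst) :=
      (fstL.continuous.tendsto P).comp hP
    obtain ⟨ns, hns, h2⟩ := (tendstoInMeasure_of_tendsto_Lp h1).exists_seq_tendsto_ae
    refine (Lp.eLpNorm_lim_le_liminf_eLpNorm (fun n => Lp.aestronglyMeasurable _) _ h2).trans ?_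
    have h3 : Tendsto (fun n => ENNReal.ofReal (C₁ * C₂.toReal * N * ‖u (ns n)‖)) atTop
        (𝓝 (ENNReal.ofReal (C₁ * C₂.toReal * N * ‖P‖))) := by
      refine ENNReal.tendsto_ofReal (Tendsto.const_mul _ ?_)
      exact (continuous_norm.tendsto P).comp (hP.comp hns.tendsto_atTop)
    rw [← h3.liminf_eq]
    exact liminf_le_liminf (Eventually.of_forall fun n => hu (ns n))
  · have hsub : Function.support φ ⊆ (Ω : Set (E N)) :=
      (subset_tsupport _).trans φ.tsupport_subset
    have hcard : Module.finrank ℝ (E N) = N := finrank_euclideanSpace_fin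
    have h1 := eLpNorm_le_eLpNorm_fderiv_of_le (volume : Measure (E N)) (u := φ)
      (s := (Ω : Set (E N))) (p := 12 / 7) (q := 4)
      (φ.contDiff.of_le (by norm_cast)) hsub
      (by rw [← NNReal.coe_le_coe]; norm_num)
      (by
        rw [hcard, ← NNReal.coe_lt_coe]
        rcases hN with rfl | rfl <;> norm_num)
      (by
        rw [hcard]
        rcases hN with rfl | rfl <;> norm_num) hΩ
    have h2 : eLpNorm (testPair φ).fst 4 (dom Ω) = eLpNorm φ ((4 : NNReal) : ℝ≥0∞) volume := by
      rw [eLpNorm_congr_ae (testPair_fst φ), dom, eLpNorm_restrict_of_support_subset hsub]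
      rfl
    have h3 : eLpNorm (fderiv ℝ φ) ((12 / 7 : NNReal) : ℝ≥0∞) volume
        ≤ eLpNorm (fderiv ℝ φ) 2 (dom Ω) * C₂ := by
      rw [← eLpNorm_restrict_of_support_subset (support_fderiv_subset φ)]
      refine eLpNorm_le_eLpNorm_mul_rpow_measure_univ ?_
        ((φ.contDiff.continuous_fderiv (by simp)).aestronglyMeasurable)
      have : (12 / 7 : NNReal) ≤ 2 := by rw [← NNReal.coe_le_coe]; norm_num
      exact_mod_cast this
    rw [h2]
    refine h1.trans ?_
    calc (C₁ : ℝ≥0∞) * eLpNorm (fderiv ℝ φ) ((12 / 7 : NNReal) : ℝ≥0∞) volume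
        ≤ C₁ * (ENNReal.ofReal (N * ‖testPair φ‖) * C₂) := by
          gcongr
          exact h3.trans (by gcongr; exact eLpNorm_fderiv_le φ)
      _ = _ := by
          rw [mul_assoc, mul_assoc, ENNReal.ofReal_mul (p := (C₁ : ℝ)) (by positivity),
            ENNReal.ofReal_mul (p := C₂.toReal) (by positivity), ENNReal.ofReal_toReal hC₂t,
            ENNReal.ofReal_coe_nnreal, mul_comm C₂]

/-- A test function, as an element of `H¹₀`. -/
def testH10 (φ : 𝓓(Ω, E N)) : H10 Ω :=
  ⟨testPair φ, Submodule.le_topologicalClosure _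
    (Submodule.subset_span ⟨φ, testPair_fst φ, testPair_snd φ⟩)⟩

@[simp] theorem coe_testH10 (φ : 𝓓(Ω, E N)) : (testH10 φ : H1Pair Ω) = testPair φ := rfl

/-- Needed for properties that make sense only on `H10`, such as those involving `toL4`. As `H10` is
closed, closed subsets of the subtype remain closed in `H1Pair`. -/
theorem H10_subtype_induction {p : H10 Ω → Prop} (hc : IsClosed {P | p P})
    (h : ∀ φ : 𝓓(Ω, E N), p (testH10 φ)) (P : H10 Ω) : p P := by
  have hcl : IsClosed (H10 Ω : Set (H1Pair Ω)) := Submodule.isClosed_topologicalClosure _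
  have h1 : (P : H1Pair Ω) ∈ Subtype.val '' {P : H10 Ω | p P} :=
    H10_induction (p := fun R => R ∈ Subtype.val '' {P : H10 Ω | p P})
      (hcl.isClosedEmbedding_subtypeVal.isClosedMap _ hc) (fun φ => ⟨testH10 φ, h φ, rfl⟩) P.2
  obtain ⟨R, hR, hRP⟩ := h1
  rwa [← Subtype.ext hRP]

/-- A Sobolev constant for the embedding of `H¹₀(Ω)` into `L⁴(Ω)`: this class records the
embedding inequality, so that the maps built on it can be used as instances. -/
class HasL4Embedding (Ω : Opens (E N)) : Prop where
  exists_le : ∃ C : ℝ, 0 ≤ C ∧ ∀ P ∈ H10 Ω, eLpNorm P.fst 4 (dom Ω) ≤ ENNReal.ofReal (C * ‖P‖)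

variable [HasL4Embedding Ω]

/-- The embedding of `H¹₀` into `L⁴`. -/
def toL4 : H10 Ω →L[ℝ] Lp (E N) 4 (dom Ω) :=
  changeExponent (fstL.comp (H10 Ω).subtypeL) 4 (by
    obtain ⟨C, hC, h⟩ := HasL4Embedding.exists_le (Ω := Ω)
    exact ⟨C, hC, fun P => h P P.2⟩)

theorem coeFn_toL4 (P : H10 Ω) : ∀ᵐ x ∂(dom Ω), toL4 P x = P.1.fst x :=
  coeFn_changeExponent _ _ _ P

attribute [irreducible] toL4

end Sobolev

/-! ### The convection form -/

section Convection

variable {N : ℕ} {Ω : Opens (E N)}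

/-- The bilinear map `(z, w) ↦ zᵢ w`. -/
def coordSMul (i : Fin N) : E N →L[ℝ] E N →L[ℝ] E N :=
  (ContinuousLinearMap.lsmul ℝ ℝ).comp (EuclideanSpace.proj (𝕜 := ℝ) i)

@[simp] theorem coordSMul_apply (i : Fin N) (z w : E N) : coordSMul i z w = z i • w := rfl

/-- The convection form `(z, w, u) ↦ ∫ ∑ᵢ zᵢ ∂ᵢu · w`, for `z` and `w` in Lebesgue spaces. -/
def convForm (Ω : Opens (E N)) (p q : ℝ≥0∞) [ENNReal.HolderTriple p q 2] [Fact (1 ≤ p)]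
    [Fact (1 ≤ q)] : Lp (E N) p (dom Ω) →L[ℝ] Lp (E N) q (dom Ω) →L[ℝ] H1Pair Ω →L[ℝ] ℝ :=
  ∑ i, (ContinuousLinearMap.compL ℝ (Lp (E N) q (dom Ω)) (L2 Ω) (H1Pair Ω →L[ℝ] ℝ)
    (((ContinuousLinearMap.compL ℝ (H1Pair Ω) (L2 Ω) ℝ).flip (sndL i)).comp (innerSL ℝ))).comp
      ((coordSMul i).holderL (dom Ω) p q 2)

variable {p q : ℝ≥0∞} [ENNReal.HolderTriple p q 2] [Fact (1 ≤ p)] [Fact (1 ≤ q)]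

theorem convForm_apply (z : Lp (E N) p (dom Ω)) (w : Lp (E N) q (dom Ω)) (P : H1Pair Ω) :
    convForm Ω p q z w P = ∑ i, ⟪(coordSMul i).holder 2 z w, P.snd i⟫_ℝ := by
  simp [convForm]

attribute [irreducible] convForm

theorem convForm_eq_integral {z : Lp (E N) p (dom Ω)} {w : Lp (E N) q (dom Ω)} {P : H1Pair Ω}
    {z' w' : E N → E N} {d : Fin N → E N → E N} (hz : ∀ᵐ x ∂(dom Ω), z x = z' x)
    (hw : ∀ᵐ x ∂(dom Ω), w x = w' x) (hd : ∀ i, ∀ᵐ x ∂(dom Ω), P.snd i x = d i x) :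
    convForm Ω p q z w P = ∫ x in (Ω : Set (E N)), ∑ i, z' x i * ⟪d i x, w' x⟫_ℝ := by
  rw [convForm_apply]
  simp_rw [L2.inner_def]
  rw [← integral_finsetSum _ fun i _ => L2.integrable_inner _ _]
  refine integral_congr_ae ?_
  have h1 : ∀ i, ∀ᵐ x ∂(dom Ω), (coordSMul i).holder 2 z w x = z x i • w x := fun i =>
    (coordSMul i).coeFn_holder z w
  filter_upwards [ae_all_iff.2 h1, hz, hw, ae_all_iff.2 hd] with x h1 h2 h3 h4
  refine Finset.sum_congr rfl fun i _ => ?_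
  rw [h1 i, h2, h3, h4 i, real_inner_smul_left, real_inner_comm]

/-- The value depends on the underlying functions and not on the exponents. This allows the `(4, 4)`
form to be compared with the `(2, ∞)` form. -/
theorem convForm_congr {p' q' : ℝ≥0∞} [ENNReal.HolderTriple p' q' 2] [Fact (1 ≤ p')]
    [Fact (1 ≤ q')] {z : Lp (E N) p (dom Ω)} {w : Lp (E N) q (dom Ω)} {z' : Lp (E N) p' (dom Ω)}
    {w' : Lp (E N) q' (dom Ω)} (hz : ∀ᵐ x ∂(dom Ω), z x = z' x) (hw : ∀ᵐ x ∂(dom Ω), w x = w' x)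
    (P : H1Pair Ω) : convForm Ω p q z w P = convForm Ω p' q' z' w' P := by
  rw [convForm_eq_integral hz hw fun i => Eventually.of_forall fun x => rfl,
    convForm_eq_integral (Eventually.of_forall fun x => rfl) (Eventually.of_forall fun x => rfl)
      fun i => Eventually.of_forall fun x => rfl]

/-- Membership in `H¹₀` removes any boundary term, and the divergence term vanishes on `V`. It
serves for `g = |φ|²` in `convForm_self`. -/
theorem integral_divFree {Z : V Ω} (g : 𝓓(Ω, ℝ)) :
    ∫ x in (Ω : Set (E N)), ∑ i, V.field Z x i * fderiv ℝ g x (e i) = 0 := by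
  -- integration by parts, by density of the test functions
  have hg : MemLp g 2 (dom Ω) := g.continuous.memLp_of_hasCompactSupport g.hasCompactSupport
  have hgd : ∀ i, MemLp (fun x => fderiv ℝ g x (e i)) 2 (dom Ω) := fun i => by
    have h1 : (fun x => fderiv ℝ g x (e i)) = (∂_{(e i : E N)} g) := by
      ext x; rw [lineDerivOp_apply_eq_fderiv]
    rw [h1]
    exact (∂_{(e i : E N)} g).continuous.memLp_of_hasCompactSupport
      (∂_{(e i : E N)} g).hasCompactSupport
  set D : Fin N → Lp ℝ 2 (dom Ω) := fun i => (hgd i).toLp _ with hD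
  -- The functional `P ↦ ∫ u · ∇g + ∫ g div u` is continuous on all of `H1Pair`, so its vanishing is
  -- a closed condition.
  set L : H1Pair Ω →L[ℝ] ℝ := ∑ i : Fin N, (innerSL ℝ (D i)).comp
      (((EuclideanSpace.proj (𝕜 := ℝ) i).compLpL 2 (dom Ω)).comp fstL)
    + (innerSL ℝ (hg.toLp g)).comp divL with hL
  have hLP : ∀ P : H1Pair Ω, L P = (∫ x in (Ω : Set (E N)), ∑ i, P.fst x i * fderiv ℝ g x (e i))
      + ∫ x in (Ω : Set (E N)), (∑ i, P.snd i x i) * g x := by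
    intro P
    have h1 : L P = ∑ i : Fin N,
        ⟪D i, (EuclideanSpace.proj (𝕜 := ℝ) i).compLpL 2 (dom Ω) P.fst⟫_ℝ
        + ⟪hg.toLp g, divL P⟫_ℝ := by
      simp [hL]
    rw [h1]
    simp_rw [L2.inner_def]
    rw [← integral_finsetSum _ fun i _ => L2.integrable_inner _ _]
    congr 1
    · refine integral_congr_ae ?_
      have h3 : ∀ i : Fin N, ∀ᵐ x ∂(dom Ω),
          (EuclideanSpace.proj (𝕜 := ℝ) i).compLpL 2 (dom Ω) P.fst x = P.fst x i := fun i =>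
        ContinuousLinearMap.coeFn_compLpL _ _
      filter_upwards [ae_all_iff.2 fun i => (hgd i).coeFn_toLp, ae_all_iff.2 h3] with x h4 h5
      refine Finset.sum_congr rfl fun i _ => ?_
      rw [hD, h4 i, h5 i]
      rfl
    · refine integral_congr_ae ?_
      filter_upwards [hg.coeFn_toLp, coeFn_divL P] with x h4 h5
      rw [h4, h5]
      rfl
  have hzero : ∀ P ∈ H10 Ω, L P = 0 := fun P hP => by
    refine H10_induction (p := fun P => L P = 0)
      (isClosed_singleton.preimage L.continuous) (fun φ => ?_) hP
    rw [hLP]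
    have hsup : ∀ x, x ∉ (Ω : Set (E N)) → φ x = 0 ∧ g x = 0 := fun x hx =>
      ⟨image_eq_zero_of_notMem_tsupport fun h => hx (φ.tsupport_subset h),
        image_eq_zero_of_notMem_tsupport fun h => hx (g.tsupport_subset h)⟩
    have e1 : ∫ x in (Ω : Set (E N)), ∑ i, (testPair φ).fst x i * fderiv ℝ g x (e i)
        = ∫ x, ∑ i, φ x i * fderiv ℝ g x (e i) := by
      refine Eq.trans ?_ (setIntegral_eq_integral_of_forall_compl_eq_zero (s := (Ω : Set (E N))) ?_)
      · refine integral_congr_ae ?_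
        filter_upwards [testPair_fst φ] with x hx
        rw [hx]
      · intro x hx
        simp [(hsup x hx).1]
    have e2 : ∫ x in (Ω : Set (E N)), (∑ i, (testPair φ).snd i x i) * g x
        = ∫ x, ∑ i, fderiv ℝ φ x (e i) i * g x := by
      refine Eq.trans ?_ (setIntegral_eq_integral_of_forall_compl_eq_zero (s := (Ω : Set (E N))) ?_)
      · refine integral_congr_ae ?_
        filter_upwards [ae_all_iff.2 fun i => testPair_snd φ i] with x hx
        rw [Finset.sum_mul]
        refine Finset.sum_congr rfl fun i _ => ?_
        rw [hx i, lineDerivOp_apply_eq_fderiv]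
      · intro x hx
        simp [(hsup x hx).2]
    have hφi : ∀ i : Fin N, ContDiff ℝ 1 fun x => φ x i := fun i =>
      (ContinuousLinearMap.contDiff (EuclideanSpace.proj (𝕜 := ℝ) i : E N →L[ℝ] ℝ)).comp
        (φ.contDiff.of_le (by norm_cast))
    have hg1 : ContDiff ℝ 1 g := g.contDiff.of_le (by norm_cast)
    have hgc := g.hasCompactSupport
    have hgc' := g.hasCompactSupport.fderiv (𝕜 := ℝ)
    have hfd : ∀ i x, fderiv ℝ φ x (e i) i = fderiv ℝ (fun x => φ x i) x (e i) := fun i x => by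
      have h1 := ((EuclideanSpace.proj (𝕜 := ℝ) i : E N →L[ℝ] ℝ).hasFDerivAt (x := φ x)).comp x
        ((φ.contDiff.differentiable (by simp)) x).hasFDerivAt
      have h2 : fderiv ℝ (fun x => φ x i) x = _ := h1.fderiv
      rw [h2]
      rfl
    have i1 : ∀ i : Fin N, Integrable fun x => φ x i * fderiv ℝ g x (e i) := fun i => by
      refine Continuous.integrable_of_hasCompactSupport ?_ ?_
      · exact (hφi i).continuous.mul ((hg1.continuous_fderiv (by simp)).clm_apply continuous_const)
      · refine HasCompactSupport.mul_left ?_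
        exact hgc'.comp_left (g := fun L : E N →L[ℝ] ℝ => L (e i)) (by simp)
    have i2 : ∀ i : Fin N, Integrable fun x => fderiv ℝ (fun x => φ x i) x (e i) * g x := fun i => by
      refine Continuous.integrable_of_hasCompactSupport ?_ hgc.mul_left
      exact (((hφi i).continuous_fderiv (by simp)).clm_apply continuous_const).mul hg1.continuous
    have i3 : ∀ i : Fin N, Integrable fun x => φ x i * g x := fun i =>
      ((hφi i).continuous.mul hg1.continuous).integrable_of_hasCompactSupport hgc.mul_left
    rw [e1, e2]
    simp_rw [hfd]
    rw [integral_finsetSum _ fun i _ => i1 i, integral_finsetSum _ fun i _ => i2 i,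
      ← Finset.sum_add_distrib]
    refine Finset.sum_eq_zero fun i _ => ?_
    rw [integral_mul_fderiv_eq_neg_fderiv_mul_of_integrable (i2 i) (i1 i) (i3 i)
      (fun x _ => (hφi i).differentiable (by simp) x) (fun x _ => hg1.differentiable (by simp) x)]
    ring
  have h1 := hzero Z.1 ((mem_V_iff _).1 Z.2).1
  rw [hLP] at h1
  have h2 : ∫ x in (Ω : Set (E N)), (∑ i, Z.1.snd i x i) * g x = 0 := by
    refine integral_eq_zero_of_ae ?_
    filter_upwards [Z.2.2] with x hx
    rw [hx, zero_mul]; rfl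
  rw [h2, add_zero] at h1
  exact h1

variable [HasL4Embedding Ω]

theorem convection_eq (Z u w : V Ω) {z : L2 Ω} (hz : V.field Z = z) :
    convection z u w = convForm Ω 4 4 (toL4 (toH10 Z)) (toL4 (toH10 w)) u := by
  subst hz
  rw [convForm_eq_integral (coeFn_toL4 _) (coeFn_toL4 _) fun i => Eventually.of_forall fun x => rfl]
  rfl

/-- The convection form with a divergence free transport field is skew-symmetric. -/
theorem convForm_self (Z : V Ω) (u : H10 Ω) :
    convForm Ω 4 4 (toL4 (toH10 Z)) (toL4 u) u = 0 := by
  refine H10_subtype_induction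
    (p := fun u => convForm Ω 4 4 (toL4 (toH10 Z)) (toL4 u) u = 0) ?_ (fun φ => ?_) u
  · refine isClosed_eq ?_ continuous_const
    exact (((convForm Ω 4 4 (toL4 (toH10 Z))).comp toL4).continuous).clm_apply
      continuous_subtype_val
  · change convForm Ω 4 4 (toL4 (toH10 Z)) (toL4 (testH10 φ)) (testPair φ) = 0
    have hw : ∀ᵐ x ∂(dom Ω), toL4 (testH10 φ) x = φ x := by
      filter_upwards [coeFn_toL4 (testH10 φ), testPair_fst φ] with x h1 h2
      rw [h1]
      exact h2
    rw [convForm_eq_integral (coeFn_toL4 (toH10 Z)) hw (testPair_snd φ)]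
    -- Since `∂ᵢφ · φ = ½ ∂ᵢ|φ|²`, the form is half the integral of `Z · ∇g`.
    let g : 𝓓(Ω, ℝ) := ⟨fun x => ‖φ x‖ ^ 2, φ.contDiff.norm_sq ℝ,
      φ.hasCompactSupport.comp_left (g := fun v : E N => ‖v‖ ^ 2) (by simp),
      (tsupport_comp_subset (g := fun v : E N => ‖v‖ ^ 2) (by simp) φ).trans φ.tsupport_subset⟩
    have hg : ∀ x v, fderiv ℝ g x v = 2 * ⟪fderiv ℝ φ x v, φ x⟫_ℝ := fun x v => by
      have h1 : HasFDerivAt φ (fderiv ℝ φ x) x :=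
        ((φ.contDiff.differentiable (by simp)) x).hasFDerivAt
      have h2 : fderiv ℝ g x = _ := h1.norm_sq.fderiv
      rw [h2]
      simp [real_inner_comm]
    have h0 := integral_divFree (Z := Z) g
    simp_rw [hg, lineDerivOp_apply_eq_fderiv] at h0 ⊢
    have h2 : ∀ x, ∑ i, V.field Z x i * (2 * ⟪fderiv ℝ φ x (e i), φ x⟫_ℝ)
        = 2 * ∑ i, V.field Z x i * ⟪fderiv ℝ φ x (e i), φ x⟫_ℝ := fun x => by
      rw [Finset.mul_sum]
      exact Finset.sum_congr rfl fun i _ => by ring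
    simp_rw [h2] at h0
    rw [integral_const_mul] at h0
    have h3 := (mul_eq_zero.1 h0).resolve_left two_ne_zero
    exact h3

end Convection

end LerayAlpha

end

noncomputable section

namespace LerayAlpha

set_option maxSynthPendingDepth 3

/-! ### Compactness of the embedding of `H¹₀` into `L²` -/

section Rellich

theorem sq_lintegral_le {α : Type*} [MeasurableSpace α] {P : Measure α} [IsProbabilityMeasure P]
    {f : α → ℝ≥0∞} (hf : AEMeasurable f P) : (∫⁻ a, f a ∂P) ^ 2 ≤ ∫⁻ a, f a ^ 2 ∂P := by
  have h := ENNReal.lintegral_mul_le_Lp_mul_Lq P (p := 2) (q := 2)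
    (Real.HolderConjugate.two_two) hf (aemeasurable_const (b := (1 : ℝ≥0∞)))
  simp only [Pi.mul_apply, mul_one, ENNReal.one_rpow, lintegral_const, measure_univ] at h
  calc (∫⁻ a, f a ∂P) ^ 2 ≤ ((∫⁻ a, f a ^ (2 : ℝ) ∂P) ^ (1 / 2 : ℝ)) ^ 2 := by gcongr
    _ = ∫⁻ a, f a ^ 2 ∂P := by
      rw [← ENNReal.rpow_natCast, ← ENNReal.rpow_mul]
      norm_num

variable {X F : Type*} [NormedAddCommGroup X] [NormedSpace ℝ X] [NormedAddCommGroup F]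
  [NormedSpace ℝ F]

theorem enorm_sub_le_lintegral_fderiv [CompleteSpace F] {φ : X → F} (hφ : ContDiff ℝ 1 φ)
    (x h : X) :
    ‖φ x - φ (x + h)‖ₑ ≤ ∫⁻ s in Ioc (0 : ℝ) 1, ‖h‖ₑ * ‖fderiv ℝ φ (x + s • h)‖ₑ := by
  have h1 : ∀ s : ℝ, HasDerivAt (fun s : ℝ => φ (x + s • h)) (fderiv ℝ φ (x + s • h) h) s :=
    fun s => by
    have h2 := ((hφ.differentiable (by simp)) (x + s • h)).hasFDerivAt
    have h3 : HasDerivAt (fun s : ℝ => x + s • h) h s := by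
      simpa using ((hasDerivAt_id s).smul_const h).const_add x
    exact h2.comp_hasDerivAt s h3
  have hc : Continuous fun s : ℝ => fderiv ℝ φ (x + s • h) h :=
    ((hφ.continuous_fderiv (by simp)).comp (by fun_prop)).clm_apply continuous_const
  have h2 := intervalIntegral.integral_eq_sub_of_hasDerivAt (a := 0) (b := 1) (fun s _ => h1 s)
    (hc.intervalIntegrable _ _)
  simp only [one_smul, zero_smul, add_zero] at h2
  rw [← enorm_neg, neg_sub, ← h2, intervalIntegral.integral_of_le zero_le_one]
  refine (enorm_integral_le_lintegral_enorm _).trans (lintegral_mono fun s => ?_)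
  rw [mul_comm]
  exact ContinuousLinearMap.le_opENorm _ _

variable [MeasurableSpace X] [BorelSpace X] [FiniteDimensional ℝ X] {μ : Measure X}
  [μ.IsAddHaarMeasure]

/-- Jensen for the uniform probability on the ball times the segment `(0, 1]`, then Tonelli: by
translation invariance each translate of `g` contributes the same integral, and `‖h‖ < r` yields the
factor `r`. -/
theorem lintegral_sub_average_le_of_le [CompleteSpace F] {φ : X → F} (hφ : Continuous φ)
    (hc : HasCompactSupport φ) {g : X → ℝ≥0∞} (hg : Continuous g)
    (hφg : ∀ x h, ‖φ x - φ (x + h)‖ₑ ≤ ∫⁻ s in Ioc (0 : ℝ) 1, ‖h‖ₑ * g (x + s • h))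
    {r : ℝ} (hr : 0 < r) :
    ∫⁻ x, ‖φ x - (μ.real (Metric.ball 0 r))⁻¹ • ∫ y in Metric.ball x r, φ y ∂μ‖ₑ ^ 2 ∂μ
      ≤ ENNReal.ofReal r ^ 2 * ∫⁻ x, g x ^ 2 ∂μ := by
  set B : Set X := Metric.ball 0 r with hB
  have hB0 : μ B ≠ 0 := (Metric.measure_ball_pos μ 0 hr).ne'
  have hBt : μ B ≠ ∞ := measure_ball_lt_top.ne
  set P : Measure X := (μ B)⁻¹ • μ.restrict B with hP
  have : IsProbabilityMeasure P := ⟨by simp [hP, ENNReal.inv_mul_cancel hB0 hBt]⟩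
  set R : Measure ℝ := volume.restrict (Ioc 0 1) with hR
  have : IsProbabilityMeasure R := ⟨by simp [hR]⟩
  have hPB : ∀ᵐ h ∂P, h ∈ B := Measure.ae_smul_measure (ae_restrict_mem measurableSet_ball) _
  have hav : ∀ x, (μ.real B)⁻¹ • ∫ y in Metric.ball x r, φ y ∂μ = ∫ h, φ (x + h) ∂P := fun x => by
    rw [hP, integral_smul_measure, ENNReal.toReal_inv]
    congr 1
    have h1 : Metric.ball x r = (fun h => -x + h) ⁻¹' B := by
      ext y
      simp [hB, dist_eq_norm, sub_eq_neg_add]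
    rw [h1, ← (measurePreserving_add_left μ (-x)).setIntegral_preimage_emb
      (Homeomorph.addLeft (-x)).measurableEmbedding (fun h => φ (x + h)) B]
    simp
  have hint : ∀ x, Integrable (fun h => φ (x + h)) P := fun x =>
    (hφ.comp (by fun_prop)).integrable_of_hasCompactSupport
      (hc.comp_homeomorph (Homeomorph.addLeft x))
  have hmeas : Measurable fun q : X × X × ℝ => g (q.1 + q.2.2 • q.2.1) :=
    Continuous.measurable (by fun_prop)
  have hpt : ∀ x, ‖φ x - ∫ h, φ (x + h) ∂P‖ₑ ^ 2
      ≤ ENNReal.ofReal r ^ 2 * ∫⁻ q, g (x + q.2 • q.1) ^ 2 ∂(P.prod R) := fun x => by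
    have hm : Measurable fun q : X × ℝ => g (x + q.2 • q.1) :=
      hmeas.comp (measurable_const.prodMk measurable_id)
    have h1 : φ x - ∫ h, φ (x + h) ∂P = ∫ h, (φ x - φ (x + h)) ∂P := by
      rw [integral_sub (integrable_const _) (hint x)]
      simp
    have h2 : ‖φ x - ∫ h, φ (x + h) ∂P‖ₑ
        ≤ ENNReal.ofReal r * ∫⁻ q, g (x + q.2 • q.1) ∂(P.prod R) := by
      rw [h1, lintegral_prod _ hm.aemeasurable, ← lintegral_const_mul _ hm.lintegral_prod_right']
      refine (enorm_integral_le_lintegral_enorm _).trans (lintegral_mono_ae ?_)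
      filter_upwards [hPB] with h hh
      refine (hφg x h).trans ?_
      have hm2 : Measurable fun s : ℝ => g (x + s • h) := (hg.comp (by fun_prop)).measurable
      rw [lintegral_const_mul _ hm2]
      gcongr
      rw [← ofReal_norm]
      exact ENNReal.ofReal_le_ofReal (mem_ball_zero_iff.1 hh).le
    calc _ ≤ (ENNReal.ofReal r * ∫⁻ q, g (x + q.2 • q.1) ∂(P.prod R)) ^ 2 := by gcongr
      _ ≤ _ := by
        rw [mul_pow]
        gcongr
        exact sq_lintegral_le hm.aemeasurable
  simp_rw [hav]
  calc ∫⁻ x, ‖φ x - ∫ h, φ (x + h) ∂P‖ₑ ^ 2 ∂μ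
      ≤ ∫⁻ x, ENNReal.ofReal r ^ 2 * ∫⁻ q, g (x + q.2 • q.1) ^ 2 ∂(P.prod R) ∂μ :=
        lintegral_mono hpt
    _ = ENNReal.ofReal r ^ 2 * ∫⁻ x, ∫⁻ q, g (x + q.2 • q.1) ^ 2 ∂(P.prod R) ∂μ :=
        lintegral_const_mul _ (hmeas.pow_const 2).lintegral_prod_right'
    _ = ENNReal.ofReal r ^ 2 * ∫⁻ q, ∫⁻ x, g (x + q.2 • q.1) ^ 2 ∂μ ∂(P.prod R) := by
        rw [lintegral_lintegral_swap (hmeas.pow_const 2).aemeasurable]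
    _ = _ := by
        simp_rw [lintegral_add_right_eq_self (fun x => g x ^ 2)]
        simp

/-- Replacing a function by its averages over the balls of radius `r` costs at most `r ‖∇φ‖`. -/
theorem lintegral_sub_average_le [CompleteSpace F] {φ : X → F} (hφ : ContDiff ℝ 1 φ)
    (hc : HasCompactSupport φ) {r : ℝ} (hr : 0 < r) :
    ∫⁻ x, ‖φ x - (μ.real (Metric.ball 0 r))⁻¹ • ∫ y in Metric.ball x r, φ y ∂μ‖ₑ ^ 2 ∂μ
      ≤ ENNReal.ofReal r ^ 2 * ∫⁻ x, ‖fderiv ℝ φ x‖ₑ ^ 2 ∂μ :=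
  lintegral_sub_average_le_of_le hφ.continuous hc (hφ.continuous_fderiv (by simp)).enorm
    (enorm_sub_le_lintegral_fderiv hφ) hr

theorem eLpNorm_two_sq {α G : Type*} [MeasurableSpace α] [NormedAddCommGroup G] {P : Measure α}
    (f : α → G) :
    eLpNorm f 2 P ^ 2 = ∫⁻ a, ‖f a‖ₑ ^ 2 ∂P := by
  have := eLpNorm_nnreal_pow_eq_lintegral (f := f) (μ := P) (p := 2) (by norm_num)
  simpa using this

end Rellich

/-! ### Averages over balls: from weak to strong convergence in `L²(Ω)` -/

section Average

theorem L2_norm_sq_eq_integral {α F : Type*} [MeasurableSpace α] {μ : Measure α}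
    [NormedAddCommGroup F] [InnerProductSpace ℝ F] (u : Lp F 2 μ) :
    ‖u‖ ^ 2 = ∫ a, ‖u a‖ ^ 2 ∂μ := by
  rw [← real_inner_self_eq_norm_sq u, L2.inner_def]
  simp

variable {N : ℕ} {Ω : Opens (E N)}

theorem tendsto_of_tendsto_inner {a : ℕ → E N} {a' : E N}
    (h : ∀ c, Tendsto (fun n => ⟪c, a n⟫_ℝ) atTop (𝓝 ⟪c, a'⟫_ℝ)) : Tendsto a atTop (𝓝 a') := by
  have h1 : ∀ b : E N, b = ∑ i, ⟪(e i : E N), b⟫_ℝ • (e i : E N) := fun b => by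
    ext j
    simp [e, Finset.sum_apply, Pi.single_apply, EuclideanSpace.inner_single_left]
  rw [h1 a']
  refine (tendsto_finsetSum (f := fun (i : Fin N) n => ⟪(e i : E N), a n⟫_ℝ • (e i : E N))
    Finset.univ fun i _ => (h _).smul_const _).congr fun n => ?_
  exact (h1 (a n)).symm

/-- The average of `u` over the balls of radius `r`. -/
def ballAverage (Ω : Opens (E N)) (r : ℝ) (u : E N → E N) (x : E N) : E N :=
  (volume.real (Metric.ball (0 : E N) r))⁻¹ • ∫ y in Metric.ball x r, u y ∂(dom Ω)

theorem lintegral_fderiv_sq_le (φ : 𝓓(Ω, E N)) :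
    ∫⁻ x, ‖fderiv ℝ φ x‖ₑ ^ 2 ≤ ENNReal.ofReal (N * ‖testPair φ‖) ^ 2 := by
  rw [← eLpNorm_two_sq (fderiv ℝ φ),
    ← eLpNorm_restrict_of_support_subset (support_fderiv_subset φ)]
  gcongr
  exact eLpNorm_fderiv_le φ

theorem aestronglyMeasurable_ballAverage (r : ℝ) (u : L2 Ω) :
    AEStronglyMeasurable (ballAverage Ω r u) (dom Ω) := by
  have h1 : AEStronglyMeasurable (fun q : E N × E N => u q.2) ((dom Ω).prod (dom Ω)) :=
    (Lp.aestronglyMeasurable u).comp_snd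
  have h2 : MeasurableSet {q : E N × E N | q.2 ∈ Metric.ball q.1 r} :=
    (isOpen_lt (continuous_snd.dist continuous_fst) continuous_const).measurableSet
  -- The moving domain becomes an indicator on the product space, so that measurability in `x`
  -- follows from Fubini.
  have h3 : ∀ x, ∫ y in Metric.ball x r, u y ∂(dom Ω)
      = ∫ y, {q : E N × E N | q.2 ∈ Metric.ball q.1 r}.indicator (fun q => u q.2) (x, y)
        ∂(dom Ω) := fun x => by
    rw [← integral_indicator measurableSet_ball]
    rfl
  unfold ballAverage
  simp_rw [h3]
  exact (h1.indicator h2).integral_prod_right'.const_smul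
    (volume.real (Metric.ball (0 : E N) r))⁻¹

variable [IsFiniteMeasure (dom Ω)]

theorem integrable_L2 (u : L2 Ω) : Integrable u (dom Ω) := (Lp.memLp u).integrable (by norm_num)

theorem integral_norm_le (u : L2 Ω) :
    ∫ y, ‖u y‖ ∂(dom Ω) ≤ (dom Ω).real univ ^ (1 / 2 : ℝ) * ‖u‖ := by
  have h := integral_mul_le_Lp_mul_Lq_of_nonneg (μ := dom Ω) (Real.HolderConjugate.two_two)
    (f := fun _ => (1 : ℝ)) (g := fun y => ‖u y‖) (by filter_upwards with x using zero_le_one)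
    (by filter_upwards with x using norm_nonneg _) (memLp_const _)
    (by simpa using (Lp.memLp u).norm)
  simp only [one_mul, Real.one_rpow, integral_const, smul_eq_mul, mul_one] at h
  refine h.trans (le_of_eq ?_)
  congr 1
  norm_num
  rw [← L2_norm_sq_eq_integral, ← Real.sqrt_eq_rpow, Real.sqrt_sq (norm_nonneg _)]

theorem norm_ballAverage_le (r : ℝ) (u : L2 Ω) (x : E N) :
    ‖ballAverage Ω r u x‖ ≤ (volume.real (Metric.ball (0 : E N) r))⁻¹
      * ((dom Ω).real univ ^ (1 / 2 : ℝ) * ‖u‖) := by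
  rw [ballAverage, norm_smul, Real.norm_of_nonneg (by positivity)]
  gcongr
  refine (norm_integral_le_integral_norm _).trans (le_trans ?_ (integral_norm_le u))
  exact setIntegral_le_integral (integrable_L2 u).norm
    (Eventually.of_forall fun _ => norm_nonneg _)

theorem memLp_ballAverage (r : ℝ) (u : L2 Ω) : MemLp (ballAverage Ω r u) 2 (dom Ω) :=
  MemLp.of_bound (aestronglyMeasurable_ballAverage r u) _
    (Eventually.of_forall (norm_ballAverage_le r u))

/-- The average over the balls of radius `r`, as an operator on `L²(Ω)`. -/
def ballAverageL (Ω : Opens (E N)) [IsFiniteMeasure (dom Ω)] (r : ℝ) : L2 Ω →L[ℝ] L2 Ω :=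
  LinearMap.mkContinuousOfExistsBound
    { toFun := fun u => (memLp_ballAverage r u).toLp _
      map_add' := fun u w => by
        rw [← MemLp.toLp_add, MemLp.toLp_eq_toLp_iff]
        refine Eventually.of_forall fun x => ?_
        rw [Pi.add_apply, ballAverage, ballAverage, ballAverage, ← smul_add,
          ← integral_add (integrable_L2 u).integrableOn (integrable_L2 w).integrableOn]
        congr 1
        exact integral_congr_ae (ae_restrict_of_ae (Lp.coeFn_add u w))
      map_smul' := fun c u => by
        rw [RingHom.id_apply, ← MemLp.toLp_const_smul, MemLp.toLp_eq_toLp_iff]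
        refine Eventually.of_forall fun x => ?_
        rw [Pi.smul_apply, ballAverage, ballAverage, smul_comm c]
        congr 1
        rw [← integral_smul]
        exact integral_congr_ae (ae_restrict_of_ae (Lp.coeFn_smul c u)) } (by
    refine ⟨(measureUnivNNReal (dom Ω)) ^ (2 : ℝ≥0∞).toReal⁻¹
      * ((volume.real (Metric.ball (0 : E N) r))⁻¹ * (dom Ω).real univ ^ (1 / 2 : ℝ)),
      fun u => ?_⟩
    simp only [LinearMap.coe_mk, AddHom.coe_mk]
    rw [mul_assoc, mul_assoc]
    refine Lp.norm_le_of_ae_bound (by positivity) ?_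
    filter_upwards [(memLp_ballAverage r u).coeFn_toLp] with x hx
    rw [hx]
    exact norm_ballAverage_le r u x)

theorem coeFn_ballAverageL (r : ℝ) (u : L2 Ω) :
    ∀ᵐ x ∂(dom Ω), ballAverageL Ω r u x = ballAverage Ω r u x :=
  (memLp_ballAverage r u).coeFn_toLp

/-- Averaging over balls turns weak convergence into strong convergence. -/
theorem tendsto_ballAverageL (r : ℝ) {u : ℕ → L2 Ω} {u' : L2 Ω} {M : ℝ} (hM : ∀ n, ‖u n‖ ≤ M)
    (h : ∀ w, Tendsto (fun n => ⟪u n, w⟫_ℝ) atTop (𝓝 ⟪u', w⟫_ℝ)) :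
    Tendsto (fun n => ballAverageL Ω r (u n)) atTop (𝓝 (ballAverageL Ω r u')) := by
  -- The value at `x` is a pairing with the indicator of a ball, so weak convergence gives pointwise
  -- convergence; the bound uniform in `x` then permits dominated convergence.
  have h1 : ∀ x, Tendsto (fun n => ballAverage Ω r (u n) x) atTop (𝓝 (ballAverage Ω r u' x)) :=
    fun x => by
    refine Tendsto.const_smul (tendsto_of_tendsto_inner fun c => ?_) _
    simp_rw [← L2.inner_indicatorConstLp_eq_inner_setIntegral ℝ measurableSet_ball
      (measure_ne_top (dom Ω) _) c]
    simp_rw [real_inner_comm _ (indicatorConstLp _ _ _ _)]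
    exact h _
  rw [tendsto_iff_norm_sub_tendsto_zero]
  have h2 : Tendsto (fun n => ‖ballAverageL Ω r (u n) - ballAverageL Ω r u'‖ ^ 2) atTop (𝓝 0) := by
    have h3 : ∀ n, ‖ballAverageL Ω r (u n) - ballAverageL Ω r u'‖ ^ 2
        = ∫ x, ‖ballAverage Ω r (u n) x - ballAverage Ω r u' x‖ ^ 2 ∂(dom Ω) := fun n => by
      rw [L2_norm_sq_eq_integral]
      refine integral_congr_ae ?_
      filter_upwards [Lp.coeFn_sub (ballAverageL Ω r (u n)) (ballAverageL Ω r u'),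
        coeFn_ballAverageL r (u n), coeFn_ballAverageL r u'] with x e1 e2 e3
      rw [e1, Pi.sub_apply, e2, e3]
    simp_rw [h3]
    set a := (volume.real (Metric.ball (0 : E N) r))⁻¹ with ha
    set b := (dom Ω).real univ ^ (1 / 2 : ℝ) with hb
    have h4 := tendsto_integral_of_dominated_convergence (μ := dom Ω)
      (F := fun n x => ‖ballAverage Ω r (u n) x - ballAverage Ω r u' x‖ ^ 2) (f := fun _ => (0 : ℝ))
      (fun _ => (a * (b * M) + a * (b * ‖u'‖)) ^ 2)
      (fun n => ((aestronglyMeasurable_ballAverage r (u n)).sub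
        (aestronglyMeasurable_ballAverage r u')).norm.pow 2) (integrable_const _)
      (fun n => Eventually.of_forall fun x => ?_) (Eventually.of_forall fun x => ?_)
    · simpa using h4
    · rw [norm_pow, norm_norm]
      gcongr
      refine (norm_sub_le _ _).trans (add_le_add ((norm_ballAverage_le r (u n) x).trans ?_)
        (norm_ballAverage_le r u' x))
      gcongr
      exact hM n
    · have := (((h1 x).sub_const (ballAverage Ω r u' x)).norm).pow 2
      simpa using this
  have h5 := (Real.continuous_sqrt.tendsto 0).comp h2
  simpa [Function.comp_def, Real.sqrt_sq (norm_nonneg _)] using h5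

/-- A test field vanishes outside `Ω`, so its averages over `Ω` and over the whole space coincide
and `lintegral_sub_average_le` applies. -/
theorem norm_sub_ballAverageL_le {r : ℝ} (hr : 0 < r) {P : H1Pair Ω} (hP : P ∈ H10 Ω) :
    ‖P.fst - ballAverageL Ω r P.fst‖ ≤ r * (N * ‖P‖) := by
  refine H10_induction (p := fun P => ‖P.fst - ballAverageL Ω r P.fst‖ ≤ r * (N * ‖P‖))
    ?_ (fun φ => ?_) hP
  · have h1 : Continuous fun P : H1Pair Ω => P.fst := (fstL (Ω := Ω)).continuous
    exact isClosed_le ((h1.sub ((ballAverageL Ω r).continuous.comp h1)).norm) (by fun_prop)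
  have hsub : Function.support φ ⊆ (Ω : Set (E N)) :=
    (subset_tsupport _).trans φ.tsupport_subset
  have h1 : ∀ x, ballAverage Ω r (testPair φ).fst x
      = (volume.real (Metric.ball (0 : E N) r))⁻¹ • ∫ y in Metric.ball x r, φ y := fun x => by
    rw [ballAverage]
    congr 1
    rw [integral_congr_ae (ae_restrict_of_ae (testPair_fst φ)),
      Measure.restrict_restrict measurableSet_ball, inter_comm,
      ← Measure.restrict_restrict Ω.isOpen.measurableSet]
    exact setIntegral_eq_integral_of_forall_compl_eq_zero fun y hy => by
      by_contra h; exact hy (hsub h)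
  have h2 := lintegral_sub_average_le (μ := (volume : Measure (E N)))
    (φ.contDiff.of_le (by norm_cast)) φ.hasCompactSupport hr
  have h3 : ‖(testPair φ).fst - ballAverageL Ω r (testPair φ).fst‖ₑ ^ 2
      ≤ (ENNReal.ofReal r * ENNReal.ofReal (N * ‖testPair φ‖)) ^ 2 := by
    rw [Lp.enorm_def, eLpNorm_two_sq]
    calc _ = ∫⁻ x in (Ω : Set (E N)), ‖φ x - (volume.real (Metric.ball (0 : E N) r))⁻¹
          • ∫ y in Metric.ball x r, φ y‖ₑ ^ 2 := by
          refine lintegral_congr_ae ?_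
          filter_upwards [Lp.coeFn_sub (testPair φ).fst (ballAverageL Ω r (testPair φ).fst),
            testPair_fst φ, coeFn_ballAverageL r (testPair φ).fst] with x e1 e2 e3
          rw [e1, Pi.sub_apply, e2, e3, h1]
      _ ≤ ∫⁻ x, ‖φ x - (volume.real (Metric.ball (0 : E N) r))⁻¹
          • ∫ y in Metric.ball x r, φ y‖ₑ ^ 2 := setLIntegral_le_lintegral _ _
      _ ≤ ENNReal.ofReal r ^ 2 * ∫⁻ x, ‖fderiv ℝ φ x‖ₑ ^ 2 := h2
      _ ≤ _ := by
          rw [mul_pow]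
          gcongr
          exact lintegral_fderiv_sq_le φ
  rw [← ENNReal.ofReal_mul hr.le] at h3
  have h4 := (ENNReal.pow_le_pow_left_iff two_ne_zero).1 h3
  rw [← ofReal_norm] at h4
  exact (ENNReal.ofReal_le_ofReal_iff (by positivity)).1 h4

/-- Modulo an operator which turns weak convergence into strong convergence, the `L²` norm is
small compared with the `H¹` norm. -/
theorem exists_norm_le_add_norm_ballAverageL {ε : ℝ} (hε : 0 < ε) :
    ∃ r, ∀ P ∈ H10 Ω, ‖P.fst‖ ≤ ε * ‖P‖ + ‖ballAverageL Ω r P.fst‖ := by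
  refine ⟨ε / (N + 1), fun P hP => ?_⟩
  have h1 := norm_sub_ballAverageL_le (r := ε / (N + 1)) (by positivity) hP
  have h2 : ε / (N + 1) * (N * ‖P‖) ≤ ε * ‖P‖ := by
    rw [div_mul_eq_mul_div, div_le_iff₀ (by positivity)]
    nlinarith [norm_nonneg P, mul_nonneg hε.le (norm_nonneg P)]
  have h3 := norm_add_le (P.fst - ballAverageL Ω (ε / (N + 1)) P.fst)
    (ballAverageL Ω (ε / (N + 1)) P.fst)
  rw [sub_add_cancel] at h3
  linarith

end Average

end LerayAlpha

end

noncomputable section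

namespace LerayAlpha

/-! ### Integrals of smooth functions depending on a parameter -/

section ParametricIntegral

variable {Z Y F : Type} [NormedAddCommGroup Z] [NormedSpace ℝ Z] [NormedAddCommGroup Y]
  [NormedSpace ℝ Y] [NormedAddCommGroup F] [NormedSpace ℝ F]

theorem hasFDerivAt_partial {g : Z × Y → F} (hg : Differentiable ℝ g) (z : Z) (y : Y) :
    HasFDerivAt (fun z => g (z, y)) ((fderiv ℝ g (z, y)).comp (ContinuousLinearMap.inl ℝ Z Y)) z :=
  (hg (z, y)).hasFDerivAt.comp z (hasFDerivAt_prodMk_left z y)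

variable [FiniteDimensional ℝ Z] [MeasurableSpace Y] [BorelSpace Y] {μ : Measure Y}
  [IsFiniteMeasureOnCompacts μ] {K : Set Y}

theorem hasFDerivAt_setIntegral [SecondCountableTopology Y] (hK : IsCompact K) {g : Z × Y → F}
    (hg : ContDiff ℝ 1 g) (z : Z) :
    HasFDerivAt (fun z => ∫ y in K, g (z, y) ∂μ)
      (∫ y in K, (fderiv ℝ g (z, y)).comp (ContinuousLinearMap.inl ℝ Z Y) ∂μ) z := by
  have : ProperSpace Z := FiniteDimensional.proper_real Z
  have : IsFiniteMeasure (μ.restrict K) := ⟨by simpa using hK.measure_lt_top⟩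
  have hd : Continuous fun q : Z × Y =>
      (fderiv ℝ g q).comp (ContinuousLinearMap.inl ℝ Z Y) :=
    (hg.continuous_fderiv (by simp)).clm_comp continuous_const
  obtain ⟨C, hC⟩ := ((isCompact_closedBall z 1).prod hK).exists_bound_of_continuousOn
    hd.continuousOn
  refine hasFDerivAt_integral_of_dominated_of_fderiv_le (𝕜 := ℝ) (bound := fun _ => C)
    (F' := fun z y => (fderiv ℝ g (z, y)).comp (ContinuousLinearMap.inl ℝ Z Y))
    (Metric.closedBall_mem_nhds z one_pos) (Eventually.of_forall fun z' => ?_) ?_ ?_ ?_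
    (integrable_const C) ?_
  · exact (hg.continuous.comp (by fun_prop)).aestronglyMeasurable
  · have : Continuous fun y => g (z, y) := hg.continuous.comp (by fun_prop)
    exact this.continuousOn.integrableOn_compact hK
  · exact (hd.comp (by fun_prop : Continuous fun y : Y => (z, y))).aestronglyMeasurable
  · filter_upwards [ae_restrict_mem hK.measurableSet] with y hy z' hz'
    exact hC (z', y) ⟨hz', hy⟩
  · filter_upwards with y z' hz'
    exact hasFDerivAt_partial (hg.differentiable (by simp)) z' y

/-- The differential is an integral of the same kind with values in a space of linear maps, so the
induction must leave the target space `F` free. -/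
theorem contDiff_setIntegral_nat [SecondCountableTopology Y] (hK : IsCompact K) (n : ℕ) :
    ∀ {F : Type} [NormedAddCommGroup F] [NormedSpace ℝ F] {g : Z × Y → F},
      ContDiff ℝ (⊤ : ℕ∞) g → ContDiff ℝ n fun z => ∫ y in K, g (z, y) ∂μ := by
  induction n with
  | zero =>
    intro F _ _ g hg
    have h1 : Differentiable ℝ fun z => ∫ y in K, g (z, y) ∂μ := fun z =>
      (hasFDerivAt_setIntegral hK (hg.of_le (by norm_cast)) z).differentiableAt
    exact contDiff_zero.2 h1.continuous
  | succ n ih =>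
    intro F _ _ g hg
    have hd := hasFDerivAt_setIntegral (μ := μ) hK (hg.of_le (by norm_cast) : ContDiff ℝ 1 g)
    push_cast
    rw [contDiff_succ_iff_fderiv]
    refine ⟨fun z => (hd z).differentiableAt, by simp, ?_⟩
    have h1 : fderiv ℝ (fun z => ∫ y in K, g (z, y) ∂μ) = fun z =>
        ∫ y in K, (fderiv ℝ g (z, y)).comp (ContinuousLinearMap.inl ℝ Z Y) ∂μ :=
      funext fun z => (hd z).fderiv
    rw [h1]
    exact ih ((contDiff_infty_iff_fderiv.1 hg).2.clm_comp contDiff_const)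

theorem contDiff_setIntegral [SecondCountableTopology Y] (hK : IsCompact K) {g : Z × Y → F}
    (hg : ContDiff ℝ (⊤ : ℕ∞) g) : ContDiff ℝ (⊤ : ℕ∞) fun z => ∫ y in K, g (z, y) ∂μ :=
  contDiff_infty.2 fun n => contDiff_setIntegral_nat hK n hg

end ParametricIntegral

/-! ### Bounds in `C¹` -/

section C1

variable {W W' : Type} [NormedAddCommGroup W] [NormedSpace ℝ W] [NormedAddCommGroup W']
  [NormedSpace ℝ W']

/-- `f` is differentiable, and `f` and its differential are bounded by `M`. -/
def C1Le (f : W → ℝ) (M : ℝ) : Prop :=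
  Differentiable ℝ f ∧ ∀ z, ‖f z‖ ≤ M ∧ ‖fderiv ℝ f z‖ ≤ M

theorem C1Le.nonneg {f : W → ℝ} {M : ℝ} (h : C1Le f M) : 0 ≤ M :=
  (norm_nonneg _).trans (h.2 0).1

theorem C1Le.mul {f g : W → ℝ} {M M' : ℝ} (hf : C1Le f M) (hg : C1Le g M') :
    C1Le (fun z => f z * g z) (2 * (M * M')) := by
  refine ⟨hf.1.mul hg.1, fun z => ⟨?_, ?_⟩⟩
  · rw [norm_mul]
    have := mul_le_mul (hf.2 z).1 (hg.2 z).1 (norm_nonneg _) hf.nonneg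
    linarith [mul_nonneg hf.nonneg hg.nonneg]
  · rw [fderiv_fun_mul (hf.1 z) (hg.1 z)]
    refine (norm_add_le _ _).trans ?_
    rw [norm_smul, norm_smul]
    have h1 := mul_le_mul (hf.2 z).1 (hg.2 z).2 (norm_nonneg _) hf.nonneg
    have h2 := mul_le_mul (hg.2 z).1 (hf.2 z).2 (norm_nonneg _) hg.nonneg
    linarith

theorem C1Le.comp {f : W → ℝ} {M : ℝ} (hf : C1Le f M) {A : W' → W} {L : W' →L[ℝ] W}
    (hA : ∀ z, HasFDerivAt A L z) (hL : ‖L‖ ≤ 1) : C1Le (fun z => f (A z)) M := by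
  refine ⟨fun z => (hf.1 (A z)).comp z (hA z).differentiableAt, fun z => ⟨(hf.2 _).1, ?_⟩⟩
  have h1 : fderiv ℝ (fun z => f (A z)) z = (fderiv ℝ f (A z)).comp L :=
    ((hf.1 (A z)).hasFDerivAt.comp z (hA z)).fderiv
  rw [h1]
  refine (ContinuousLinearMap.opNorm_comp_le _ _).trans ?_
  have := mul_le_mul (hf.2 (A z)).2 hL (norm_nonneg _) hf.nonneg
  linarith

theorem C1Le.const_mul {f : W → ℝ} {M : ℝ} (hf : C1Le f M) (c : ℝ) :
    C1Le (fun z => c * f z) (|c| * M) := by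
  refine ⟨hf.1.const_mul c, fun z => ⟨?_, ?_⟩⟩
  · rw [norm_mul]
    exact mul_le_mul_of_nonneg_left (hf.2 z).1 (abs_nonneg _)
  · rw [fderiv_const_mul (hf.1 z), norm_smul]
    exact mul_le_mul_of_nonneg_left (hf.2 z).2 (abs_nonneg _)

theorem C1Le.mono {f : W → ℝ} {M M' : ℝ} (hf : C1Le f M) (h : M ≤ M') : C1Le f M' :=
  ⟨hf.1, fun z => ⟨(hf.2 z).1.trans h, (hf.2 z).2.trans h⟩⟩

theorem exists_C1Le {f : W → ℝ} (hf : ContDiff ℝ 1 f) (hc : HasCompactSupport f) :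
    ∃ M, C1Le f M := by
  obtain ⟨A, hA⟩ := hc.exists_bound_of_continuous hf.continuous
  obtain ⟨B, hB⟩ := (hc.fderiv (𝕜 := ℝ)).exists_bound_of_continuous
    (hf.continuous_fderiv (by simp))
  exact ⟨max A B, hf.differentiable (by simp),
    fun z => ⟨(hA z).trans (le_max_left _ _), (hB z).trans (le_max_right _ _)⟩⟩

theorem C1Le.setIntegral {Y : Type} [NormedAddCommGroup Y] [NormedSpace ℝ Y] [MeasurableSpace Y]
    [BorelSpace Y] [SecondCountableTopology Y] [FiniteDimensional ℝ W] {μ : Measure Y}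
    [IsFiniteMeasureOnCompacts μ] {K : Set Y} (hK : IsCompact K) {g : W × Y → ℝ}
    (hg : ContDiff ℝ 1 g) {M : ℝ} (hM : ∀ y ∈ K, C1Le (fun z => g (z, y)) M) :
    C1Le (fun z => ∫ y in K, g (z, y) ∂μ) (M * μ.real K) := by
  refine ⟨fun z => (hasFDerivAt_setIntegral hK hg z).differentiableAt, fun z => ⟨?_, ?_⟩⟩
  · exact norm_setIntegral_le_of_norm_le_const hK.measure_lt_top fun y hy => ((hM y hy).2 z).1
  · rw [(hasFDerivAt_setIntegral hK hg z).fderiv]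
    refine norm_setIntegral_le_of_norm_le_const hK.measure_lt_top fun y hy => ?_
    rw [← (hasFDerivAt_partial (hg.differentiable (by simp)) z y).fderiv]
    exact ((hM y hy).2 z).2

end C1

/-! ### Translations as divergences -/

section Translation

variable {N : ℕ}

/-- A potential for the translations of `G (·, h)` by `(0, h)`, integrated over `‖h‖ ≤ R`. -/
def transPotential (G : (ℝ × E N) × E N → ℝ) (R : ℝ) (j : Fin N) (z : ℝ × E N) : ℝ :=
  ∫ q in Metric.closedBall (0 : E N) R ×ˢ Icc (0 : ℝ) 1,
    q.1 j * G (z - q.2 • ((0 : ℝ), q.1), q.1)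

variable {G : (ℝ × E N) × E N → ℝ} {R : ℝ}

theorem isCompact_transDomain (R : ℝ) :
    IsCompact (Metric.closedBall (0 : E N) R ×ˢ Icc (0 : ℝ) 1) :=
  (isCompact_closedBall _ _).prod isCompact_Icc

theorem contDiff_trans (hG : ContDiff ℝ (⊤ : ℕ∞) G) (j : Fin N) :
    ContDiff ℝ (⊤ : ℕ∞) fun w : (ℝ × E N) × (E N × ℝ) =>
      w.2.1 j * G (w.1 - w.2.2 • ((0 : ℝ), w.2.1), w.2.1) := by
  have h1 : ContDiff ℝ (⊤ : ℕ∞) fun w : (ℝ × E N) × (E N × ℝ) => w.2.1 j :=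
    (ContinuousLinearMap.contDiff (EuclideanSpace.proj (𝕜 := ℝ) j : E N →L[ℝ] ℝ)).comp
      (contDiff_fst.comp contDiff_snd)
  refine h1.mul (hG.comp ?_)
  fun_prop

theorem contDiff_transPotential (hG : ContDiff ℝ (⊤ : ℕ∞) G) (j : Fin N) :
    ContDiff ℝ (⊤ : ℕ∞) (transPotential G R j) :=
  contDiff_setIntegral (isCompact_transDomain R) (contDiff_trans hG j)

theorem C1Le_transPotential (hG : ContDiff ℝ (⊤ : ℕ∞) G) {M : ℝ}
    (hM : ∀ h, C1Le (fun z => G (z, h)) M) (j : Fin N) :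
    C1Le (transPotential G R j)
      (R * M * volume.real (Metric.closedBall (0 : E N) R ×ˢ Icc (0 : ℝ) 1)) := by
  refine C1Le.setIntegral (isCompact_transDomain R)
    ((contDiff_trans hG j).of_le (by norm_cast)) ?_
  rintro ⟨h, s⟩ ⟨hh, -⟩
  have h1 := ((hM h).comp (A := fun z : ℝ × E N => z - s • ((0 : ℝ), h))
    (L := ContinuousLinearMap.id ℝ _) (fun z => (hasFDerivAt_id z).sub_const _)
    ContinuousLinearMap.norm_id_le).const_mul (h j)
  refine h1.mono ?_
  have h2 : |h j| ≤ R := (PiLp.norm_apply_le h j).trans (by simpa using hh)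
  exact mul_le_mul_of_nonneg_right h2 (hM h).nonneg

/-- A value of `G` at a point contributes to the potential only along the segment from that point to
its translate by `h`. -/
theorem support_transPotential_subset {A : Set (ℝ × E N)}
    (hA : ∀ z h, G (z, h) ≠ 0 → ∀ s ∈ Icc (0 : ℝ) 1, z + s • ((0 : ℝ), h) ∈ A) (j : Fin N) :
    Function.support (transPotential G R j) ⊆ A := by
  intro z hz
  by_contra hzA
  refine hz (setIntegral_eq_zero_of_forall_eq_zero fun q hq => ?_)
  by_cases h0 : G (z - q.2 • ((0 : ℝ), q.1), q.1) = 0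
  · rw [h0, mul_zero]
  · have := hA _ _ h0 q.2 hq.2
    rw [sub_add_cancel] at this
    exact absurd this hzA

/-- Under the integral the divergence produces `∑ hⱼ ∂ⱼG`, which is the derivative in `s` of `-G (z
- s h, h)`; integration over `s ∈ [0, 1]` leaves the difference of the end values. -/
theorem sum_fderiv_transPotential (hG : ContDiff ℝ (⊤ : ℕ∞) G) (z : ℝ × E N) :
    ∑ j, fderiv ℝ (transPotential G R j) z ((0 : ℝ), (e j : E N))
      = ∫ h in Metric.closedBall (0 : E N) R, (G (z, h) - G (z - ((0 : ℝ), h), h)) := by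
  set K := Metric.closedBall (0 : E N) R ×ˢ Icc (0 : ℝ) 1 with hK
  have hKc : IsCompact K := isCompact_transDomain R
  set D : E N × ℝ → ℝ := fun q => fderiv ℝ G (z - q.2 • ((0 : ℝ), q.1), q.1)
    (((0 : ℝ), q.1), (0 : E N)) with hD
  have hGd : Differentiable ℝ G := hG.differentiable (by simp)
  have hDc : Continuous D :=
    ((hG.continuous_fderiv (by simp)).comp (by fun_prop)).clm_apply (by fun_prop)
  have h1 : ∀ j, fderiv ℝ (transPotential G R j) z ((0 : ℝ), (e j : E N))
      = ∫ q in K, q.1 j * fderiv ℝ G (z - q.2 • ((0 : ℝ), q.1), q.1)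
        (((0 : ℝ), (e j : E N)), (0 : E N)) := fun j => by
    have h2 := hasFDerivAt_setIntegral (μ := (volume : Measure (E N × ℝ))) hKc
      ((contDiff_trans hG j).of_le (by norm_cast)) z
    have hc : Continuous fun q : E N × ℝ => (fderiv ℝ (fun w : (ℝ × E N) × (E N × ℝ) =>
        w.2.1 j * G (w.1 - w.2.2 • ((0 : ℝ), w.2.1), w.2.1)) (z, q)).comp
          (ContinuousLinearMap.inl ℝ (ℝ × E N) (E N × ℝ)) :=
      (((contDiff_trans hG j).continuous_fderiv (by simp)).comp (by fun_prop)).clm_comp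
        continuous_const
    rw [show fderiv ℝ (transPotential G R j) z = _ from h2.fderiv,
      ContinuousLinearMap.integral_apply (hc.continuousOn.integrableOn_compact hKc)]
    refine integral_congr_ae (Eventually.of_forall fun q => ?_)
    have h3 := hasFDerivAt_partial ((contDiff_trans hG j).differentiable (by simp)) z q
    have h4 : HasFDerivAt (fun z : ℝ × E N => q.1 j * G (z - q.2 • ((0 : ℝ), q.1), q.1))
        (q.1 j • ((fderiv ℝ G (z - q.2 • ((0 : ℝ), q.1), q.1)).comp
          (ContinuousLinearMap.inl ℝ (ℝ × E N) (E N)))) z := by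
      refine HasFDerivAt.const_mul ?_ _
      have a := hasFDerivAt_partial hGd (z - q.2 • ((0 : ℝ), q.1)) q.1
      have b : HasFDerivAt (fun z : ℝ × E N => z - q.2 • ((0 : ℝ), q.1))
        (ContinuousLinearMap.id ℝ (ℝ × E N)) z := (hasFDerivAt_id z).sub_const _
      have c := HasFDerivAt.comp (g := fun z => G (z, q.1)) z a b
      rwa [ContinuousLinearMap.comp_id] at c
    have h5 := h3.unique h4
    simp only [h5]
    simp
  have hi : ∀ j, IntegrableOn (fun q : E N × ℝ => q.1 j *
      fderiv ℝ G (z - q.2 • ((0 : ℝ), q.1), q.1) (((0 : ℝ), (e j : E N)), (0 : E N))) K := fun j => by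
    refine ContinuousOn.integrableOn_compact hKc (Continuous.continuousOn ?_)
    exact Continuous.mul (by fun_prop)
      (((hG.continuous_fderiv (by simp)).comp (by fun_prop)).clm_apply continuous_const)
  have hsum : ∀ q : E N × ℝ, ∑ j, q.1 j * fderiv ℝ G (z - q.2 • ((0 : ℝ), q.1), q.1)
      (((0 : ℝ), (e j : E N)), (0 : E N)) = D q := fun q => by
    have hx : q.1 = ∑ i, q.1 i • (e i : E N) := by
      ext j
      simp [Finset.sum_apply, e, Pi.single_apply]
    have h6 : (((0 : ℝ), q.1), (0 : E N)) = ∑ j, q.1 j • (((0 : ℝ), (e j : E N)), (0 : E N)) := by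
      ext1
      · ext1
        · simp [Prod.fst_sum]
        · simpa [Prod.fst_sum, Prod.snd_sum] using hx
      · simp [Prod.snd_sum]
    rw [hD]
    simp only
    rw [h6, map_sum]
    exact Finset.sum_congr rfl fun j _ => by rw [map_smul, smul_eq_mul]
  simp_rw [h1]
  rw [← integral_finsetSum _ fun j _ => hi j]
  simp_rw [hsum]
  rw [hK, Measure.volume_eq_prod, setIntegral_prod _ (by
    rw [← Measure.volume_eq_prod]; exact hDc.continuousOn.integrableOn_compact hKc)]
  refine integral_congr_ae (Eventually.of_forall fun h => ?_)
  have h7 : ∀ s : ℝ, HasDerivAt (fun s : ℝ => -G (z - s • ((0 : ℝ), h), h)) (D (h, s)) s := fun s => by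
    have h8 : HasDerivAt (fun s : ℝ => z - s • ((0 : ℝ), h)) (-((0 : ℝ), h)) s := by
      simpa using ((hasDerivAt_id s).smul_const ((0 : ℝ), h)).const_sub z
    have h9 := ((hasFDerivAt_partial hGd (z - s • ((0 : ℝ), h)) h).comp_hasDerivAt s h8).neg
    refine HasDerivAt.congr_deriv (f := fun s : ℝ => -G (z - s • ((0 : ℝ), h), h)) h9 ?_
    rw [map_neg, neg_neg]
    rfl
  have h8 := intervalIntegral.integral_eq_sub_of_hasDerivAt (a := 0) (b := 1) (fun s _ => h7 s)
    ((hDc.comp (by fun_prop : Continuous fun s : ℝ => (h, s))).intervalIntegrable _ _)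
  simp only
  rw [integral_Icc_eq_integral_Ioc, ← intervalIntegral.integral_of_le zero_le_one, h8]
  simp
  ring

end Translation

end LerayAlpha

end

noncomputable section

namespace LerayAlpha

set_option maxSynthPendingDepth 3

/-! ### Limits of distributions whose gradients converge -/

section TestFunctions

/-- A smooth function supported in a compact subset of `U`, as a test function. -/
def mkTest {W : Type*} [NormedAddCommGroup W] [NormedSpace ℝ W] {U : Opens W} (f : W → ℝ)
    (hf : ContDiff ℝ (⊤ : ℕ∞) f) {A : Set W} (hA : IsCompact A) (hAU : A ⊆ U)
    (hs : Function.support f ⊆ A) : 𝓓(U, ℝ) :=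
  ⟨f, hf, HasCompactSupport.of_support_subset_isCompact hA hs,
    (closure_minimal hs hA.isClosed).trans hAU⟩

@[simp] theorem mkTest_apply {W : Type*} [NormedAddCommGroup W] [NormedSpace ℝ W] {U : Opens W}
    (f : W → ℝ) (hf : ContDiff ℝ (⊤ : ℕ∞) f) {A : Set W} (hA : IsCompact A) (hAU : A ⊆ U)
    (hs : Function.support f ⊆ A) (x : W) : mkTest f hf hA hAU hs x = f x := rfl

theorem C1Le.sub {W : Type} [NormedAddCommGroup W] [NormedSpace ℝ W] {f g : W → ℝ} {M M' : ℝ}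
    (hf : C1Le f M) (hg : C1Le g M') : C1Le (fun z => f z - g z) (M + M') := by
  refine ⟨hf.1.sub hg.1, fun z => ⟨?_, ?_⟩⟩
  · exact (norm_sub_le _ _).trans (add_le_add (hf.2 z).1 (hg.2 z).1)
  · rw [fderiv_fun_sub (hf.1 z) (hg.1 z)]
    exact (norm_sub_le _ _).trans (add_le_add (hf.2 z).2 (hg.2 z).2)

end TestFunctions

section Pressure

variable {N : ℕ} {Ω : Opens (E N)} {T : ℝ}

theorem contDiff_slice (χ : 𝓓(cylinder T Ω, ℝ)) (t : ℝ) :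
    ContDiff ℝ (⊤ : ℕ∞) fun y : E N => χ (t, y) :=
  χ.contDiff.comp (by fun_prop)

theorem hasCompactSupport_slice (χ : 𝓓(cylinder T Ω, ℝ)) (t : ℝ) :
    HasCompactSupport fun y : E N => χ (t, y) :=
  HasCompactSupport.of_support_subset_isCompact (χ.hasCompactSupport.isCompact.image continuous_snd)
    fun y hy => ⟨(t, y), subset_tsupport _ hy, rfl⟩

theorem integrable_slice (χ : 𝓓(cylinder T Ω, ℝ)) (t : ℝ) : Integrable fun y : E N => χ (t, y) :=
  (contDiff_slice χ t).continuous.integrable_of_hasCompactSupport (hasCompactSupport_slice χ t)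

/-- The integral of `χ` in the space variables. -/
def meanFun (χ : 𝓓(cylinder T Ω, ℝ)) (z : ℝ × E N) : ℝ := ∫ y, χ (z.1, y)

theorem meanFun_eq (χ : 𝓓(cylinder T Ω, ℝ)) (z : ℝ × E N) :
    meanFun χ z = ∫ y in Prod.snd '' tsupport χ, χ (z.1, y) :=
  (setIntegral_eq_integral_of_forall_compl_eq_zero fun y hy => by
    by_contra h
    exact hy ⟨(z.1, y), subset_tsupport _ h, rfl⟩).symm

theorem contDiff_meanFun (χ : 𝓓(cylinder T Ω, ℝ)) : ContDiff ℝ (⊤ : ℕ∞) (meanFun χ) := by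
  rw [funext (meanFun_eq χ)]
  refine contDiff_setIntegral (g := fun w : (ℝ × E N) × E N => χ (w.1.1, w.2))
    (χ.hasCompactSupport.isCompact.image continuous_snd) (χ.contDiff.comp ?_)
  fun_prop

theorem C1Le_time {f : ℝ × E N → ℝ} {M : ℝ} (h : C1Le f M) (y : E N) :
    C1Le (fun z : ℝ × E N => f (z.1, y)) M := by
  refine h.comp (A := fun z : ℝ × E N => (z.1, y))
    (L := (ContinuousLinearMap.fst ℝ ℝ (E N)).prod 0)
    (fun z => hasFDerivAt_fst.prodMk (hasFDerivAt_const _ _)) ?_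
  refine ContinuousLinearMap.opNorm_le_bound _ zero_le_one fun z => ?_
  rw [one_mul]
  simp [Prod.norm_def]

theorem C1Le_space {f : E N → ℝ} {M : ℝ} (h : C1Le f M) (x₀ : E N) :
    C1Le (fun z : ℝ × E N => f (z.2 - x₀)) M :=
  h.comp (A := fun z : ℝ × E N => z.2 - x₀) (L := ContinuousLinearMap.snd ℝ ℝ (E N))
    (fun _ => hasFDerivAt_snd.sub_const x₀) (ContinuousLinearMap.norm_snd_le ..)

theorem C1Le_meanFun [IsFiniteMeasure (dom Ω)] {χ : 𝓓(cylinder T Ω, ℝ)} {M : ℝ} (h : C1Le χ M) :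
    C1Le (meanFun χ) (M * volume.real (Ω : Set (E N))) := by
  rw [funext (meanFun_eq χ)]
  have hK : IsCompact (Prod.snd '' tsupport χ) := χ.hasCompactSupport.isCompact.image continuous_snd
  refine (C1Le.setIntegral (g := fun w : (ℝ × E N) × E N => χ (w.1.1, w.2)) hK
    ((χ.contDiff.comp (by fun_prop)).of_le (by norm_cast)) fun y _ => C1Le_time h y).mono ?_
  refine mul_le_mul_of_nonneg_left (measureReal_mono ?_ ?_) h.nonneg
  · rintro _ ⟨z, hz, rfl⟩
    exact (χ.tsupport_subset hz).2
  · have := measure_ne_top (dom Ω) univ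
    rwa [Measure.restrict_apply_univ] at this

theorem meanFun_ne_zero {χ : 𝓓(cylinder T Ω, ℝ)} {z : ℝ × E N} (h : meanFun χ z ≠ 0) :
    z.1 ∈ Prod.fst '' tsupport χ := by
  by_contra hz
  refine h (integral_eq_zero_of_ae (Eventually.of_forall fun y => ?_))
  by_contra hy
  exact hz ⟨(z.1, y), subset_tsupport _ hy, rfl⟩

theorem isCompact_fst_tsupport (χ : 𝓓(cylinder T Ω, ℝ)) : IsCompact (Prod.fst '' tsupport χ) :=
  χ.hasCompactSupport.isCompact.image continuous_fst

theorem fst_tsupport_subset (χ : 𝓓(cylinder T Ω, ℝ)) : Prod.fst '' tsupport χ ⊆ Ioo 0 T := by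
  rintro _ ⟨z, hz, rfl⟩
  exact (χ.tsupport_subset hz).1

/-- The test function `(t, x) ↦ (∫ χ(t, y) dy) ρ(x)`. -/
def meanTimes (ρ : 𝓓(Ω, ℝ)) : 𝓓(cylinder T Ω, ℝ) →ₗ[ℝ] 𝓓(cylinder T Ω, ℝ) where
  toFun χ := mkTest (fun z => meanFun χ z * ρ z.2)
    ((contDiff_meanFun χ).mul (ρ.contDiff.comp contDiff_snd))
    (A := (Prod.fst '' tsupport χ) ×ˢ tsupport ρ)
    ((isCompact_fst_tsupport χ).prod ρ.hasCompactSupport)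
    (prod_mono (fst_tsupport_subset χ) ρ.tsupport_subset)
    fun _ hz => ⟨meanFun_ne_zero (left_ne_zero_of_mul hz),
      subset_tsupport _ (right_ne_zero_of_mul hz)⟩
  map_add' χ χ' := by
    ext z
    change meanFun (χ + χ') z * ρ z.2 = meanFun χ z * ρ z.2 + meanFun χ' z * ρ z.2
    simp only [meanFun, add_apply]
    rw [integral_add (integrable_slice χ _) (integrable_slice χ' _), add_mul]
  map_smul' c χ := by
    ext z
    change meanFun (c • χ) z * ρ z.2 = c * (meanFun χ z * ρ z.2)
    simp only [meanFun, smul_apply, smul_eq_mul]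
    rw [integral_const_mul, mul_assoc]

theorem meanTimes_apply (ρ : 𝓓(Ω, ℝ)) (χ : 𝓓(cylinder T Ω, ℝ)) (z : ℝ × E N) :
    meanTimes ρ χ z = (∫ y, χ (z.1, y)) * ρ z.2 := rfl

/-- A factor of unit integral leaves the spatial mean unchanged; this allows one bump to be
exchanged for another. -/
theorem meanTimes_meanTimes (ρ σ : 𝓓(Ω, ℝ)) (hσ : ∫ x, σ x = 1) (χ : 𝓓(cylinder T Ω, ℝ)) :
    meanTimes ρ (meanTimes σ χ) = meanTimes ρ χ := by
  ext z
  rw [meanTimes_apply, meanTimes_apply]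
  simp_rw [meanTimes_apply]
  rw [integral_const_mul, hσ, mul_one]

theorem exists_C1Le_meanTimes [IsFiniteMeasure (dom Ω)] (ρ : 𝓓(Ω, ℝ)) :
    ∃ B, 0 ≤ B ∧ ∀ (χ : 𝓓(cylinder T Ω, ℝ)) M, C1Le χ M → C1Le (meanTimes ρ χ) (B * M) := by
  obtain ⟨R, hR⟩ := exists_C1Le (ρ.contDiff.of_le (by norm_cast)) ρ.hasCompactSupport
  have hR0 := hR.nonneg
  refine ⟨2 * (volume.real (Ω : Set (E N)) * R), by positivity, fun χ M hχ => ?_⟩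
  have h1 := C1Le_space hR 0
  simp only [sub_zero] at h1
  exact ((C1Le_meanFun hχ).mul h1).mono (le_of_eq (by ring))

/-- The numbers `p n χ` converge, and their limit is bounded by `B`. -/
def LimLe (p : ℕ → 𝓓'(cylinder T Ω, ℝ)) (χ : 𝓓(cylinder T Ω, ℝ)) (B : ℝ) : Prop :=
  ∃ l, Tendsto (fun n => p n χ) atTop (𝓝 l) ∧ |l| ≤ B

/-- The gradients of the `p n` converge, to distributions of order one. -/
def GradLim (p : ℕ → 𝓓'(cylinder T Ω, ℝ)) (F : Fin N → 𝓓(cylinder T Ω, ℝ) → ℝ) (C : ℝ) : Prop :=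
  0 ≤ C ∧ ∀ j φ, Tendsto (fun n => (∂_{((0 : ℝ), (e j : E N))} (p n)) φ) atTop (𝓝 (F j φ)) ∧
    ∀ M, C1Le φ M → |F j φ| ≤ C * M

variable {p : ℕ → 𝓓'(cylinder T Ω, ℝ)} {F : Fin N → 𝓓(cylinder T Ω, ℝ) → ℝ} {C : ℝ}

theorem LimLe.add {χ χ' : 𝓓(cylinder T Ω, ℝ)} {B B' : ℝ} (h : LimLe p χ B) (h' : LimLe p χ' B') :
    LimLe p (χ + χ') (B + B') := by
  obtain ⟨l, hl, hB⟩ := h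
  obtain ⟨l', hl', hB'⟩ := h'
  refine ⟨l + l', ?_, (abs_add_le _ _).trans (add_le_add hB hB')⟩
  simp_rw [map_add]
  exact hl.add hl'

theorem LimLe.neg {χ : 𝓓(cylinder T Ω, ℝ)} {B : ℝ} (h : LimLe p χ B) : LimLe p (-χ) B := by
  obtain ⟨l, hl, hB⟩ := h
  refine ⟨-l, ?_, by rwa [abs_neg]⟩
  simp_rw [map_neg]
  exact hl.neg

theorem LimLe.sum {ι : Type*} (s : Finset ι) {χ : ι → 𝓓(cylinder T Ω, ℝ)} {B : ι → ℝ}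
    (h : ∀ i ∈ s, LimLe p (χ i) (B i)) : LimLe p (∑ i ∈ s, χ i) (∑ i ∈ s, B i) := by
  classical
  induction s using Finset.induction_on with
  | empty => exact ⟨0, by simp, by simp⟩
  | insert i s hi ih =>
    rw [Finset.sum_insert hi, Finset.sum_insert hi]
    exact (h i (Finset.mem_insert_self i s)).add
      (ih fun k hk => h k (Finset.mem_insert_of_mem hk))

/-- On a divergence of test functions `p n` acts through its gradient alone. Only the limit gets a
bound; no uniform estimate of the `p n` is involved. -/
theorem GradLim.limLe_div (h : GradLim p F C) {Φ : Fin N → 𝓓(cylinder T Ω, ℝ)}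
    {χ : 𝓓(cylinder T Ω, ℝ)} (hχ : ∀ z, χ z = ∑ j, fderiv ℝ (Φ j) z ((0 : ℝ), (e j : E N)))
    {M : ℝ} (hM : ∀ j, C1Le (Φ j) M) : LimLe p χ (N * (C * M)) := by
  refine ⟨-∑ j, F j (Φ j), ?_, ?_⟩
  · have h1 : χ = ∑ j, ∂_{((0 : ℝ), (e j : E N))} (Φ j) := by
      ext z
      rw [hχ, sum_apply]
      exact Finset.sum_congr rfl fun j _ => (lineDerivOp_apply_eq_fderiv _ _ _).symm
    have h2 : ∀ n, p n χ = -∑ j, (∂_{((0 : ℝ), (e j : E N))} (p n)) (Φ j) := fun n => by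
      rw [h1, map_sum, ← Finset.sum_neg_distrib]
      refine Finset.sum_congr rfl fun j _ => ?_
      rw [Distribution.lineDerivOp_apply_apply, map_neg, neg_neg]
    simp_rw [h2]
    exact (tendsto_finsetSum _ fun j _ => (h.2 j (Φ j)).1).neg
  · rw [abs_neg]
    refine (Finset.abs_sum_le_sum_abs _ _).trans ?_
    refine (Finset.sum_le_sum fun j _ => (h.2 j (Φ j)).2 M (hM j)).trans ?_
    simp

/-- The condition on segments keeps the potentials of the translations compactly supported in the
cylinder. -/
theorem GradLim.limLe_trans (h : GradLim p F C) {G : (ℝ × E N) × E N → ℝ}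
    (hG : ContDiff ℝ (⊤ : ℕ∞) G) {R : ℝ} {A : Set (ℝ × E N)} (hA : IsCompact A)
    (hAQ : A ⊆ cylinder T Ω)
    (hGA : ∀ z h, G (z, h) ≠ 0 → ∀ s ∈ Icc (0 : ℝ) 1, z + s • ((0 : ℝ), h) ∈ A)
    {M : ℝ} (hM : ∀ h, C1Le (fun z => G (z, h)) M) {χ : 𝓓(cylinder T Ω, ℝ)}
    (hχ : ∀ z, χ z = ∫ h in Metric.closedBall (0 : E N) R, (G (z, h) - G (z - ((0 : ℝ), h), h))) :
    LimLe p χ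
      (N * (C * (R * M * volume.real (Metric.closedBall (0 : E N) R ×ˢ Icc (0 : ℝ) 1)))) := by
  refine h.limLe_div (Φ := fun j => mkTest (transPotential G R j) (contDiff_transPotential hG j) hA
    hAQ (support_transPotential_subset hGA j)) (fun z => ?_) fun j => C1Le_transPotential hG hM j
  rw [hχ, ← sum_fderiv_transPotential hG]
  rfl

/-- On test functions supported over `S`, subtracting the mean times `ρ` makes `p n` converge. -/
def LocalAt (p : ℕ → 𝓓'(cylinder T Ω, ℝ)) (ρ : 𝓓(Ω, ℝ)) (S : Set (E N)) : Prop :=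
  ∃ B, 0 ≤ B ∧ ∀ (χ : 𝓓(cylinder T Ω, ℝ)) M, (∀ z, χ z ≠ 0 → z.2 ∈ S) → C1Le χ M →
    LimLe p (χ - meanTimes ρ χ) (B * M)

/-- Inside a ball, `χ` can be deformed into its mean times a bump by translations along segments
that stay in a larger ball contained in `Ω`: mollify `χ` by `ρ`, then read `ρ ∗ χ` as a
superposition of translates of `ρ`. -/
theorem GradLim.exists_localAt (h : GradLim p F C) {x₀ : E N} (hx₀ : x₀ ∈ Ω) :
    ∃ r > 0, ∃ ρ : 𝓓(Ω, ℝ), LocalAt p ρ (Metric.closedBall x₀ r) := by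
  obtain ⟨r', hr', hball⟩ := Metric.isOpen_iff.1 Ω.isOpen x₀ hx₀
  -- Points of a ball of radius `r` moved by at most `r` stay within `2r < r'` of `x₀`.
  set r := r' / 3 with hr
  have hr0 : 0 < r := by positivity
  have hsub : Metric.closedBall x₀ (2 * r) ⊆ (Ω : Set (E N)) :=
    (Metric.closedBall_subset_ball (by rw [hr]; linarith)).trans hball
  let f : ContDiffBump (0 : E N) := ⟨r / 2, r, by positivity, by linarith⟩
  set ρ : E N → ℝ := f.normed volume with hρ
  have hρs : ContDiff ℝ (⊤ : ℕ∞) ρ := f.contDiff_normed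
  have hρ1 : ∫ x, ρ x = 1 := f.integral_normed
  have hρ0 : ∀ x, ρ x ≠ 0 → ‖x‖ ≤ r := fun x hx => by
    have : x ∈ Function.support (f.normed volume) := hx
    rw [f.support_normed_eq] at this
    exact (mem_ball_zero_iff.1 this).le
  obtain ⟨Mρ, hMρ⟩ := exists_C1Le (hρs.of_le (by norm_cast)) f.hasCompactSupport_normed
  have hMρ0 := hMρ.nonneg
  let ρ₀ : 𝓓(Ω, ℝ) := mkTest (fun x => ρ (x - x₀)) (hρs.comp (by fun_prop))
    (isCompact_closedBall x₀ (2 * r)) hsub fun x hx => by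
      rw [mem_closedBall_iff_norm]
      linarith [hρ0 _ hx]
  refine ⟨r, hr0, ρ₀, ?_⟩
  set V₀ := volume.real (Metric.closedBall (0 : E N) r ×ˢ Icc (0 : ℝ) 1) with hV₀
  have hC := h.1
  refine ⟨N * (C * (r * (3 * Mρ) * V₀)), by positivity, fun χ M hχS hχM => ?_⟩
  -- Integrating `G (z, h) - G (z - h, h)` in `h`, the first product gives `χ - ρ ∗ χ` and the
  -- second gives `ρ ∗ χ - (∫ χ) ρ(· - x₀)`; the convolutions cancel.
  set G : (ℝ × E N) × E N → ℝ := fun w => ρ w.2 * χ w.1 - χ (w.1.1, x₀ + w.2) * ρ (w.1.2 - x₀)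
    with hG
  have hGs : ContDiff ℝ (⊤ : ℕ∞) G := by
    refine ContDiff.sub ?_ ?_
    · exact (hρs.comp contDiff_snd).mul (χ.contDiff.comp contDiff_fst)
    · exact (χ.contDiff.comp (by fun_prop)).mul (hρs.comp (by fun_prop))
  have hGM : ∀ h, C1Le (fun z => G (z, h)) (3 * Mρ * M) := fun h => by
    refine ((hχM.const_mul (ρ h)).sub ((C1Le_time hχM (x₀ + h)).mul (C1Le_space hMρ x₀))).mono ?_
    have := mul_le_mul_of_nonneg_right (hMρ.2 h).1 hχM.nonneg
    rw [Real.norm_eq_abs] at this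
    linarith
  have key := h.limLe_trans hGs (R := r)
    ((isCompact_fst_tsupport χ).prod (isCompact_closedBall x₀ (2 * r)))
    (prod_mono (fst_tsupport_subset χ) hsub) ?_ hGM (χ := χ - meanTimes ρ₀ χ) (fun z => ?_)
  · convert key using 1
    ring
  · intro z h hz s hs
    have hs1 : ‖s • h‖ ≤ ‖h‖ := by
      rw [norm_smul, Real.norm_of_nonneg hs.1]
      nlinarith [hs.2, norm_nonneg h]
    by_cases h1 : ρ h * χ z = 0
    · have h2 : χ (z.1, x₀ + h) * ρ (z.2 - x₀) ≠ 0 := fun h2 => hz (by simp [hG, h1, h2])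
      have h3 := left_ne_zero_of_mul h2
      have h4 := hχS _ h3
      have h5 := hρ0 _ (right_ne_zero_of_mul h2)
      rw [mem_closedBall_iff_norm, add_sub_cancel_left] at h4
      refine ⟨⟨(z.1, x₀ + h), subset_tsupport _ h3, by simp⟩, ?_⟩
      rw [mem_closedBall_iff_norm]
      calc ‖z.2 + s • h - x₀‖ = ‖(z.2 - x₀) + s • h‖ := by congr 1; abel
        _ ≤ ‖z.2 - x₀‖ + ‖s • h‖ := norm_add_le _ _
        _ ≤ 2 * r := by linarith
    · have h3 := right_ne_zero_of_mul h1
      have h4 := hχS _ h3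
      have h5 := hρ0 _ (left_ne_zero_of_mul h1)
      rw [mem_closedBall_iff_norm] at h4
      refine ⟨⟨z, subset_tsupport _ h3, by simp⟩, ?_⟩
      rw [mem_closedBall_iff_norm]
      calc ‖z.2 + s • h - x₀‖ = ‖(z.2 - x₀) + s • h‖ := by congr 1; abel
        _ ≤ ‖z.2 - x₀‖ + ‖s • h‖ := norm_add_le _ _
        _ ≤ 2 * r := by linarith
  · obtain ⟨t, x⟩ := z
    have hρc : Continuous ρ := hρs.continuous
    have hχc : Continuous fun y => χ (t, y) := (contDiff_slice χ t).continuous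
    have i0 : Integrable ρ := hρc.integrable_of_hasCompactSupport f.hasCompactSupport_normed
    have i1 : Integrable fun h => ρ h * χ (t, x) := i0.mul_const _
    have i2 : Integrable fun h => χ (t, x₀ + h) * ρ (x - x₀) :=
      ((integrable_slice χ t).comp_add_left x₀).mul_const _
    have i3 : Integrable fun h => ρ h * χ (t, x - h) :=
      (hρc.mul (hχc.comp (by fun_prop))).integrable_of_hasCompactSupport
        f.hasCompactSupport_normed.mul_right
    have i4 : Integrable fun h => χ (t, x₀ + h) * ρ (x - x₀ - h) := by
      have := i3.comp_sub_left (x - x₀)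
      refine this.congr (Eventually.of_forall fun h => ?_)
      simp only
      rw [show x - (x - x₀ - h) = x₀ + h by abel, mul_comm]
    have e1 : ∀ h, G ((t, x), h) - G ((t, x) - ((0 : ℝ), h), h)
        = ρ h * χ (t, x) - χ (t, x₀ + h) * ρ (x - x₀)
          - (ρ h * χ (t, x - h) - χ (t, x₀ + h) * ρ (x - x₀ - h)) := fun h => by
      simp only [hG, Prod.mk_sub_mk, sub_zero]
      rw [show x - h - x₀ = x - x₀ - h by abel]
    simp_rw [e1]
    have e3 := integral_sub (i1.sub i2) (i3.sub i4)
    simp only [Pi.sub_apply] at e3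
    rw [setIntegral_eq_integral_of_forall_compl_eq_zero, e3,
      integral_sub i1 i2, integral_sub i3 i4, integral_mul_const, integral_mul_const, hρ1]
    · have e2 : ∫ h, χ (t, x₀ + h) * ρ (x - x₀ - h) = ∫ h, ρ h * χ (t, x - h) := by
        rw [← integral_sub_left_eq_self (fun h => ρ h * χ (t, x - h)) volume (x - x₀)]
        refine integral_congr_ae (Eventually.of_forall fun h => ?_)
        simp only
        rw [show x - (x - x₀ - h) = x₀ + h by abel, mul_comm]
      rw [e2, integral_add_left_eq_self (fun y => χ (t, y)), sub_self, sub_zero, one_mul,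
        sub_apply, meanTimes_apply]
      rfl
    · intro h hh
      have hh' : r < ‖h‖ := by simpa using hh
      have z1 : ρ h = 0 := by
        by_contra hn
        linarith [hρ0 h hn]
      have z2 : χ (t, x₀ + h) = 0 := by
        by_contra hn
        have := hχS _ hn
        rw [mem_closedBall_iff_norm, add_sub_cancel_left] at this
        linarith
      rw [z1, z2]
      ring

/-- `p n` converges on differences `(∫ χ) (ρ - ρ')`. -/
def MeanEquiv (p : ℕ → 𝓓'(cylinder T Ω, ℝ)) (ρ ρ' : 𝓓(Ω, ℝ)) : Prop :=
  ∃ B, 0 ≤ B ∧ ∀ (χ : 𝓓(cylinder T Ω, ℝ)) M, C1Le χ M →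
    LimLe p (meanTimes ρ χ - meanTimes ρ' χ) (B * M)

theorem MeanEquiv.symm {ρ ρ' : 𝓓(Ω, ℝ)} (h : MeanEquiv p ρ ρ') : MeanEquiv p ρ' ρ := by
  obtain ⟨B, hB, h⟩ := h
  exact ⟨B, hB, fun χ M hM => by simpa using (h χ M hM).neg⟩

theorem MeanEquiv.trans {ρ ρ' ρ'' : 𝓓(Ω, ℝ)} (h : MeanEquiv p ρ ρ') (h' : MeanEquiv p ρ' ρ'') :
    MeanEquiv p ρ ρ'' := by
  obtain ⟨B, hB, h⟩ := h
  obtain ⟨B', hB', h'⟩ := h'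
  refine ⟨B + B', by positivity, fun χ M hM => ?_⟩
  have := (h χ M hM).add (h' χ M hM)
  rwa [sub_add_sub_cancel, ← add_mul] at this

/-- Take a normalized bump `σ` supported in `S ∩ S'`. Both local statements apply to `(∫ χ) σ`,
whose mean is that of `χ`, and their difference compares `ρ` with `ρ'`. -/
theorem LocalAt.meanEquiv [IsFiniteMeasure (dom Ω)] {ρ ρ' : 𝓓(Ω, ℝ)} {S S' : Set (E N)} (h : LocalAt p ρ S)
    (h' : LocalAt p ρ' S') {x₀ : E N} (hx₀ : x₀ ∈ Ω) (hS : S ∈ 𝓝 x₀) (hS' : S' ∈ 𝓝 x₀) :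
    MeanEquiv p ρ ρ' := by
  obtain ⟨r, hr, hball⟩ := Metric.nhds_basis_closedBall.mem_iff.1
    (inter_mem (inter_mem hS hS') (Ω.isOpen.mem_nhds hx₀))
  let f : ContDiffBump x₀ := ⟨r / 2, r, by positivity, by linarith⟩
  let σ : 𝓓(Ω, ℝ) := ⟨f.normed volume, f.contDiff_normed, f.hasCompactSupport_normed, by
    rw [f.tsupport_normed_eq]
    exact hball.trans inter_subset_right⟩
  have hσ : ∫ x, σ x = 1 := f.integral_normed
  have hσ0 : ∀ x, σ x ≠ 0 → x ∈ S ∩ S' := fun x hx => by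
    have : x ∈ Function.support (f.normed volume) := hx
    rw [f.support_normed_eq] at this
    exact (hball (Metric.ball_subset_closedBall this)).1
  obtain ⟨B₀, hB₀, hσM⟩ := exists_C1Le_meanTimes (T := T) σ
  obtain ⟨B, hB, h⟩ := h
  obtain ⟨B', hB', h'⟩ := h'
  refine ⟨(B' + B) * B₀, by positivity, fun χ M hM => ?_⟩
  have h1 := h (meanTimes σ χ) _ (fun z hz => (hσ0 _ (right_ne_zero_of_mul hz)).1) (hσM χ M hM)
  have h2 := h' (meanTimes σ χ) _ (fun z hz => (hσ0 _ (right_ne_zero_of_mul hz)).2) (hσM χ M hM)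
  rw [meanTimes_meanTimes _ _ hσ] at h1 h2
  have := h2.add h1.neg
  rw [show meanTimes σ χ - meanTimes ρ' χ + -(meanTimes σ χ - meanTimes ρ χ)
    = meanTimes ρ χ - meanTimes ρ' χ by abel] at this
  rwa [← mul_assoc, ← mul_assoc, ← add_mul, ← add_mul] at this

end Pressure

end LerayAlpha

end

noncomputable section

namespace LerayAlpha

set_option maxSynthPendingDepth 3

/-! ### Gluing over a connected domain, and construction of the limit pressure -/

section PressureLimit

variable {N : ℕ} {Ω : Opens (E N)} {T : ℝ} {p : ℕ → 𝓓'(cylinder T Ω, ℝ)}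
  {F : Fin N → 𝓓(cylinder T Ω, ℝ) → ℝ} {C : ℝ}

/-- The product of a test function on the cylinder and of a smooth function of `x`. -/
def spaceMul (θ : E N → ℝ) (hθ : ContDiff ℝ (⊤ : ℕ∞) θ) (χ : 𝓓(cylinder T Ω, ℝ)) :
    𝓓(cylinder T Ω, ℝ) :=
  mkTest (fun z => θ z.2 * χ z) ((hθ.comp contDiff_snd).mul χ.contDiff)
    χ.hasCompactSupport χ.tsupport_subset
    fun _ hz => subset_tsupport _ (right_ne_zero_of_mul hz)

theorem spaceMul_apply (θ : E N → ℝ) (hθ : ContDiff ℝ (⊤ : ℕ∞) θ) (χ : 𝓓(cylinder T Ω, ℝ))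
    (z : ℝ × E N) : spaceMul θ hθ χ z = θ z.2 * χ z := rfl

/-- Bumps attached to nearby points are equivalent, and connectedness makes all of them equivalent,
so one `ρ` serves everywhere. A partition of unity over the spatial projection of `K` reduces the
claim to the local one. -/
theorem GradLim.exists_limLe [IsFiniteMeasure (dom Ω)] (h : GradLim p F C) (hΩ : IsConnected (Ω : Set (E N))) :
    ∃ ρ : 𝓓(Ω, ℝ), ∀ K : Set (ℝ × E N), IsCompact K → K ⊆ cylinder T Ω → ∃ B, 0 ≤ B ∧
      ∀ (χ : 𝓓(cylinder T Ω, ℝ)) M, (∀ z, χ z ≠ 0 → z ∈ K) → C1Le χ M →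
        LimLe p (χ - meanTimes ρ χ) (B * M) := by
  have hloc : ∀ x : Ω, ∃ r > 0, ∃ ρ : 𝓓(Ω, ℝ), LocalAt p ρ (Metric.closedBall (x : E N) r) :=
    fun x => h.exists_localAt x.2
  choose r hr ρ hρ using hloc
  obtain ⟨x₀, hx₀⟩ := hΩ.nonempty
  have hequiv : ∀ x y : Ω, MeanEquiv p (ρ x) (ρ y) := by
    have : PreconnectedSpace Ω := Subtype.preconnectedSpace hΩ.isPreconnected
    intro x y
    have : Std.Symm fun x y : Ω => MeanEquiv p (ρ x) (ρ y) := ⟨fun _ _ h => MeanEquiv.symm h⟩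
    refine PreconnectedSpace.induction₂ (fun x y : Ω => MeanEquiv p (ρ x) (ρ y)) (fun x => ?_)
      ⟨fun _ _ _ h h' => MeanEquiv.trans h h'⟩ x y
    have hb : ∀ᶠ y : Ω in 𝓝 x, (y : E N) ∈ Metric.ball (x : E N) (r x) :=
      continuous_subtype_val.continuousAt.eventually (Metric.ball_mem_nhds _ (hr x))
    filter_upwards [hb] with y hy
    exact (hρ x).meanEquiv (hρ y) y.2
      (mem_of_superset (Metric.isOpen_ball.mem_nhds hy) Metric.ball_subset_closedBall)
      (Metric.closedBall_mem_nhds _ (hr y))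
  refine ⟨ρ ⟨x₀, hx₀⟩, fun K hK hKQ => ?_⟩
  have hK2 : IsCompact (Prod.snd '' K) := hK.image continuous_snd
  have hK2Ω : ∀ x ∈ Prod.snd '' K, x ∈ Ω := by
    rintro _ ⟨z, hz, rfl⟩
    exact (hKQ hz).2
  obtain ⟨t, ht⟩ := hK2.elim_finite_subcover (fun x : Ω => Metric.ball (x : E N) (r x))
    (fun _ => Metric.isOpen_ball) fun x hx => mem_iUnion.2
      ⟨⟨x, hK2Ω x hx⟩, Metric.mem_ball_self (hr ⟨x, hK2Ω x hx⟩)⟩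
  obtain ⟨f, hf⟩ := SmoothPartitionOfUnity.exists_isSubordinate (modelWithCornersSelf ℝ (E N))
    hK2.isClosed (fun x : t => Metric.ball ((x : Ω) : E N) (r x)) (fun _ => Metric.isOpen_ball)
    (by simpa [iUnion_subtype] using ht)
  have hfs : ∀ i, ContDiff ℝ (⊤ : ℕ∞) (f i) := fun i => (f i).contMDiff.contDiff
  have hfc : ∀ i, HasCompactSupport (f i) := fun i =>
    (isCompact_closedBall ((i : Ω) : E N) (r i)).of_isClosed_subset (isClosed_tsupport _)
      ((hf i).trans Metric.ball_subset_closedBall)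
  have hfM : ∀ i, ∃ M, C1Le (f i) M := fun i => exists_C1Le ((hfs i).of_le (by norm_cast)) (hfc i)
  choose Mf hMf using hfM
  choose B₁ hB₁ h₁ using hρ
  choose B₂ hB₂ h₂ using fun x => hequiv x ⟨x₀, hx₀⟩
  have hMf0 := fun i => (hMf i).nonneg
  refine ⟨∑ i : t, (B₁ i + B₂ i) * (2 * Mf i),
    Finset.sum_nonneg fun i _ => mul_nonneg (add_nonneg (hB₁ i) (hB₂ i)) (by linarith [hMf0 i]),
    fun χ M hχK hχM => ?_⟩
  have hsum : χ = ∑ i : t, spaceMul (f i) (hfs i) χ := by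
    ext z
    rw [sum_apply]
    simp_rw [spaceMul_apply]
    rw [← Finset.sum_mul]
    by_cases hz : χ z = 0
    · rw [hz, mul_zero]
    · have h3 := f.sum_eq_one (x := z.2) ⟨z, hχK z hz, rfl⟩
      rw [finsum_eq_sum_of_fintype] at h3
      rw [h3, one_mul]
  have hterm : ∀ i : t, LimLe p (spaceMul (f i) (hfs i) χ
      - meanTimes (ρ ⟨x₀, hx₀⟩) (spaceMul (f i) (hfs i) χ)) ((B₁ i + B₂ i) * (2 * Mf i) * M) := by
    intro i
    have hM : C1Le (spaceMul (f i) (hfs i) χ) (2 * (Mf i * M)) := by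
      have := C1Le_space (hMf i) 0
      simp only [sub_zero] at this
      exact this.mul hχM
    have h3 := h₁ i (spaceMul (f i) (hfs i) χ) _ (fun z hz => ?_) hM
    · have h4 := h3.add (h₂ i _ _ hM)
      rw [sub_add_sub_cancel] at h4
      convert h4 using 1
      ring
    · exact Metric.ball_subset_closedBall
        (hf i (subset_tsupport _ (left_ne_zero_of_mul hz)))
  have h5 := LimLe.sum Finset.univ fun i _ => hterm i
  rw [Finset.sum_sub_distrib, ← map_sum, ← hsum, ← Finset.sum_mul] at h5
  exact h5

/-- This is why the correction by the mean is harmless: it vanishes on the test functions that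
define the gradient. -/
theorem integral_slice_lineDeriv (φ : 𝓓(cylinder T Ω, ℝ)) (j : Fin N) (t : ℝ) :
    ∫ y, (∂_{((0 : ℝ), (e j : E N))} φ) (t, y) = 0 := by
  have h1 : ∀ y, (∂_{((0 : ℝ), (e j : E N))} φ) (t, y)
      = 1 * fderiv ℝ (fun y => φ (t, y)) y (e j) := fun y => by
    have h2 := ((φ.contDiff.differentiable (by simp)) (t, y)).hasFDerivAt.comp y
      (hasFDerivAt_prodMk_right t y)
    have h3 : fderiv ℝ (fun y => φ (t, y)) y = _ := h2.fderiv
    rw [lineDerivOp_apply_eq_fderiv, h3, one_mul]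
    simp
  have h4 := integrable_slice (∂_{((0 : ℝ), (e j : E N))} φ) t
  simp_rw [h1] at h4 ⊢
  rw [integral_mul_fderiv_eq_neg_fderiv_mul_of_integrable (by simp) h4
    (by simpa using integrable_slice φ t) (fun _ _ => differentiableAt_const _)
    (fun y _ => (contDiff_slice φ t).differentiable (by simp) y)]
  simp

/-- Seminorms of orders `0` and `1` control the bounds in `LimLe`, which gives the continuity of the
limit on test functions supported in a fixed compact set. -/
theorem C1Le_of_supportedIn {W : Type} [NormedAddCommGroup W] [NormedSpace ℝ W] {K : Compacts W}
    (f : 𝓓_{K}(W, ℝ)) :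
    C1Le f ((Finset.sup {0, 1} fun i => ContDiffMapSupportedIn.seminorm ℝ W ℝ ⊤ K i) f) := by
  refine ⟨f.contDiff.differentiable (by simp), fun z => ⟨?_, ?_⟩⟩
  · refine (ContDiffMapSupportedIn.norm_apply_le_seminorm ℝ).trans ?_
    exact Seminorm.le_finset_sup_apply (p := fun i => ContDiffMapSupportedIn.seminorm ℝ W ℝ ⊤ K i)
      (by simp)
  · rw [← norm_iteratedFDeriv_one]
    refine (ContDiffMapSupportedIn.norm_iteratedFDeriv_apply_le_seminorm_top ℝ).trans ?_
    exact Seminorm.le_finset_sup_apply (p := fun i => ContDiffMapSupportedIn.seminorm ℝ W ℝ ⊤ K i)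
      (by simp)

/-- If the gradients of distributions `p n` converge to distributions of order one, then the limit
is the gradient of a distribution. -/
theorem GradLim.exists_distribution [IsFiniteMeasure (dom Ω)] (h : GradLim p F C)
    (hΩ : IsConnected (Ω : Set (E N))) :
    ∃ q : 𝓓'(cylinder T Ω, ℝ), ∀ j φ, (∂_{((0 : ℝ), (e j : E N))} q) φ = F j φ := by
  obtain ⟨ρ, hρ⟩ := h.exists_limLe hΩ
  have hlim : ∀ χ : 𝓓(cylinder T Ω, ℝ), ∃ l, Tendsto (fun n => p n (χ - meanTimes ρ χ)) atTop (𝓝 l) :=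
    fun χ => by
    obtain ⟨B, -, hB⟩ := hρ (tsupport χ) χ.hasCompactSupport χ.tsupport_subset
    obtain ⟨M, hM⟩ := exists_C1Le (χ.contDiff.of_le (by norm_cast)) χ.hasCompactSupport
    obtain ⟨l, hl, -⟩ := hB χ M (fun z hz => subset_tsupport _ hz) hM
    exact ⟨l, hl⟩
  -- Subtracting the mean times `ρ` discards the part of `p n` depending on time alone, about which
  -- the gradients carry no information.
  choose q hq using hlim
  have hadd : ∀ f g, q (f + g) = q f + q g := fun f g => by
    refine tendsto_nhds_unique (hq (f + g)) (((hq f).add (hq g)).congr fun n => ?_)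
    rw [map_add, ← map_add (p n)]
    congr 1
    abel
  have hsmul : ∀ (c : ℝ) f, q (c • f) = c • q f := fun c f => by
    refine tendsto_nhds_unique (hq (c • f)) (((hq f).const_smul c).congr fun n => ?_)
    rw [map_smul, ← map_smul (p n), smul_sub]
  let q' : 𝓓(cylinder T Ω, ℝ) →L[ℝ] ℝ := TestFunction.mkCLM ℝ q hadd hsmul fun K hK => by
    obtain ⟨B, hB0, hB⟩ := hρ K K.isCompact hK
    refine (ContDiffMapSupportedIn.mkCLMtoNormedSpace (𝕜 := ℝ)
      (fun f : 𝓓_{K}(ℝ × E N, ℝ) => q (TestFunction.ofSupportedIn hK f)) (fun f g => ?_)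
      (fun c f => ?_) ⟨{0, 1}, B, hB0, fun f => ?_⟩).continuous
    · exact hadd (TestFunction.ofSupportedIn hK f) (TestFunction.ofSupportedIn hK g)
    · exact hsmul c (TestFunction.ofSupportedIn hK f)
    · have hs : ∀ z, TestFunction.ofSupportedIn hK f z ≠ 0 → z ∈ (K : Set (ℝ × E N)) :=
        fun z hz => by
          by_contra hzK
          exact hz (f.zero_on_compl hzK)
      obtain ⟨l, hl, hlB⟩ := hB (TestFunction.ofSupportedIn hK f) _ hs (C1Le_of_supportedIn f)
      rwa [tendsto_nhds_unique (hq _) hl]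
  let q'' : 𝓓'(cylinder T Ω, ℝ) := q'
  refine ⟨q'', fun j φ => ?_⟩
  rw [Distribution.lineDerivOp_apply_apply]
  have h1 : q'' (-∂_{((0 : ℝ), (e j : E N))} φ) = q (-∂_{((0 : ℝ), (e j : E N))} φ) := rfl
  rw [h1]
  refine tendsto_nhds_unique (hq _) ((h.2 j φ).1.congr fun n => ?_)
  have h2 : meanTimes ρ (-∂_{((0 : ℝ), (e j : E N))} φ) = 0 := by
    rw [map_neg, neg_eq_zero]
    ext z
    rw [meanTimes_apply, integral_slice_lineDeriv, zero_mul]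
    rfl
  rw [h2, sub_zero, Distribution.lineDerivOp_apply_apply]

end PressureLimit

end LerayAlpha

end

noncomputable section

namespace LerayAlpha

set_option maxSynthPendingDepth 3

/-! ### The equations as identities between functionals -/

section Mix

variable {A X H R : Type*} [NormedAddCommGroup A] [NormedSpace ℝ A] [NormedAddCommGroup X]
  [NormedSpace ℝ X] [NormedAddCommGroup H] [NormedSpace ℝ H]

/-- The trilinear form `(z, y, w) ↦ b (ι z) (ι w) (κ y)`. -/
def mixForm (b : A →L[ℝ] A →L[ℝ] H →L[ℝ] ℝ) (ι : X →L[ℝ] A) (κ : X →L[ℝ] H) :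
    X →L[ℝ] X →L[ℝ] X →L[ℝ] ℝ :=
  ((((ContinuousLinearMap.compL ℝ X H (X →L[ℝ] ℝ)).flip κ).comp
    (ContinuousLinearMap.flipₗᵢ ℝ X H ℝ).toContinuousLinearEquiv.toContinuousLinearMap).comp
      ((ContinuousLinearMap.compL ℝ X A (H →L[ℝ] ℝ)).flip ι)).comp (b.comp ι)

theorem neg_sub_add_apply (a b c : X →L[ℝ] ℝ) (w : X) :
    (-a - b + c) w = -a w - b w + c w := rfl

theorem bilin_sub_sub (b : X →L[ℝ] X →L[ℝ] ℝ) (x y : X) (s : ℝ) :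
    b (s • x - y) (s • x - y) = s ^ 2 * b x x - s * (b x y + b y x) + b y y := by
  simp only [map_sub, map_smul, sub_apply, smul_apply, smul_eq_mul]
  ring

end Mix

section Bilin

variable {α A B D : Type*} [MeasurableSpace α] {μ : Measure α} [NormedAddCommGroup A]
  [NormedSpace ℝ A] [NormedAddCommGroup B] [NormedSpace ℝ B] [NormedAddCommGroup D]
  [NormedSpace ℝ D]

theorem aestronglyMeasurable_bilin (b : A →L[ℝ] B →L[ℝ] D) {f : α → A} {g : α → B}
    (hf : AEStronglyMeasurable f μ) (hg : AEStronglyMeasurable g μ) :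
    AEStronglyMeasurable (fun t => b (f t) (g t)) μ :=
  b.aestronglyMeasurable_comp₂ hf hg

theorem memLp_bilin_of_bound_left (b : A →L[ℝ] B →L[ℝ] D) {f : α → A} {g : α → B}
    (hf : AEStronglyMeasurable f μ) {M : ℝ} (hM : ∀ᵐ t ∂μ, ‖f t‖ ≤ M) {p : ℝ≥0∞}
    (hg : MemLp g p μ) : MemLp (fun t => b (f t) (g t)) p μ := by
  refine (hg.norm.const_mul (‖b‖ * M)).of_le (aestronglyMeasurable_bilin b hf hg.1) ?_
  filter_upwards [hM] with t ht
  refine (b.le_opNorm₂ _ _).trans ?_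
  have h0 : 0 ≤ M := (norm_nonneg _).trans ht
  rw [norm_mul, norm_norm, Real.norm_of_nonneg (by positivity)]
  gcongr

theorem memLp_bilin_of_bound_right (b : A →L[ℝ] B →L[ℝ] D) {f : α → A} {g : α → B} {p : ℝ≥0∞}
    (hf : MemLp f p μ) (hg : AEStronglyMeasurable g μ) {M : ℝ} (hM : ∀ᵐ t ∂μ, ‖g t‖ ≤ M) :
    MemLp (fun t => b (f t) (g t)) p μ :=
  memLp_bilin_of_bound_left b.flip hg hM hf

theorem memLp_neg_sub_add {X L : Type*} [NormedAddCommGroup X] [NormedSpace ℝ X]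
    [NormedAddCommGroup L] [NormedSpace ℝ L] (a : X →L[ℝ] X →L[ℝ] ℝ)
    (b : X →L[ℝ] X →L[ℝ] X →L[ℝ] ℝ) (c : L →L[ℝ] X →L[ℝ] ℝ) {Y Z : α → X} {v : α → L} {p : ℝ≥0∞}
    (hY : MemLp Y p μ) (hZ : AEStronglyMeasurable Z μ) {B : ℝ} (hB : ∀ᵐ t ∂μ, ‖Z t‖ ≤ B)
    (hv : MemLp v p μ) : MemLp (fun t => -a (Y t) - b (Z t) (Y t) + c (v t)) p μ :=
  ((a.comp_memLp' hY).neg.sub (memLp_bilin_of_bound_left b hZ hB hY)).add (c.comp_memLp' hv)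

end Bilin

section Operators

variable {N : ℕ} {Ω ω : Opens (E N)}

theorem dom_mono (h : ω ≤ Ω) : dom ω ≤ dom Ω := Measure.restrict_mono h le_rfl

/-- The restriction of vector fields to `ω ⊆ Ω`. -/
def restrictL (h : ω ≤ Ω) : L2 Ω →L[ℝ] L2 ω :=
  LinearMap.mkContinuous
    { toFun := fun u => ((Lp.memLp u).mono_measure (dom_mono h)).toLp u
      map_add' := fun u w => by
        rw [← MemLp.toLp_add, MemLp.toLp_eq_toLp_iff]
        exact (Lp.coeFn_add u w).filter_mono (ae_mono (dom_mono h))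
      map_smul' := fun c u => by
        rw [RingHom.id_apply, ← MemLp.toLp_const_smul, MemLp.toLp_eq_toLp_iff]
        exact (Lp.coeFn_smul c u).filter_mono (ae_mono (dom_mono h)) } 1 fun u => by
    simp only [LinearMap.coe_mk, AddHom.coe_mk]
    rw [Lp.norm_toLp, one_mul, Lp.norm_def]
    exact ENNReal.toReal_mono (Lp.eLpNorm_ne_top u) (eLpNorm_mono_measure _ (dom_mono h))

theorem coeFn_restrictL (h : ω ≤ Ω) (u : L2 Ω) : ∀ᵐ x ∂(dom ω), restrictL h u x = u x :=
  MemLp.coeFn_toLp ((Lp.memLp u).mono_measure (dom_mono h))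

theorem norm_restrictL_le (h : ω ≤ Ω) (u : L2 Ω) : ‖restrictL h u‖ ≤ ‖u‖ := by
  have := (restrictL h).le_of_opNorm_le (LinearMap.mkContinuous_norm_le _ zero_le_one _) u
  rwa [one_mul] at this

theorem inner_restrictL (h : ω ≤ Ω) (v : L2 ω) (u : L2 Ω) :
    ⟪v, restrictL h u⟫_ℝ = ∫ x in (ω : Set (E N)), ⟪v x, u x⟫_ℝ := by
  rw [L2.inner_def]
  refine integral_congr_ae ?_
  filter_upwards [coeFn_restrictL h u] with x hx
  rw [hx]

/-- The action of a control on `V`. -/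
def controlL (h : ω ≤ Ω) : L2 ω →L[ℝ] V Ω →L[ℝ] ℝ :=
  ((ContinuousLinearMap.compL ℝ (V Ω) (L2 ω) ℝ).flip ((restrictL h).comp fieldL)).comp (innerSL ℝ)

theorem controlL_apply (h : ω ≤ Ω) (v : L2 ω) (w : V Ω) :
    controlL h v w = ⟪v, restrictL h (V.field w)⟫_ℝ := rfl

/-- Let `a, b, c` be `(∇Z, ∇Z)`, `(∇Z, ∇Y)`, `(∇Y, ∇Y)`. Testing with `Z` and `Y` gives `|z - y|² =
α² (b - a)`, so `a ≤ b`. Nonnegativity of `|∇(rZ - Y)|²` for `r = 1` then gives `a ≤ c`, and for `r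
= 2` gives `b - a ≤ c / 4`. The last estimate is not uniform in `α` and only places `Z` in `L^∞(V)`
for each fixed `α`. -/
theorem filter_estimates {Y Z : V Ω} {α : ℝ} (hα : 0 < α)
    (h : ∀ w : V Ω, ⟪V.field Z, V.field w⟫_ℝ + α ^ 2 * V.gradInner Z w
      = ⟪V.field Y, V.field w⟫_ℝ) :
    ‖Z‖ ≤ ‖Y‖ ∧ ‖V.field Z‖ ≤ ‖V.field Y‖ ∧ ‖V.field Z - V.field Y‖ ≤ α * ‖Y‖ ∧
      α ^ 2 * ‖Z‖ ^ 2 ≤ (α ^ 2 + 1) * ‖V.field Y‖ ^ 2 := by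
  have hZ := h Z
  have hY := h Y
  have ha := gradInner_self_nonneg Z
  have hc := gradInner_self_nonneg Y
  have hsymm : V.gradInner Y Z = V.gradInner Z Y :=
    Finset.sum_congr rfl fun i _ => real_inner_comm _ _
  have e1 : ∀ r : ℝ, 0 ≤ r ^ 2 * V.gradInner Z Z - r * (V.gradInner Z Y + V.gradInner Y Z)
      + V.gradInner Y Y := fun r => by
    have h1 := bilin_sub_sub gradForm Z Y r
    simp only [gradForm_apply] at h1
    rw [← h1]
    exact gradInner_self_nonneg _
  have p1 := e1 1
  have p2 := e1 2
  rw [hsymm] at p1 p2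
  rw [real_inner_self_eq_norm_sq] at hZ hY
  rw [real_inner_comm] at hY
  have e3 : ‖V.field Z - V.field Y‖ ^ 2 = α ^ 2 * (V.gradInner Z Y - V.gradInner Z Z) := by
    rw [norm_sub_sq_real, real_inner_comm]
    linarith
  have hα2 : 0 < α ^ 2 := by positivity
  have hab : 0 ≤ V.gradInner Z Y - V.gradInner Z Z := by
    have : 0 ≤ α ^ 2 * (V.gradInner Z Y - V.gradInner Z Z) := by rw [← e3]; positivity
    exact nonneg_of_mul_nonneg_right this hα2
  have hzy := real_inner_le_norm (V.field Y) (V.field Z)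
  have hz : ‖V.field Z‖ ≤ ‖V.field Y‖ := by
    by_contra hlt
    push Not at hlt
    have : 0 ≤ α ^ 2 * V.gradInner Z Z := by positivity
    nlinarith [norm_nonneg (V.field Y), norm_nonneg (V.field Z)]
  refine ⟨?_, hz, ?_, ?_⟩
  · refine le_of_sq_le_sq ?_ (norm_nonneg _)
    rw [norm_sq_V, norm_sq_V]
    have := pow_le_pow_left₀ (norm_nonneg _) hz 2
    linarith
  · refine le_of_sq_le_sq ?_ (by positivity)
    rw [e3, mul_pow, norm_sq_V]
    refine mul_le_mul_of_nonneg_left ?_ hα2.le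
    nlinarith [sq_nonneg ‖V.field Y‖]
  · have h1 : α ^ 2 * V.gradInner Z Z ≤ ‖V.field Y‖ ^ 2 := by
      nlinarith [norm_nonneg (V.field Y), norm_nonneg (V.field Z)]
    have h2 := mul_le_mul_of_nonneg_left (pow_le_pow_left₀ (norm_nonneg _) hz 2) hα2.le
    rw [norm_sq_V]
    linarith

variable [HasL4Embedding Ω]

/-- The embedding of `V` into `L⁴`. -/
def VtoL4 : V Ω →L[ℝ] Lp (E N) 4 (dom Ω) := toL4.comp toH10

/-- The convection form on `V`. -/
def convV (Ω : Opens (E N)) [HasL4Embedding Ω] : V Ω →L[ℝ] V Ω →L[ℝ] V Ω →L[ℝ] ℝ :=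
  mixForm (convForm Ω 4 4) VtoL4 (V Ω).subtypeL

theorem convV_apply (Z Y w : V Ω) :
    convV Ω Z Y w = convForm Ω 4 4 (VtoL4 Z) (VtoL4 w) (Y : H1Pair Ω) := rfl

theorem VtoL4_apply (Z : V Ω) : VtoL4 Z = toL4 (toH10 Z) := rfl

theorem convV_eq (Z Y w : V Ω) : convV Ω Z Y w = convection (V.field Z) Y w :=
  (convV_apply Z Y w).trans (convection_eq Z Y w rfl).symm

theorem convV_self (Z Y : V Ω) : convV Ω Z Y Y = 0 :=
  (convV_apply Z Y Y).trans (convForm_self Z (toH10 Y))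

/-- The right-hand side of the equation for `∂ₜy` in `V'`. -/
def momentumFunctional (h : ω ≤ Ω) (Y Z : V Ω) (v : L2 ω) : V Ω →L[ℝ] ℝ :=
  -gradForm Y - convV Ω Z Y + controlL h v

theorem momentumFunctional_apply (h : ω ≤ Ω) (Y Z : V Ω) (v : L2 ω) (w : V Ω) :
    momentumFunctional h Y Z v w
      = -V.gradInner Y w - convV Ω Z Y w + ⟪v, restrictL h (V.field w)⟫_ℝ := by
  exact (neg_sub_add_apply (gradForm Y) (convV Ω Z Y) (controlL h v) w).trans
    (congrArg₂ (· + ·) (congrArg₂ (· - ·) (congrArg Neg.neg (gradForm_apply Y w)) rfl)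
      (controlL_apply h v w))

theorem momentumFunctional_def (h : ω ≤ Ω) (Y Z : V Ω) (v : L2 ω) :
    momentumFunctional h Y Z v = -gradForm Y - convV Ω Z Y + controlL h v := rfl

end Operators

attribute [irreducible] convV controlL restrictL VtoL4 momentumFunctional

end LerayAlpha

end

noncomputable section

namespace LerayAlpha

set_option maxSynthPendingDepth 3

/-! ### Estimates for the states of the Leray-`α` system -/

section Estimates

variable {N : ℕ} {Ω ω : Opens (E N)} {T : ℝ}

theorem memLp_control (v : Control T ω) : MemLp v 2 (timeMeasure T) :=
  (Lp.memLp v).mono_exponent le_top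

theorem ae_norm_control_le {v : Control T ω} {C : ℝ} (hv : ‖v‖ ≤ C) :
    ∀ᵐ t ∂(timeMeasure T), ‖v t‖ ≤ C := by
  have h1 : ∀ᵐ t ∂(timeMeasure T), ‖v t‖ₑ ≤ eLpNormEssSup v (timeMeasure T) :=
    ae_le_eLpNormEssSup
  filter_upwards [h1] with t ht
  rw [← eLpNorm_exponent_top, ← Lp.enorm_def, ← ofReal_norm, ← ofReal_norm,
    ENNReal.ofReal_le_ofReal_iff (norm_nonneg _)] at ht
  exact ht.trans hv

theorem sq_eLpNorm_toReal_eq {α F : Type*} [MeasurableSpace α] {μ : Measure α}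
    [NormedAddCommGroup F] {f : α → F} (hf : MemLp f 2 μ) :
    (eLpNorm f 2 μ).toReal ^ 2 = ∫ a, ‖f a‖ ^ 2 ∂μ := by
  have hm : AEStronglyMeasurable (fun a => ‖f a‖ ^ 2) μ := hf.1.norm.pow 2
  rw [← ENNReal.toReal_pow, eLpNorm_two_sq, integral_eq_lintegral_of_nonneg_ae
    (Eventually.of_forall fun _ => by positivity) hm]
  congr 1
  refine lintegral_congr fun a => ?_
  rw [← ofReal_norm, ENNReal.ofReal_pow (norm_nonneg _)]

theorem integrable_norm_sq {α F : Type*} [MeasurableSpace α] {μ : Measure α}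
    [NormedAddCommGroup F] {f : α → F} (hf : MemLp f 2 μ) : Integrable (fun a => ‖f a‖ ^ 2) μ := by
  have := hf.norm.integrable_mul hf.norm (p := 2) (q := 2)
  refine this.congr (Eventually.of_forall fun a => ?_)
  simp [sq]

theorem gradInner_self_eq (Y : V Ω) : V.gradInner Y Y = ‖Y‖ ^ 2 - ‖V.field Y‖ ^ 2 := by
  rw [norm_sq_V]
  ring

theorem integrable_gradInner_self {Y : ℝ → V Ω} {μ : Measure ℝ} (hY : MemLp Y 2 μ) :
    Integrable (fun t => V.gradInner (Y t) (Y t)) μ ∧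
    ∫ t, V.gradInner (Y t) (Y t) ∂μ = (∫ t, ‖Y t‖ ^ 2 ∂μ) - ∫ t, ‖V.field (Y t)‖ ^ 2 ∂μ := by
  have hi0 := integrable_norm_sq hY
  have hif : Integrable (fun t => ‖V.field (Y t)‖ ^ 2) μ :=
    integrable_norm_sq (fieldL.comp_memLp' hY)
  simp_rw [gradInner_self_eq]
  exact ⟨hi0.sub hif, integral_sub hi0 hif⟩

/-- Cauchy–Schwarz bounds the work of the control by `C B T`; the still unknown maximum `B` of `‖y‖`
is absorbed in `energy_estimate`. -/
theorem norm_sq_sub_le (h : ω ≤ Ω) {y : ℝ → L2 Ω} {Y : ℝ → V Ω} {v : Control T ω}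
    {C B : ℝ} (hC : 0 ≤ C) (hB0 : 0 ≤ B) (hv : ‖v‖ ≤ C) (hyB : ∀ t ∈ Icc 0 T, ‖y t‖ ≤ B)
    (hyY : IsL2V T y Y) {t : ℝ} (ht : t ∈ Ioc 0 T)
    (e1 : ‖y t‖ ^ 2 - ‖y 0‖ ^ 2 = 2 * ∫ τ in Ioo 0 t,
      (-V.gradInner (Y τ) (Y τ) + ⟪v τ, restrictL h (V.field (Y τ))⟫_ℝ))
    (hi1 : Integrable (fun t => V.gradInner (Y t) (Y t)) (timeMeasure T)) :
    ‖y t‖ ^ 2 + 2 * ∫ τ in Ioo 0 t, V.gradInner (Y τ) (Y τ)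
      ≤ ‖y 0‖ ^ 2 + 2 * C * T * B := by
  have htime : ∀ᵐ t ∂(timeMeasure T), t ∈ Ioo 0 T := ae_restrict_mem measurableSet_Ioo
  have hvC := ae_norm_control_le hv
  have hvB : ∀ᵐ t ∂(timeMeasure T), ‖⟪v t, restrictL h (V.field (Y t))⟫_ℝ‖ ≤ C * B := by
    filter_upwards [hvC, hyY.2, htime] with t h1 h2 h3
    refine (abs_real_inner_le_norm _ _).trans ?_
    refine mul_le_mul h1 ((norm_restrictL_le h _).trans ?_) (norm_nonneg _) hC
    rw [h2]
    exact hyB t (Ioo_subset_Icc_self h3)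
  have hmv : AEStronglyMeasurable (fun t => ⟪v t, restrictL h (V.field (Y t))⟫_ℝ)
      (timeMeasure T) :=
    (memLp_control v).1.inner
      (((restrictL h).comp fieldL).continuous.comp_aestronglyMeasurable hyY.1.1)
  have hi2 : Integrable (fun t => ⟪v t, restrictL h (V.field (Y t))⟫_ℝ) (timeMeasure T) :=
    Integrable.of_bound hmv (C * B) hvB
  have hle : timeMeasure t ≤ timeMeasure T :=
    Measure.restrict_mono (Ioo_subset_Ioo_right ht.2) le_rfl
  have e2 : ∫ τ in Ioo 0 t, (-V.gradInner (Y τ) (Y τ) + ⟪v τ, restrictL h (V.field (Y τ))⟫_ℝ)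
      = -(∫ τ in Ioo 0 t, V.gradInner (Y τ) (Y τ))
        + ∫ τ in Ioo 0 t, ⟪v τ, restrictL h (V.field (Y τ))⟫_ℝ := by
    rw [← integral_neg]
    exact integral_add (hi1.mono_measure hle).neg (hi2.mono_measure hle)
  have e3 := norm_integral_le_of_norm_le_const (hvB.filter_mono (ae_mono hle))
  rw [measureReal_restrict_apply_univ, Real.volume_real_Ioo_of_le ht.1.le, sub_zero,
    Real.norm_eq_abs] at e3
  have e4 : C * B * t ≤ C * B * T := mul_le_mul_of_nonneg_left ht.2 (by positivity)
  rw [e2] at e1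
  have := (le_abs_self _).trans (e3.trans e4)
  linarith

theorem integral_norm_sq_field_le (hT : 0 < T) {y : ℝ → L2 Ω} {Y : ℝ → V Ω} {B : ℝ}
    (hyB : ∀ t ∈ Icc 0 T, ‖y t‖ ≤ B) (hyY : IsL2V T y Y) :
    ∫ t in Ioo 0 T, ‖V.field (Y t)‖ ^ 2 ≤ B ^ 2 * T := by
  have htime : ∀ᵐ t ∂(timeMeasure T), t ∈ Ioo 0 T := ae_restrict_mem measurableSet_Ioo
  have := norm_integral_le_of_norm_le_const (f := fun t => ‖V.field (Y t)‖ ^ 2) (C := B ^ 2)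
    (μ := timeMeasure T) (by
      filter_upwards [hyY.2, htime] with t h1 h2
      rw [h1, norm_pow, norm_norm]
      exact pow_le_pow_left₀ (norm_nonneg _) (hyB t (Ioo_subset_Icc_self h2)) 2)
  rw [measureReal_restrict_apply_univ, Real.volume_real_Ioo_of_le hT.le, sub_zero] at this
  exact (le_abs_self _).trans this

/-- If `b` were larger, then `b (b - 2CT)` would exceed `a²`. -/
theorem le_of_sq_add_le {a b C T g : ℝ} (ha : 0 ≤ a) (hC : 0 ≤ C) (hT : 0 ≤ T)
    (hg : 0 ≤ g) (h : b ^ 2 + 2 * g ≤ a ^ 2 + 2 * C * T * b) : b ≤ a + 2 * C * T := by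
  by_contra! hlt
  have : 0 ≤ C * T := by positivity
  nlinarith

theorem add_le_of_energy {a b B S C T g f r : ℝ} (hC : 0 ≤ C) (hT : 0 ≤ T) (hB : 0 ≤ B)
    (hBS : B ≤ S) (hg : 0 ≤ g) (h : b ^ 2 + 2 * g ≤ a ^ 2 + 2 * C * T * B) (h2 : f ≤ B ^ 2 * T)
    (h3 : g = r - f) : r ≤ T * S ^ 2 + (a ^ 2 + 2 * C * T * S) := by
  have e4 : B ^ 2 * T ≤ T * S ^ 2 := by
    rw [mul_comm]
    gcongr
  have e5 : 2 * C * T * B ≤ 2 * C * T * S := by gcongr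
  have e7 := sq_nonneg b
  linarith

variable [HasL4Embedding Ω]

theorem memLp_momentumFunctional (h : ω ≤ Ω) {Y Z : ℝ → V Ω} {v : ℝ → L2 ω} {μ : Measure ℝ}
    (hY : MemLp Y 2 μ) (hZ : AEStronglyMeasurable Z μ) {B : ℝ} (hB : ∀ᵐ t ∂μ, ‖Z t‖ ≤ B)
    (hv : MemLp v 2 μ) : MemLp (fun t => momentumFunctional h (Y t) (Z t) (v t)) 2 μ := by
  refine (memLp_congr_ae (Eventually.of_forall fun t => momentumFunctional_def h _ _ _)).2 ?_
  exact memLp_neg_sub_add (gradForm (Ω := Ω)) (convV Ω) (controlL h) hY hZ hB hv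

/-- The bounds satisfied by a state of the Leray-`α` system. -/
structure LerayBounds (h : ω ≤ Ω) (T α M : ℝ) (v : Control T ω) (y z : ℝ → L2 Ω)
    (Y Z : ℝ → V Ω) : Prop where
  hy : IsL2V T y Y
  hz : IsL2V T z Z
  continuousOn : ContinuousOn y (Icc 0 T)
  bound : ∀ t ∈ Icc 0 T, ‖y t‖ ≤ M
  eLpNorm_le : eLpNorm Y 2 (timeMeasure T) ≤ ENNReal.ofReal M
  norm_le : ∀ᵐ t ∂(timeMeasure T), ‖Z t‖ ≤ ‖Y t‖
  transport_le : ∀ᵐ t ∂(timeMeasure T), ‖z t‖ ≤ M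
  norm_sub_le : ∀ᵐ t ∂(timeMeasure T), ‖z t - y t‖ ≤ α * ‖Y t‖
  weak : ∀ w : V Ω, ∀ s ∈ Icc 0 T, ∀ t ∈ Icc 0 T, ⟪y t - y s, V.field w⟫_ℝ
    = ∫ τ in s..t, momentumFunctional h (Y τ) (Z τ) (v τ) w

/-- Continuity of `y` upgrades the equation from distributions in time to an identity between any
two times. Both the energy identity and the equicontinuity start from this form. -/
theorem weak_formulation (h : ω ≤ Ω) (hT : 0 < T) {y z : ℝ → L2 Ω} {Y Z : ℝ → V Ω}
    {p : 𝓓'(cylinder T Ω, ℝ)} {v : Control T ω} (hy : ContinuousOn y (Icc 0 T))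
    (hz : ∀ᵐ t ∂(timeMeasure T), V.field (Z t) = z t)
    (hmom : MomentumEquation T Ω ω y Y z p v)
    (hG : MemLp (fun t => momentumFunctional h (Y t) (Z t) (v t)) 2 (timeMeasure T))
    (w : V Ω) {s t : ℝ} (hs : s ∈ Icc 0 T) (ht : t ∈ Icc 0 T) :
    ⟪y t - y s, V.field w⟫_ℝ = ∫ τ in s..t, momentumFunctional h (Y τ) (Z τ) (v τ) w := by
  have hu : ContinuousOn (fun t => ⟪y t, V.field w⟫_ℝ) (Icc 0 T) := hy.inner continuousOn_const
  have hGw : Integrable (fun t => momentumFunctional h (Y t) (Z t) (v t) w) (timeMeasure T) :=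
    (((ContinuousLinearMap.apply ℝ ℝ w).comp_memLp' hG).integrable (by norm_num))
  have hv : Integrable (fun t => ⟪v t, restrictL h (V.field w)⟫_ℝ) (timeMeasure T) :=
    ((memLp_control v).integrable (by norm_num)).inner_const _
  rw [inner_sub_left]
  refine intervalIntegral_eq_of_weak_deriv hT hu hGw (fun ψ h1 h2 h3 => ?_) hs ht
  have hψ : ∀ f : ℝ → ℝ, Integrable f (timeMeasure T) →
      Integrable (fun t => ψ t * f t) (timeMeasure T) := fun f hf => by
    obtain ⟨c, hc⟩ := h2.exists_bound_of_continuous h1.continuous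
    exact hf.bdd_mul h1.continuous.aestronglyMeasurable (Eventually.of_forall hc)
  have hd : Integrable (fun t => deriv ψ t * ⟪y t, V.field w⟫_ℝ) (timeMeasure T) :=
    (((h1.continuous_deriv (by simp)).continuousOn.mul hu).integrableOn_Icc).mono_set
      Ioo_subset_Icc_self
  have key := hmom.1 w ψ h1 h2 h3
  simp_rw [← inner_restrictL h] at key
  have e1 : ∫ t in Ioo 0 T, (-(deriv ψ t * ⟪y t, V.field w⟫_ℝ)
      + ψ t * (V.gradInner (Y t) w + convection (z t) (Y t) w))
      = ∫ t in Ioo 0 T, (-(deriv ψ t * ⟪y t, V.field w⟫_ℝ)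
        + (ψ t * ⟪v t, restrictL h (V.field w)⟫_ℝ
          - ψ t * momentumFunctional h (Y t) (Z t) (v t) w)) := by
    refine integral_congr_ae ?_
    filter_upwards [hz] with t ht
    rw [momentumFunctional_apply, convV_eq, ht]
    ring
  have e2 := integral_add hd.neg ((hψ _ hv).sub (hψ _ hGw))
  have e3 := integral_sub (hψ _ hv) (hψ _ hGw)
  have e4 : ∫ t in Ioo 0 T, -(deriv ψ t * ⟪y t, V.field w⟫_ℝ)
    = -∫ t in Ioo 0 T, deriv ψ t * ⟪y t, V.field w⟫_ℝ := integral_neg _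
  simp only [Pi.sub_apply, Pi.neg_apply] at e2
  rw [e1, e2, e3, e4] at key
  linarith

/-- The convection term drops out of `energy_equality` by `convV_self`. -/
theorem energy_identity (h : ω ≤ Ω) {y : ℝ → L2 Ω} {Y Z : ℝ → V Ω} {v : ℝ → L2 ω}
    (hy : ContinuousOn y (Icc 0 T)) (hY : IsL2V T y Y)
    (hG : MemLp (fun t => momentumFunctional h (Y t) (Z t) (v t)) 2 (timeMeasure T))
    (hw : ∀ w : V Ω, ∀ s ∈ Icc 0 T, ∀ t ∈ Icc 0 T, ⟪y t - y s, V.field w⟫_ℝ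
      = ∫ τ in s..t, momentumFunctional h (Y τ) (Z τ) (v τ) w)
    {t : ℝ} (ht : t ∈ Ioc 0 T) :
    ‖y t‖ ^ 2 - ‖y 0‖ ^ 2 = 2 * ∫ τ in Ioo 0 t,
      (-V.gradInner (Y τ) (Y τ) + ⟪v τ, restrictL h (V.field (Y τ))⟫_ℝ) := by
  have hle : timeMeasure t ≤ timeMeasure T :=
    Measure.restrict_mono (Ioo_subset_Ioo_right ht.2) le_rfl
  have hsub : Icc 0 t ⊆ Icc 0 T := Icc_subset_Icc_right ht.2
  have key := energy_equality ht.1 (fieldL (Ω := Ω)) (hy.mono hsub) (hY.1.mono_measure hle)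
    (ae_mono hle hY.2) (hG.mono_measure hle) fun w s hs r hr => hw w s (hsub hs) r (hsub hr)
  rw [key]
  congr 1
  refine integral_congr_ae (Eventually.of_forall fun τ => ?_)
  simp only
  rw [momentumFunctional_apply, convV_self, sub_zero]

/-- At a time where the continuous function `‖y‖` attains its maximum `B`, the energy gives `B² ≤ ‖y
0‖² + 2CTB`, which bounds `B`. The energy at time `T` then bounds the gradients, and `T B²` accounts
for the rest of the norm of `V`. -/
theorem energy_estimate (h : ω ≤ Ω) (hT : 0 < T) {y : ℝ → L2 Ω} {Y Z : ℝ → V Ω}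
    {v : Control T ω} {C : ℝ} (hC : 0 ≤ C) (hv : ‖v‖ ≤ C) (hcont : ContinuousOn y (Icc 0 T))
    (hyY : IsL2V T y Y)
    (hG : MemLp (fun t => momentumFunctional h (Y t) (Z t) (v t)) 2 (timeMeasure T))
    (hweak : ∀ w : V Ω, ∀ s ∈ Icc 0 T, ∀ t ∈ Icc 0 T, ⟪y t - y s, V.field w⟫_ℝ
      = ∫ τ in s..t, momentumFunctional h (Y τ) (Z τ) (v τ) w) :
    (∀ t ∈ Icc 0 T, ‖y t‖ ≤ ‖y 0‖ + 2 * C * T) ∧ ∫ t in Ioo 0 T, ‖Y t‖ ^ 2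
      ≤ T * (‖y 0‖ + 2 * C * T) ^ 2 + (‖y 0‖ ^ 2 + 2 * C * T * (‖y 0‖ + 2 * C * T)) := by
  set S := ‖y 0‖ + 2 * C * T with hS
  have hS0 : 0 ≤ S := by positivity
  obtain ⟨t₀, ht₀, hmax⟩ := isCompact_Icc.exists_isMaxOn (nonempty_Icc.2 hT.le) hcont.norm
  set B := ‖y t₀‖ with hB
  have hyB : ∀ t ∈ Icc 0 T, ‖y t‖ ≤ B := fun t ht => hmax ht
  have hB0 : 0 ≤ B := norm_nonneg _
  obtain ⟨hi1, e3⟩ := integrable_gradInner_self hyY.1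
  have hgn : ∀ t, 0 ≤ ∫ τ in Ioo 0 t, V.gradInner (Y τ) (Y τ) := fun t =>
    integral_nonneg fun τ => gradInner_self_nonneg _
  have hBS : B ≤ S := by
    rcases eq_or_lt_of_le ht₀.1 with h0 | h0
    · rw [hB, ← h0]
      exact le_add_of_nonneg_right (by positivity)
    · exact le_of_sq_add_le (norm_nonneg _) hC hT.le (hgn t₀)
        (norm_sq_sub_le h hC hB0 hv hyB hyY ⟨h0, ht₀.2⟩
          (energy_identity h hcont hyY hG hweak ⟨h0, ht₀.2⟩) hi1)
  exact ⟨fun t ht => (hyB t ht).trans hBS, add_le_of_energy hC hT.le hB0 hBS (hgn T)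
    (norm_sq_sub_le h hC hB0 hv hyB hyY ⟨hT, le_rfl⟩
      (energy_identity h hcont hyY hG hweak ⟨hT, le_rfl⟩) hi1)
    (integral_norm_sq_field_le hT hyB hyY) e3⟩

/-- The states associated with controls bounded by `C` are bounded, uniformly in `α`. -/
theorem exists_lerayBounds (h : ω ≤ Ω) (hT : 0 < T) (y₀ : L2 Ω) {C : ℝ} (hC : 0 ≤ C) :
    ∃ M, 0 ≤ M ∧ ∀ (α : ℝ) (v : Control T ω) (y z : ℝ → L2 Ω) (p π : 𝓓'(cylinder T Ω, ℝ)),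
      0 < α → ‖v‖ ≤ C → IsLerayState T Ω ω α y₀ v y p z π →
      ∃ Y Z : ℝ → V Ω, LerayBounds h T α M v y z Y Z ∧ MomentumEquation T Ω ω y Y z p v := by
  set S := ‖y₀‖ + 2 * C * T with hS
  have hS0 : 0 ≤ S := by positivity
  set R := T * S ^ 2 + (‖y₀‖ ^ 2 + 2 * C * T * S) with hR
  have hR0 : 0 ≤ R := by positivity
  -- One constant dominates both the sup bound `S` and the `L²(V)` bound `√R`.
  refine ⟨S + √R, by positivity, fun α v y z p π hα hv hst => ?_⟩
  obtain ⟨hcont, -, hinit, Y, Z, hyY, hzZ, hmom, hfil⟩ := hst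
  have hfe : ∀ᵐ t ∂(timeMeasure T), ‖Z t‖ ≤ ‖Y t‖ ∧ ‖V.field (Z t)‖ ≤ ‖V.field (Y t)‖ ∧
      ‖V.field (Z t) - V.field (Y t)‖ ≤ α * ‖Y t‖ ∧ α ^ 2 * ‖Z t‖ ^ 2 ≤ (α ^ 2 + 1) * ‖V.field (Y t)‖ ^ 2 := by
    filter_upwards [hfil.1, hyY.2, hzZ.2] with t h1 h2 h3
    refine filter_estimates hα fun w => ?_
    rw [h2, h3]
    exact h1 w
  obtain ⟨t₀, ht₀, hmax⟩ := isCompact_Icc.exists_isMaxOn (nonempty_Icc.2 hT.le) hcont.norm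
  set B := ‖y t₀‖ with hB
  have hyB : ∀ t ∈ Icc 0 T, ‖y t‖ ≤ B := fun t ht => hmax ht
  have htime : ∀ᵐ t ∂(timeMeasure T), t ∈ Ioo 0 T := ae_restrict_mem measurableSet_Ioo
  -- for a fixed `α`, the transport field is bounded in `V`
  have hZB : ∀ᵐ t ∂(timeMeasure T), ‖Z t‖ ≤ √((α ^ 2 + 1) * B ^ 2 / α ^ 2) := by
    filter_upwards [hfe, hyY.2, htime] with t h1 h2 h3
    refine Real.le_sqrt_of_sq_le ?_
    rw [le_div_iff₀ (by positivity), mul_comm]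
    refine h1.2.2.2.trans (mul_le_mul_of_nonneg_left ?_ (by positivity))
    rw [h2]
    exact pow_le_pow_left₀ (norm_nonneg _) (hyB t (Ioo_subset_Icc_self h3)) 2
  -- Only membership in `L²(V')` is retained from `hZB`; the bounds obtained below do not depend on
  -- `α`.
  have hG := memLp_momentumFunctional h hyY.1 hzZ.1.1 hZB (memLp_control v)
  have hweak := fun w s hs t ht => weak_formulation h hT hcont hzZ.2 hmom hG w
    (s := s) (t := t) hs ht
  obtain ⟨hyS, hYR⟩ := energy_estimate h hT hC hv hcont hyY hG hweak
  rw [hinit] at hyS hYR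
  have hYn : eLpNorm Y 2 (timeMeasure T) ≤ ENNReal.ofReal (S + √R) := by
    rw [← ENNReal.ofReal_toReal hyY.1.2.ne]
    refine ENNReal.ofReal_le_ofReal ((Real.le_sqrt_of_sq_le ?_).trans (le_add_of_nonneg_left hS0))
    rw [sq_eLpNorm_toReal_eq hyY.1]
    exact hYR
  have hyM : ∀ t ∈ Icc 0 T, ‖y t‖ ≤ S + √R := fun t ht =>
    (hyS t ht).trans (le_add_of_nonneg_right (Real.sqrt_nonneg _))
  refine ⟨Y, Z, ⟨hyY, hzZ, hcont, hyM, hYn, hfe.mono fun _ h => h.1, ?_, ?_, hweak⟩, hmom⟩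
  · filter_upwards [hfe, hyY.2, hzZ.2, htime] with t h1 h2 h3 h4
    rw [← h3]
    refine h1.2.1.trans ?_
    rw [h2]
    exact hyM t (Ioo_subset_Icc_self h4)
  · filter_upwards [hfe, hyY.2, hzZ.2] with t h1 h2 h3
    rw [← h2, ← h3]
    exact h1.2.2.1

end Estimates

end LerayAlpha

end

noncomputable section

namespace LerayAlpha

set_option maxSynthPendingDepth 3

/-! ### Compactness of sequences of paths in a Hilbert space -/

section Paths

theorem tendsto_of_approx {a : ℕ → ℝ} {l : ℝ} (h : ∀ ε > 0, ∃ b : ℕ → ℝ, ∃ l',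
    Tendsto b atTop (𝓝 l') ∧ (∀ n, |a n - b n| ≤ ε) ∧ |l - l'| ≤ ε) : Tendsto a atTop (𝓝 l) := by
  refine Metric.tendsto_atTop.2 fun ε hε => ?_
  obtain ⟨b, l', hb, h1, h2⟩ := h (ε / 4) (by positivity)
  obtain ⟨n₀, hn⟩ := Metric.tendsto_atTop.1 hb (ε / 4) (by positivity)
  refine ⟨n₀, fun n h3 => ?_⟩
  have h4 := hn n h3
  have h5 := h1 n
  rw [Real.dist_eq, abs_lt] at h4 ⊢
  rw [abs_le] at h5 h2
  constructor <;> linarith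

variable {H : Type*} [NormedAddCommGroup H] [InnerProductSpace ℝ H]

/-- Weak equicontinuity on `[0, T]` of a sequence of paths. -/
def WeaklyEquicontinuous (T : ℝ) (y : ℕ → ℝ → H) (h : H) : Prop :=
  ∀ ε > 0, ∃ δ > 0, ∀ n, ∀ s ∈ Icc 0 T, ∀ t ∈ Icc 0 T, |t - s| < δ → |⟪y n t - y n s, h⟫_ℝ| ≤ ε

theorem weaklyEquicontinuous_of_closure {T M : ℝ} {y : ℕ → ℝ → H}
    (hM : ∀ n, ∀ t ∈ Icc 0 T, ‖y n t‖ ≤ M) {S : Set H}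
    (hS : ∀ h ∈ S, WeaklyEquicontinuous T y h) {h : H} (hh : h ∈ closure S) :
    WeaklyEquicontinuous T y h := by
  intro ε hε
  obtain ⟨h', hS', hd⟩ := Metric.mem_closure_iff.1 hh (ε / (2 * (2 * |M| + 1))) (by positivity)
  obtain ⟨δ, hδ, H1⟩ := hS h' hS' (ε / 2) (by positivity)
  refine ⟨δ, hδ, fun n s hs t ht hst => ?_⟩
  have e1 : ⟪y n t - y n s, h⟫_ℝ = ⟪y n t - y n s, h'⟫_ℝ + ⟪y n t - y n s, h - h'⟫_ℝ := by
    rw [← inner_add_right, add_sub_cancel]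
  have e2 : |⟪y n t - y n s, h - h'⟫_ℝ| ≤ ε / 2 := by
    refine (abs_real_inner_le_norm _ _).trans ?_
    have h1 : ‖y n t - y n s‖ ≤ 2 * |M| + 1 := by
      have := norm_sub_le (y n t) (y n s)
      have := (hM n t ht).trans (le_abs_self M)
      have := (hM n s hs).trans (le_abs_self M)
      linarith
    rw [dist_eq_norm] at hd
    refine (mul_le_mul h1 hd.le (norm_nonneg _) (by positivity)).trans (le_of_eq ?_)
    field_simp
  rw [e1]
  exact (abs_add_le _ _).trans (by linarith [H1 n s hs t ht hst])

/-- The increments lie in the closure of `K`, so the component of `h` orthogonal to it is invisible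
and no density of `K` in the whole space is required. -/
theorem weaklyEquicontinuous_of_mem [CompleteSpace H] {T M : ℝ} {y : ℕ → ℝ → H}
    (hM : ∀ n, ∀ t ∈ Icc 0 T, ‖y n t‖ ≤ M) {K : Submodule ℝ H}
    (hK : ∀ h ∈ K, WeaklyEquicontinuous T y h)
    (hy : ∀ n, ∀ t ∈ Icc 0 T, y n t ∈ K.topologicalClosure) (h : H) :
    WeaklyEquicontinuous T y h := by
  have : CompleteSpace K.topologicalClosure := K.isClosed_topologicalClosure.completeSpace_coe
  obtain ⟨a, ha, b, hb, hab⟩ := K.topologicalClosure.exists_add_mem_mem_orthogonal h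
  intro ε hε
  obtain ⟨δ, hδ, H1⟩ := weaklyEquicontinuous_of_closure hM hK (h := a) ha ε hε
  refine ⟨δ, hδ, fun n s hs t ht hst => ?_⟩
  rw [hab, inner_add_right, (K.topologicalClosure.mem_orthogonal b).1 hb _
    (sub_mem (hy n t ht) (hy n s hs)), add_zero]
  exact H1 n s hs t ht hst

/-- Equicontinuity transfers the Cauchy property from a nearby rational time to `t`, uniformly in
`n`. -/
theorem exists_weak_limit_path [CompleteSpace H] {T M : ℝ} (hT : 0 < T) {y : ℕ → ℝ → H}
    (hM : ∀ n, ∀ t ∈ Icc 0 T, ‖y n t‖ ≤ M) (hE : ∀ h, WeaklyEquicontinuous T y h)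
    (hQ : ∀ q : ℚ, (q : ℝ) ∈ Icc 0 T → ∀ h, ∃ l, Tendsto (fun n => ⟪y n q, h⟫_ℝ) atTop (𝓝 l)) :
    ∃ y' : ℝ → H, ∀ t ∈ Icc 0 T, ∀ h, Tendsto (fun n => ⟪y n t, h⟫_ℝ) atTop (𝓝 ⟪y' t, h⟫_ℝ) := by
  have key : ∀ t : ℝ, ∃ y', t ∈ Icc 0 T →
      ∀ h, Tendsto (fun n => ⟪y n t, h⟫_ℝ) atTop (𝓝 ⟪y', h⟫_ℝ) := fun t => by
    by_cases ht : t ∈ Icc 0 T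
    swap
    · exact ⟨0, fun h => absurd h ht⟩
    obtain ⟨y', hy'⟩ := exists_weak_limit (fun n => hM n t ht) (S := univ) (fun h _ => by
      refine cauchySeq_tendsto_of_complete (Metric.cauchySeq_iff'.2 fun ε hε => ?_)
      obtain ⟨δ, hδ, H1⟩ := hE h (ε / 4) (by positivity)
      obtain ⟨q, hq1, hq2⟩ := exists_rat_btwn (show max 0 (t - δ) < min T (t + δ) by
        rw [max_lt_iff, lt_min_iff, lt_min_iff]
        exact ⟨⟨hT, by linarith [ht.1]⟩, by linarith [ht.2], by linarith⟩)
      rw [max_lt_iff] at hq1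
      rw [lt_min_iff] at hq2
      have hq : (q : ℝ) ∈ Icc 0 T := ⟨hq1.1.le, hq2.1.le⟩
      obtain ⟨l, hl⟩ := hQ q hq h
      obtain ⟨n₀, hn₀⟩ := Metric.cauchySeq_iff'.1 hl.cauchySeq (ε / 4) (by positivity)
      refine ⟨n₀, fun n hn => ?_⟩
      have h1 := hn₀ n hn
      have h2 : ∀ m, |⟪y m t - y m q, h⟫_ℝ| ≤ ε / 4 := fun m =>
        H1 m q hq t ht (abs_lt.2 ⟨by linarith [hq2.2], by linarith [hq1.2]⟩)
      have h3 := h2 n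
      have h4 := h2 n₀
      rw [Real.dist_eq, abs_lt] at h1 ⊢
      rw [inner_sub_left, abs_le] at h3 h4
      constructor <;> linarith [h1.1, h1.2, h3.1, h3.2, h4.1, h4.2]) (fun n => by
      refine Submodule.le_topologicalClosure _ (Submodule.subset_span (mem_univ _)))
    exact ⟨y', fun _ => hy'⟩
  choose y' hy' using key
  exact ⟨y', hy'⟩

theorem continuousOn_inner_of_weak_limit {T : ℝ} {y : ℕ → ℝ → H} {y' : ℝ → H} {h : H}
    (hE : WeaklyEquicontinuous T y h)
    (hy : ∀ t ∈ Icc 0 T, Tendsto (fun n => ⟪y n t, h⟫_ℝ) atTop (𝓝 ⟪y' t, h⟫_ℝ)) :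
    ContinuousOn (fun t => ⟪y' t, h⟫_ℝ) (Icc 0 T) := by
  refine Metric.continuousOn_iff.2 fun s hs ε hε => ?_
  obtain ⟨δ, hδ, H1⟩ := hE (ε / 2) (by positivity)
  refine ⟨δ, hδ, fun t ht hst => ?_⟩
  rw [Real.dist_eq] at hst ⊢
  have h1 := ((hy t ht).sub (hy s hs)).abs
  refine (le_of_tendsto' h1 fun n => ?_).trans_lt (half_lt_self hε)
  rw [← inner_sub_left]
  exact H1 n s hs t ht hst

theorem norm_le_of_weak_limit {x : ℕ → H} {x' : H} {M : ℝ} (hM : ∀ n, ‖x n‖ ≤ M)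
    (hx : ∀ h, Tendsto (fun n => ⟪x n, h⟫_ℝ) atTop (𝓝 ⟪x', h⟫_ℝ)) : ‖x'‖ ≤ M := by
  have h1 : ⟪x', x'⟫_ℝ ≤ M * ‖x'‖ := le_of_tendsto' (hx x') fun n =>
    (real_inner_le_norm _ _).trans (mul_le_mul_of_nonneg_right (hM n) (norm_nonneg _))
  have h0 : 0 ≤ M := (norm_nonneg _).trans (hM 0)
  rw [real_inner_self_eq_norm_sq] at h1
  by_contra! hlt
  nlinarith [norm_nonneg x']

variable {X : Type*} [NormedAddCommGroup X] [InnerProductSpace ℝ X]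

/-- The functional `x ↦ ⟪h, κ x⟫`. -/
def pairL (κ : X →L[ℝ] H) : H →L[ℝ] X →L[ℝ] ℝ :=
  ((ContinuousLinearMap.compL ℝ X H ℝ).flip κ).comp (innerSL ℝ)

theorem pairL_apply (κ : X →L[ℝ] H) (h : H) (x : X) : pairL κ h x = ⟪h, κ x⟫_ℝ := rfl

/-- Fix `h`, set `g = ⟪h, κ Y' - y'⟫` and test with `g(t) ⟪h, κ ·⟫`. The weak limit of `Y n` and the
dominated limit of `y n` must agree, which says `∫ g² = 0`; second countability handles all `h` at
once. -/
theorem ae_eq_of_weakTendsto [SecondCountableTopology H] {T M : ℝ} {Y : ℕ → ℝ → X} {Y' : ℝ → X}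
    (κ : X →L[ℝ] H) (hY : ∀ n, MemLp (Y n) 2 (timeMeasure T)) (hY' : MemLp Y' 2 (timeMeasure T))
    (hw : WeakTendsto (timeMeasure T) Y Y') {y : ℕ → ℝ → H} {y' : ℝ → H}
    (hyY : ∀ n, ∀ᵐ t ∂(timeMeasure T), κ (Y n t) = y n t)
    (hM : ∀ n, ∀ t ∈ Icc 0 T, ‖y n t‖ ≤ M)
    (hy' : ∀ h, ContinuousOn (fun t => ⟪y' t, h⟫_ℝ) (Icc 0 T))
    (hy : ∀ t ∈ Icc 0 T, ∀ h, Tendsto (fun n => ⟪y n t, h⟫_ℝ) atTop (𝓝 ⟪y' t, h⟫_ℝ)) :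
    ∀ᵐ t ∂(timeMeasure T), κ (Y' t) = y' t := by
  have htime : ∀ᵐ t ∂(timeMeasure T), t ∈ Icc 0 T :=
    (ae_restrict_mem measurableSet_Ioo).mono fun t ht => Ioo_subset_Icc_self ht
  have key : ∀ h : H, (fun t => ⟪h, κ (Y' t) - y' t⟫_ℝ) =ᵐ[timeMeasure T] 0 := fun h => by
    set g : ℝ → ℝ := fun t => ⟪h, κ (Y' t) - y' t⟫_ℝ with hg
    have hc : MemLp (fun t => ⟪y' t, h⟫_ℝ) 2 (timeMeasure T) := by
      obtain ⟨c, hc⟩ := isCompact_Icc.exists_bound_of_continuousOn (hy' h)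
      exact MemLp.of_bound (((hy' h).mono Ioo_subset_Icc_self).aestronglyMeasurable
        measurableSet_Ioo) c (htime.mono hc)
    have hg2 : MemLp g 2 (timeMeasure T) := by
      have h1 : MemLp (fun t => pairL κ h (Y' t)) 2 (timeMeasure T) :=
        (pairL κ h).comp_memLp' hY'
      refine (h1.sub hc).ae_eq (Eventually.of_forall fun t => ?_)
      simp only [hg, Pi.sub_apply, pairL_apply, inner_sub_right, real_inner_comm]
    have hl : MemLp (fun t => g t • pairL κ h) 2 (timeMeasure T) :=
      (ContinuousLinearMap.toSpanSingleton ℝ (pairL κ h)).comp_memLp' hg2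
    have h1 := hw _ hl
    have h2 : Tendsto (fun n => ∫ t in Ioo 0 T, g t * ⟪y n t, h⟫_ℝ) atTop
        (𝓝 (∫ t in Ioo 0 T, g t * ⟪y' t, h⟫_ℝ)) := by
      refine tendsto_integral_of_dominated_convergence (fun t => ‖g t‖ * (|M| * ‖h‖))
        (fun n => ?_) ((hg2.integrable (by norm_num)).norm.mul_const _) (fun n => ?_) ?_
      · have h3 : AEStronglyMeasurable (fun t => pairL κ h (Y n t)) (timeMeasure T) :=
          (pairL κ h).continuous.comp_aestronglyMeasurable (hY n).1
        refine (hg2.1.mul h3).congr ?_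
        filter_upwards [hyY n] with t ht
        simp only [Pi.mul_apply, pairL_apply, ht, real_inner_comm]
      · filter_upwards [htime] with t ht
        rw [norm_mul]
        refine mul_le_mul_of_nonneg_left ((norm_inner_le_norm _ _).trans ?_) (norm_nonneg _)
        exact mul_le_mul_of_nonneg_right ((hM n t ht).trans (le_abs_self _)) (norm_nonneg _)
      · filter_upwards [htime] with t ht
        exact (hy t ht h).const_mul _
    have h3 : ∀ n, ∫ t in Ioo 0 T, (g t • pairL κ h) (Y n t)
        = ∫ t in Ioo 0 T, g t * ⟪y n t, h⟫_ℝ := fun n => by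
      refine integral_congr_ae ?_
      filter_upwards [hyY n] with t ht
      rw [smul_apply, pairL_apply, ht, smul_eq_mul, real_inner_comm]
    simp_rw [h3] at h1
    have h4 := tendsto_nhds_unique h1 h2
    have h5 : ∫ t in Ioo 0 T, g t ^ 2 = 0 := by
      have h6 := integral_sub (integrable_clm_apply hl hY') (hg2.integrable_mul hc (p := 2) (q := 2))
      simp only [Pi.mul_apply] at h6
      rw [h4, sub_self] at h6
      refine Eq.trans ?_ h6
      refine integral_congr_ae (Eventually.of_forall fun t => ?_)
      simp only [smul_apply, pairL_apply, smul_eq_mul]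
      rw [← mul_sub, real_inner_comm h (y' t), ← inner_sub_right, sq]
    have h7 := (integral_eq_zero_iff_of_nonneg (fun t => sq_nonneg (g t)) hg2.integrable_sq).1 h5
    filter_upwards [h7] with t ht
    exact pow_eq_zero_iff two_ne_zero |>.1 ht
  have := ae_eq_zero_of_forall_inner key
  filter_upwards [this] with t ht
  exact sub_eq_zero.1 ht

theorem tendsto_eLpNorm_two_of_ae {α F : Type*} [MeasurableSpace α] {μ : Measure α}
    [IsFiniteMeasure μ] [NormedAddCommGroup F] {f : ℕ → α → F} {B : ℝ}
    (hf : ∀ n, AEStronglyMeasurable (f n) μ) (hB : ∀ n, ∀ᵐ t ∂μ, ‖f n t‖ ≤ B)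
    (h : ∀ᵐ t ∂μ, Tendsto (fun n => f n t) atTop (𝓝 0)) :
    Tendsto (fun n => eLpNorm (f n) 2 μ) atTop (𝓝 0) := by
  have h1 : Tendsto (fun n => ∫⁻ t, ‖f n t‖ₑ ^ 2 ∂μ) atTop (𝓝 (∫⁻ _, 0 ∂μ)) := by
    refine tendsto_lintegral_of_dominated_convergence' (fun _ => ENNReal.ofReal B ^ 2)
      (fun n => (hf n).enorm.pow_const 2) (fun n => ?_) (by
        rw [lintegral_const]
        finiteness) ?_
    · filter_upwards [hB n] with t ht
      rw [← ofReal_norm]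
      gcongr
    · filter_upwards [h] with t ht
      have := (ENNReal.continuous_pow 2).tendsto _ |>.comp ht.enorm
      simpa [Function.comp_def] using this
  simp_rw [← eLpNorm_two_sq] at h1
  rw [lintegral_zero] at h1
  have h2 := (ENNReal.continuous_rpow_const (y := 1 / 2)).tendsto 0 |>.comp h1
  rw [ENNReal.zero_rpow_of_pos (by norm_num)] at h2
  refine h2.congr fun n => ?_
  simp only [Function.comp_apply]
  rw [← ENNReal.rpow_natCast, ← ENNReal.rpow_mul]
  norm_num

/-- A compactness argument of Aubin–Lions type. By `hκ` the norm of `y n - y'` is at most `η` times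
a quantity bounded in `L²` plus the norm of its image under `K`. The latter tends to zero at almost
every time, since `y n t` converges weakly, and in `L²` by dominated convergence. -/
theorem tendsto_eLpNorm_of_compactness {T M : ℝ} {Y : ℕ → ℝ → X} {Y' : ℝ → X} (κ : X →L[ℝ] H)
    (hY : ∀ n, MemLp (Y n) 2 (timeMeasure T)) (hY' : MemLp Y' 2 (timeMeasure T)) {R : ℝ≥0∞}
    (hR : R ≠ ∞) (hYR : ∀ n, eLpNorm (Y n) 2 (timeMeasure T) ≤ R) {y : ℕ → ℝ → H} {y' : ℝ → H}
    (hyY : ∀ n, ∀ᵐ t ∂(timeMeasure T), κ (Y n t) = y n t)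
    (hyY' : ∀ᵐ t ∂(timeMeasure T), κ (Y' t) = y' t)
    (hM : ∀ n, ∀ t ∈ Icc 0 T, ‖y n t‖ ≤ M)
    (hy : ∀ t ∈ Icc 0 T, ∀ h, Tendsto (fun n => ⟪y n t, h⟫_ℝ) atTop (𝓝 ⟪y' t, h⟫_ℝ))
    (hκ : ∀ ε > 0, ∃ K : H →L[ℝ] H, (∀ x, ‖κ x‖ ≤ ε * ‖x‖ + ‖K (κ x)‖) ∧
      ∀ (u : ℕ → H) (u' : H) (M : ℝ), (∀ n, ‖u n‖ ≤ M) →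
        (∀ h, Tendsto (fun n => ⟪u n, h⟫_ℝ) atTop (𝓝 ⟪u', h⟫_ℝ)) →
        Tendsto (fun n => K (u n)) atTop (𝓝 (K u'))) :
    Tendsto (fun n => eLpNorm (fun t => y n t - y' t) 2 (timeMeasure T)) atTop (𝓝 0) := by
  have htime : ∀ᵐ t ∂(timeMeasure T), t ∈ Icc 0 T :=
    (ae_restrict_mem measurableSet_Ioo).mono fun t ht => Ioo_subset_Icc_self ht
  set R' := R + eLpNorm Y' 2 (timeMeasure T) with hR'
  have hR'' : R' ≠ ∞ := ENNReal.add_ne_top.2 ⟨hR, hY'.2.ne⟩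
  have hsub : ∀ n, eLpNorm (fun t => Y n t - Y' t) 2 (timeMeasure T) ≤ R' := fun n =>
    (eLpNorm_sub_le (hY n).1 hY'.1 (by norm_num)).trans (add_le_add_left (hYR n) _)
  have hmy : ∀ n, AEStronglyMeasurable (fun t => κ (Y n t) - κ (Y' t)) (timeMeasure T) := fun n =>
    (κ.continuous.comp_aestronglyMeasurable (hY n).1).sub
      (κ.continuous.comp_aestronglyMeasurable hY'.1)
  have hall : ∀ᵐ t ∂(timeMeasure T), ∀ n, κ (Y n t) = y n t := ae_all_iff.2 hyY
  refine ENNReal.tendsto_nhds_zero.2 fun ε hε => ?_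
  obtain ⟨η, hη, hηR⟩ : ∃ η : ℝ, 0 < η ∧ ENNReal.ofReal η * R' ≤ ε / 2 := by
    have h1 : Tendsto (fun η : ℝ => ENNReal.ofReal η * R') (𝓝[>] 0) (𝓝 0) := by
      have := ENNReal.Tendsto.mul_const (b := R')
        ((ENNReal.continuous_ofReal.tendsto 0).mono_left
        (nhdsWithin_le_nhds (s := Ioi (0 : ℝ)))) (Or.inr hR'')
      simpa using this
    have h2 := (ENNReal.tendsto_nhds_zero.1 h1 (ε / 2) (ENNReal.half_pos hε.ne')).and
      self_mem_nhdsWithin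
    obtain ⟨η, h3, h4⟩ := h2.exists
    exact ⟨η, h4, h3⟩
  obtain ⟨K, hK1, hK2⟩ := hκ η hη
  have hKt : Tendsto (fun n => eLpNorm (fun t => K (κ (Y n t) - κ (Y' t))) 2 (timeMeasure T))
      atTop (𝓝 0) := by
    refine tendsto_eLpNorm_two_of_ae (B := ‖K‖ * (M + M))
      (fun n => K.continuous.comp_aestronglyMeasurable (hmy n)) (fun n => ?_) ?_
    · filter_upwards [hyY n, hyY', htime] with t h1 h2 h3
      refine (K.le_opNorm _).trans (mul_le_mul_of_nonneg_left ?_ (norm_nonneg _))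
      rw [h1, h2]
      exact (norm_sub_le _ _).trans (add_le_add (hM n t h3)
        (norm_le_of_weak_limit (fun n => hM n t h3) (hy t h3)))
    · filter_upwards [hall, hyY', htime] with t h1 h2 h3
      have := (hK2 (fun n => y n t) (y' t) M (fun n => hM n t h3) (hy t h3)).sub_const (K (y' t))
      simp_rw [h1, h2, map_sub]
      simpa using this
  filter_upwards [ENNReal.tendsto_nhds_zero.1 hKt (ε / 2) (ENNReal.half_pos hε.ne')] with n hn
  have e1 : eLpNorm (fun t => y n t - y' t) 2 (timeMeasure T)
      ≤ eLpNorm (fun t => η * ‖Y n t - Y' t‖ + ‖K (κ (Y n t) - κ (Y' t))‖) 2 (timeMeasure T) := by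
    refine eLpNorm_mono_ae ?_
    filter_upwards [hyY n, hyY'] with t h1 h2
    rw [← h1, ← h2, ← map_sub]
    exact (hK1 _).trans (le_abs_self _)
  have e2 := eLpNorm_add_le (p := 2) (μ := timeMeasure T)
    (f := fun t => η * ‖Y n t - Y' t‖) (g := fun t => ‖K (κ (Y n t) - κ (Y' t))‖)
    (((hY n).1.sub hY'.1).norm.const_mul η)
    (K.continuous.comp_aestronglyMeasurable (hmy n)).norm (by norm_num)
  have e3 : eLpNorm (fun t => η * ‖Y n t - Y' t‖) 2 (timeMeasure T)
      = ENNReal.ofReal η * eLpNorm (fun t => Y n t - Y' t) 2 (timeMeasure T) := by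
    have := eLpNorm_const_smul (p := 2) (μ := timeMeasure T) η (fun t => ‖Y n t - Y' t‖)
    rw [eLpNorm_norm] at this
    rw [← Real.enorm_of_nonneg hη.le, ← this]
    rfl
  rw [eLpNorm_norm, e3] at e2
  calc _ ≤ _ := e1
    _ ≤ _ := e2
    _ ≤ ENNReal.ofReal η * R' + ε / 2 := by
      refine add_le_add ?_ hn
      gcongr
      exact hsub n
    _ ≤ ε / 2 + ε / 2 := by gcongr
    _ = ε := ENNReal.add_halves ε

end Paths

end LerayAlpha

end

noncomputable section

namespace LerayAlpha

set_option maxSynthPendingDepth 3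

/-! ### Equicontinuity from integral bounds, and weak-* limits of controls -/

section WeakLimits

variable {H : Type*} [NormedAddCommGroup H] [InnerProductSpace ℝ H]

/-- An increment over `[s, t]` is at most `K |t - s| + δ R`. Fixing `δ` first makes the second term
at most `ε / 2`, after which closeness of `s` and `t` handles the first. -/
theorem weaklyEquicontinuous_of_integral {T R : ℝ} {X : Type*} [NormedAddCommGroup X]
    {Y : ℕ → ℝ → X} (hY : ∀ n, MemLp (Y n) 2 (timeMeasure T))
    (hR : ∀ n, ∫ t in Ioo 0 T, ‖Y n t‖ ^ 2 ≤ R) {y : ℕ → ℝ → H} {h : H} {f : ℕ → ℝ → ℝ}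
    (hf : ∀ n, ∀ s ∈ Icc 0 T, ∀ t ∈ Icc 0 T, ⟪y n t - y n s, h⟫_ℝ = ∫ τ in s..t, f n τ)
    (hK : ∀ δ > 0, ∃ K, ∀ n, ∀ᵐ t ∂(timeMeasure T), |f n t| ≤ K + δ * ‖Y n t‖ ^ 2) :
    WeaklyEquicontinuous T y h := by
  intro ε hε
  have hR0 : 0 ≤ R := (integral_nonneg fun t => by positivity).trans (hR 0)
  obtain ⟨K, hK⟩ := hK (ε / (2 * (R + 1))) (by positivity)
  refine ⟨ε / (2 * (|K| + 1)), by positivity, ?_⟩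
  have main : ∀ n, ∀ s ∈ Icc 0 T, ∀ t ∈ Icc 0 T, s ≤ t → |t - s| < ε / (2 * (|K| + 1)) →
      |⟪y n t - y n s, h⟫_ℝ| ≤ ε := fun n s hs t ht hst hlt => by
    rw [hf n s hs t ht, intervalIntegral.integral_of_le hst, integral_Ioc_eq_integral_Ioo]
    have hsub : Ioo s t ⊆ Ioo 0 T := Ioo_subset_Ioo hs.1 ht.2
    have hle : volume.restrict (Ioo s t) ≤ timeMeasure T := Measure.restrict_mono hsub le_rfl
    have hi := (integrable_norm_sq (hY n)).const_mul (ε / (2 * (R + 1)))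
    have h1 := norm_integral_le_of_norm_le (f := f n)
      ((integrable_const (μ := volume.restrict (Ioo s t)) |K|).add (hi.mono_measure hle))
      (((hK n).filter_mono (ae_mono hle)).mono fun τ hτ =>
        hτ.trans (add_le_add_left (le_abs_self K) _))
    have h2 := integral_add (integrable_const (μ := volume.restrict (Ioo s t)) |K|)
      (hi.mono_measure hle)
    simp only [Pi.add_apply] at h1
    rw [h2, integral_const, measureReal_restrict_apply_univ, Real.volume_real_Ioo_of_le hst,
      integral_const_mul, smul_eq_mul, Real.norm_eq_abs] at h1
    have h3 : ∫ τ in Ioo s t, ‖Y n τ‖ ^ 2 ≤ R :=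
      (integral_mono_measure hle (Eventually.of_forall fun τ => by positivity)
        (integrable_norm_sq (hY n))).trans (hR n)
    have h4 : (t - s) * |K| ≤ ε / 2 := by
      have h5 : (t - s) * |K| ≤ ε / (2 * (|K| + 1)) * (|K| + 1) :=
        mul_le_mul ((le_abs_self _).trans hlt.le) (by linarith) (abs_nonneg _) (by positivity)
      refine h5.trans (le_of_eq ?_)
      field_simp
    have h6 : ε / (2 * (R + 1)) * ∫ τ in Ioo s t, ‖Y n τ‖ ^ 2 ≤ ε / 2 := by
      have : ε / (2 * (R + 1)) * ∫ τ in Ioo s t, ‖Y n τ‖ ^ 2 ≤ ε / (2 * (R + 1)) * (R + 1) :=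
        mul_le_mul_of_nonneg_left (by linarith) (by positivity)
      refine this.trans (le_of_eq ?_)
      field_simp
    linarith
  intro n s hs t ht hst
  rcases le_total s t with h1 | h1
  · exact main n s hs t ht h1 hst
  · have h2 := main n t ht s hs h1 (by rwa [abs_sub_comm])
    rwa [← neg_sub, inner_neg_left, abs_neg]

theorem exists_weakTendsto {T : ℝ} {X : Type*} [NormedAddCommGroup X] [InnerProductSpace ℝ X]
    [CompleteSpace X] {R : ℝ≥0∞} (hR : R ≠ ∞) {Y : ℕ → ℝ → X}
    (hY : ∀ n, MemLp (Y n) 2 (timeMeasure T)) (hYR : ∀ n, eLpNorm (Y n) 2 (timeMeasure T) ≤ R)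
    {φ : ℕ → ℕ} (hφ : ∀ m, ∃ l, Tendsto (fun n => ⟪(hY (φ n)).toLp, (hY m).toLp⟫_ℝ) atTop (𝓝 l)) :
    ∃ Y' : ℝ → X, MemLp Y' 2 (timeMeasure T) ∧
      WeakTendsto (timeMeasure T) (fun n => Y (φ n)) Y' := by
  obtain ⟨Y', h⟩ := exists_weak_limit_of_self (x := fun n => (hY (φ n)).toLp) (C := R.toReal)
    (fun n => by
      rw [Lp.norm_toLp]
      exact ENNReal.toReal_mono hR (hYR _)) (ξ := fun m => (hY m).toLp) hφ
    fun n => mem_range_self (φ n)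
  exact ⟨Y', Lp.memLp Y', weakTendsto_of_inner (fun n => hY (φ n)) h⟩

theorem abs_inner_toLp_le {T : ℝ} {X : Type*} [NormedAddCommGroup X] [InnerProductSpace ℝ X]
    {R : ℝ≥0∞} (hR : R ≠ ∞) {Y : ℕ → ℝ → X} (hY : ∀ n, MemLp (Y n) 2 (timeMeasure T))
    (hYR : ∀ n, eLpNorm (Y n) 2 (timeMeasure T) ≤ R) (n m : ℕ) :
    |⟪(hY n).toLp, (hY m).toLp⟫_ℝ| ≤ R.toReal * R.toReal := by
  have h : ∀ n, ‖(hY n).toLp‖ ≤ R.toReal := fun n => by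
    rw [Lp.norm_toLp]
    exact ENNReal.toReal_mono hR (hYR _)
  exact (abs_real_inner_le_norm _ _).trans
    (mul_le_mul (h n) (h m) (norm_nonneg _) ENNReal.toReal_nonneg)

/-- The functional `ℓ + b z w`. -/
def addBilin {X A B : Type*} [NormedAddCommGroup X] [NormedSpace ℝ X] [NormedAddCommGroup A]
    [NormedSpace ℝ A] [NormedAddCommGroup B] [NormedSpace ℝ B] (b : A →L[ℝ] B →L[ℝ] X →L[ℝ] ℝ)
    (ℓ : X →L[ℝ] ℝ) (z : A) (w : B) : X →L[ℝ] ℝ :=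
  ℓ + b z w

/-- Since `W` is bounded, the functionals `ℓ + b (z n) W` converge strongly in `L²`, and they are
paired with a weakly convergent sequence. -/
theorem tendsto_integral_functional {T : ℝ} {X A B : Type*} [NormedAddCommGroup X]
    [NormedSpace ℝ X] [NormedAddCommGroup A] [NormedSpace ℝ A] [NormedAddCommGroup B]
    [NormedSpace ℝ B] (b : A →L[ℝ] B →L[ℝ] X →L[ℝ] ℝ) {Y : ℕ → ℝ → X} {Y' : ℝ → X}
    (hYY : WeakTendsto (timeMeasure T) Y Y') {R : ℝ≥0∞} (hR : R ≠ ∞)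
    (hY : ∀ n, MemLp (Y n) 2 (timeMeasure T)) (hYR : ∀ n, eLpNorm (Y n) 2 (timeMeasure T) ≤ R)
    {z : ℕ → ℝ → A} {z' : ℝ → A} (hz : ∀ n, MemLp (z n) 2 (timeMeasure T))
    (hz' : MemLp z' 2 (timeMeasure T))
    (hzz : Tendsto (fun n => eLpNorm (fun t => z n t - z' t) 2 (timeMeasure T)) atTop (𝓝 0))
    {ℓ : ℝ → X →L[ℝ] ℝ} (hℓ : MemLp ℓ 2 (timeMeasure T)) {W : ℝ → B}
    (hW : AEStronglyMeasurable W (timeMeasure T)) {c : ℝ}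
    (hc : ∀ᵐ t ∂(timeMeasure T), ‖W t‖ ≤ c) :
    Tendsto (fun n => ∫ t in Ioo 0 T, addBilin b (ℓ t) (z n t) (W t) (Y n t)) atTop
      (𝓝 (∫ t in Ioo 0 T, addBilin b (ℓ t) (z' t) (W t) (Y' t))) := by
  have h1 : ∀ z, MemLp z 2 (timeMeasure T) → MemLp (fun t => b (z t) (W t)) 2 (timeMeasure T) :=
    fun z hz => memLp_bilin_of_bound_right b hz hW hc
  refine hYY.tendsto_integral hR hY hYR (fun n => hℓ.add (h1 _ (hz n))) (hℓ.add (h1 _ hz')) ?_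
  have h2 : Tendsto (fun n => ENNReal.ofReal (‖b‖ * |c|) *
      eLpNorm (fun t => z n t - z' t) 2 (timeMeasure T)) atTop (𝓝 0) := by
    have := ENNReal.Tendsto.const_mul hzz (Or.inr (ENNReal.ofReal_ne_top (r := ‖b‖ * |c|)))
    rwa [mul_zero] at this
  refine tendsto_of_tendsto_of_tendsto_of_le_of_le tendsto_const_nhds h2 (fun _ => bot_le)
    fun n => ?_
  refine eLpNorm_le_mul_eLpNorm_of_ae_le_mul ?_ _
  filter_upwards [hc] with t ht
  rw [addBilin, addBilin, add_sub_add_left_eq_sub, ← sub_apply, ← map_sub]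
  refine (b.le_opNorm₂ _ _).trans ?_
  rw [mul_right_comm]
  gcongr
  exact ht.trans (le_abs_self c)

/-- Test with `v'` cut off to the set where its norm exceeds `C`: the limit inequality `∫ ⟪g, v'⟫ ≤
C ∫ ‖g‖` is the reverse of the pointwise one, so the set is negligible. -/
theorem ae_norm_le_of_weak {T C : ℝ} (hC : 0 ≤ C) {v : ℕ → ℝ → H} {v' : ℝ → H}
    (hv : ∀ n, MemLp (v n) 2 (timeMeasure T)) (hv' : MemLp v' 2 (timeMeasure T))
    (hvC : ∀ n, ∀ᵐ t ∂(timeMeasure T), ‖v n t‖ ≤ C)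
    (hw : WeakTendsto (timeMeasure T) v v') : ∀ᵐ t ∂(timeMeasure T), ‖v' t‖ ≤ C := by
  have hn : MemLp (fun t => ‖v' t‖) 2 (timeMeasure T) := hv'.norm
  set u : ℝ → H := hv'.1.mk v' with hu
  have huv : v' =ᵐ[timeMeasure T] u := hv'.1.ae_eq_mk
  have hum : StronglyMeasurable u := hv'.1.stronglyMeasurable_mk
  have hA : MeasurableSet {t | C < ‖u t‖} := measurableSet_lt measurable_const hum.norm.measurable
  set g : ℝ → H := indicator {t | C < ‖u t‖} u with hg
  have hg2 : MemLp g 2 (timeMeasure T) := (hv'.ae_eq huv).indicator hA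
  have h1 := hw (fun t => innerSL ℝ (g t)) ((innerSL ℝ).comp_memLp' hg2)
  have h2 : ∫ t in Ioo 0 T, ⟪g t, v' t⟫_ℝ ≤ C * ∫ t in Ioo 0 T, ‖g t‖ := by
    refine le_of_tendsto' h1 fun n => ?_
    rw [← integral_const_mul]
    refine integral_mono_ae (integrable_clm_apply ((innerSL ℝ).comp_memLp' hg2) (hv n))
      ((hg2.integrable (by norm_num)).norm.const_mul C) ?_
    filter_upwards [hvC n] with t ht
    rw [innerSL_apply_apply, mul_comm]
    exact (real_inner_le_norm _ _).trans (mul_le_mul_of_nonneg_left ht (norm_nonneg _))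
  have hi1 : Integrable (fun t => ⟪g t, v' t⟫_ℝ) (timeMeasure T) :=
    integrable_clm_apply ((innerSL ℝ).comp_memLp' hg2) hv'
  have hi2 := (hg2.integrable (by norm_num)).norm.const_mul C
  have hnn : ∀ᵐ t ∂(timeMeasure T), 0 ≤ ⟪g t, v' t⟫_ℝ - C * ‖g t‖ := by
    filter_upwards [huv] with t ht
    rw [ht, hg]
    by_cases h : C < ‖u t‖
    · rw [indicator_of_mem (by exact h), real_inner_self_eq_norm_sq]
      nlinarith [norm_nonneg (u t)]
    · rw [indicator_of_notMem (by exact h)]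
      simp
  have h3 : ∫ t in Ioo 0 T, (⟪g t, v' t⟫_ℝ - C * ‖g t‖) = 0 := by
    refine le_antisymm ?_ (integral_nonneg_of_ae hnn)
    rw [integral_sub hi1 hi2, integral_const_mul]
    linarith
  have h4 := (integral_eq_zero_iff_of_nonneg_ae hnn (hi1.sub hi2)).1 h3
  filter_upwards [h4, huv] with t h5 h6
  rw [h6]
  by_contra! h
  simp only [hg, Pi.zero_apply] at h5
  rw [h6, indicator_of_mem (by exact h), real_inner_self_eq_norm_sq] at h5
  nlinarith [norm_nonneg (u t)]

/-- Simple functions are square integrable and dense in `L¹`; the common essential bound `C` makes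
the approximation error uniform in `n`. -/
theorem tendsto_integral_inner_of_integrable {T C : ℝ} (hC : 0 ≤ C) {v : ℕ → ℝ → H} {v' : ℝ → H}
    (hv : ∀ n, MemLp (v n) 2 (timeMeasure T)) (hv' : MemLp v' 2 (timeMeasure T))
    (hvC : ∀ n, ∀ᵐ t ∂(timeMeasure T), ‖v n t‖ ≤ C)
    (hw : WeakTendsto (timeMeasure T) v v') {g : ℝ → H} (hg : MemLp g 1 (timeMeasure T)) :
    Tendsto (fun n => ∫ t in Ioo 0 T, ⟪v n t, g t⟫_ℝ) atTop
      (𝓝 (∫ t in Ioo 0 T, ⟪v' t, g t⟫_ℝ)) := by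
  have hvC' := ae_norm_le_of_weak hC hv hv' hvC hw
  refine tendsto_of_approx fun ε hε => ?_
  obtain ⟨k, hk, -⟩ := hg.exists_simpleFunc_eLpNorm_sub_lt ENNReal.one_ne_top
    (ε := ENNReal.ofReal (ε / (C + 1))) (by simpa using by positivity)
  have hk2 : MemLp k 2 (timeMeasure T) := k.memLp_of_isFiniteMeasure 2 _
  have hk1 : MemLp k 1 (timeMeasure T) := k.memLp_of_isFiniteMeasure 1 _
  have hi : ∀ f : ℝ → H, MemLp f 1 (timeMeasure T) → ∀ u, MemLp u 2 (timeMeasure T) →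
      (∀ᵐ t ∂(timeMeasure T), ‖u t‖ ≤ C) → Integrable (fun t => ⟪u t, f t⟫_ℝ) (timeMeasure T) := by
    intro f hf u hu huC
    have : MemLp (fun t => innerSL ℝ (u t) (f t)) 1 (timeMeasure T) :=
      memLp_bilin_of_bound_left (innerSL ℝ) hu.1 huC hf
    exact memLp_one_iff_integrable.1 this
  have hsub : ∫ t in Ioo 0 T, ‖g t - k t‖ ≤ ε / (C + 1) := by
    rw [eLpNorm_one_eq_lintegral_enorm] at hk
    have := integral_norm_eq_lintegral_enorm (hg.1.sub hk1.1)
    simp only [Pi.sub_apply] at this hk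
    rw [this]
    exact ENNReal.toReal_le_of_le_ofReal (by positivity) hk.le
  have est : ∀ u, MemLp u 2 (timeMeasure T) → (∀ᵐ t ∂(timeMeasure T), ‖u t‖ ≤ C) →
      |(∫ t in Ioo 0 T, ⟪u t, g t⟫_ℝ) - ∫ t in Ioo 0 T, ⟪u t, k t⟫_ℝ| ≤ ε := fun u hu huC => by
    have hgi := memLp_one_iff_integrable.1 (hg.sub hk1)
    rw [← integral_sub (hi g hg u hu huC) (hi k hk1 u hu huC), ← Real.norm_eq_abs]
    have h1 := norm_integral_le_of_norm_le (f := fun t => ⟪u t, g t⟫_ℝ - ⟪u t, k t⟫_ℝ)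
      (hgi.norm.const_mul C) (huC.mono fun t ht => by
        rw [← inner_sub_right]
        exact (norm_inner_le_norm _ _).trans (mul_le_mul_of_nonneg_right ht (norm_nonneg _)))
    refine h1.trans ?_
    rw [integral_const_mul]
    refine (mul_le_mul_of_nonneg_left hsub hC).trans ?_
    rw [← mul_div_assoc, div_le_iff₀ (by positivity)]
    linarith
  refine ⟨fun n => ∫ t in Ioo 0 T, ⟪v n t, k t⟫_ℝ, ∫ t in Ioo 0 T, ⟪v' t, k t⟫_ℝ, ?_,
    fun n => est _ (hv n) (hvC n), est _ hv' hvC'⟩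
  have := hw (fun t => innerSL ℝ (k t)) ((innerSL ℝ).comp_memLp' hk2)
  simpa only [innerSL_apply_apply, real_inner_comm] using this

end WeakLimits

end LerayAlpha

end

noncomputable section

namespace LerayAlpha

set_option maxSynthPendingDepth 3

/-! ### The equations tested against bounded fields -/

theorem abs_trilinear_sub_le {A B P : Type*} [NormedAddCommGroup A] [NormedSpace ℝ A]
    [NormedAddCommGroup B] [NormedSpace ℝ B] [NormedAddCommGroup P] [NormedSpace ℝ P]
    {X : Submodule ℝ P} (b : A →L[ℝ] B →L[ℝ] P →L[ℝ] ℝ) (ι : X →L[ℝ] A) {δ : ℝ} (hδ : 0 < δ)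
    {w k : B} (hwk : ‖w - k‖ ≤ δ / (‖b‖ * ‖ι‖ + 1)) (z y : X) :
    |b (ι z) w (y : P) - b (ι z) k (y : P)| ≤ δ * (‖z‖ * ‖y‖) := by
  rw [← sub_apply, ← map_sub]
  refine ((b (ι z) (w - k)).le_opNorm (y : P)).trans ?_
  have h1 := (b.le_opNorm₂ (ι z) (w - k)).trans (mul_le_mul_of_nonneg_right
    (mul_le_mul_of_nonneg_left (ι.le_opNorm z) (norm_nonneg b)) (norm_nonneg _))
  have h2 : ‖b‖ * ‖ι‖ * ‖w - k‖ ≤ δ := by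
    refine (mul_le_mul_of_nonneg_left hwk (by positivity)).trans ?_
    rw [← mul_div_assoc, div_le_iff₀ (by positivity)]
    nlinarith
  refine (mul_le_mul_of_nonneg_right h1 (norm_nonneg _)).trans ?_
  calc _ = ‖b‖ * ‖ι‖ * ‖w - k‖ * (‖z‖ * ‖y‖) := by
        rw [Submodule.coe_norm y]
        ring
    _ ≤ _ := mul_le_mul_of_nonneg_right h2 (by positivity)

theorem abs_neg_add_sum_le {N : ℕ} {a c M r : ℝ} {b : Fin N → ℝ} (ha : |a| ≤ c * M * r)
    (hb : ∀ i, |b i| ≤ c * M * r) : |-a + ∑ i, b i| ≤ M * (c * (N + 1) * r) := by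
  have h3 := (Finset.abs_sum_le_sum_abs _ Finset.univ).trans (Finset.sum_le_sum fun i _ => hb i)
  rw [Finset.sum_const, Finset.card_univ, Fintype.card_fin, nsmul_eq_mul] at h3
  refine (abs_add_le _ _).trans ?_
  rw [abs_neg]
  exact (add_le_add ha h3).trans (le_of_eq (by ring))

section Tests

theorem neg_add_sum_apply {ι X : Type*} [NormedAddCommGroup X] [NormedSpace ℝ X] (s : Finset ι)
    (a : X →L[ℝ] ℝ) (b : ι → X →L[ℝ] ℝ) (x : X) : (-a + ∑ i ∈ s, b i) x = -a x + ∑ i ∈ s, b i x := by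
  rw [add_apply, neg_apply, sum_apply]

theorem Continuous.neg_add_sum {α ι F : Type*} [TopologicalSpace α] [NormedAddCommGroup F]
    {s : Finset ι} {a : α → F} {b : ι → α → F} (ha : Continuous a) (hb : ∀ i, Continuous (b i)) :
    Continuous fun t => -a t + ∑ i ∈ s, b i t :=
  ha.neg.add (continuous_finsetSum _ fun i _ => hb i)

variable {N : ℕ} {Ω ω : Opens (E N)} {T : ℝ}

/-- The form `(z, w, u) ↦ ((z · ∇)u, w)` for a bounded field `w`. -/
def convMixed (Ω : Opens (E N)) : L2 Ω →L[ℝ] Lp (E N) ∞ (dom Ω) →L[ℝ] V Ω →L[ℝ] ℝ :=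
  (ContinuousLinearMap.compL ℝ (Lp (E N) ∞ (dom Ω)) (H1Pair Ω →L[ℝ] ℝ) (V Ω →L[ℝ] ℝ)
    ((ContinuousLinearMap.compL ℝ (V Ω) (H1Pair Ω) ℝ).flip (V Ω).subtypeL)).comp (convForm Ω 2 ∞)

theorem convMixed_apply (z : L2 Ω) (w : Lp (E N) ∞ (dom Ω)) (u : V Ω) :
    convMixed Ω z w u = convForm Ω 2 ∞ z w (u : H1Pair Ω) := rfl

attribute [irreducible] convMixed

/-- Bounded continuous functions are dense in `L⁴` and represent elements of `L^∞` as well. -/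
theorem exists_bounded_approx [IsFiniteMeasure (dom Ω)] (w : Lp (E N) 4 (dom Ω)) {η : ℝ}
    (hη : 0 < η) : ∃ (k : Lp (E N) 4 (dom Ω)) (g : Lp (E N) ∞ (dom Ω)),
      (∀ᵐ x ∂(dom Ω), g x = k x) ∧ ‖w - k‖ ≤ η := by
  obtain ⟨k, hk⟩ := (BoundedContinuousFunction.toLp_denseRange (p := 4) (E N) (dom Ω) ℝ
    (by norm_num)).exists_dist_lt w hη
  refine ⟨_, BoundedContinuousFunction.toLp ∞ (dom Ω) ℝ k, ?_, (dist_eq_norm w _ ▸ hk).le⟩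
  filter_upwards [BoundedContinuousFunction.coeFn_toLp ∞ (dom Ω) ℝ k,
    BoundedContinuousFunction.coeFn_toLp 4 (dom Ω) ℝ k] with x h1 h2
  rw [h1, h2]

theorem convMixed_eq [HasL4Embedding Ω] {k : Lp (E N) 4 (dom Ω)} {g : Lp (E N) ∞ (dom Ω)}
    (hgk : ∀ᵐ x ∂(dom Ω), g x = k x) (Z Y : V Ω) :
    convMixed Ω (V.field Z) g Y = convForm Ω 4 4 (VtoL4 Z) k Y := by
  refine (convMixed_apply _ _ _).trans (convForm_congr ?_ hgk _)
  rw [VtoL4_apply]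
  filter_upwards [coeFn_toL4 (toH10 Z)] with x hx
  rw [hx]
  rfl

theorem abs_convV_sub_le [HasL4Embedding Ω] (w : V Ω) {δ : ℝ} (hδ : 0 < δ)
    {k : Lp (E N) 4 (dom Ω)} {g : Lp (E N) ∞ (dom Ω)} (hgk : ∀ᵐ x ∂(dom Ω), g x = k x)
    (hk : ‖VtoL4 w - k‖ ≤ δ / (‖convForm Ω 4 4‖ * ‖VtoL4 (Ω := Ω)‖ + 1)) (Z Y : V Ω) :
    |convV Ω Z Y w - convMixed Ω (V.field Z) g Y| ≤ δ * (‖Z‖ * ‖Y‖) :=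
  (congrArg abs (congrArg₂ (· - ·) (convV_apply Z Y w) (convMixed_eq hgk Z Y))).trans_le
    (abs_trilinear_sub_le (convForm Ω 4 4) VtoL4 hδ hk Z Y)

/-- For `w` in `L⁴` the convection term is controlled only by `‖Z‖ ‖Y‖`, which is merely integrable
in time; for bounded `g` it is controlled by the `L²` norm of the transport field times `‖Y‖`.
Replacing `w` by `g` gives the bad product a small coefficient. -/
theorem exists_convV_approx [IsFiniteMeasure (dom Ω)] [HasL4Embedding Ω] (w : V Ω) {δ : ℝ}
    (hδ : 0 < δ) : ∃ g : Lp (E N) ∞ (dom Ω), ∀ Z Y : V Ω,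
      |convV Ω Z Y w - convMixed Ω (V.field Z) g Y| ≤ δ * (‖Z‖ * ‖Y‖) :=
  have hc0 : 0 < ‖convForm Ω 4 4‖ * ‖VtoL4 (Ω := Ω)‖ + 1 :=
    add_pos_of_nonneg_of_pos (mul_nonneg (norm_nonneg _) (norm_nonneg _)) one_pos
  (exists_bounded_approx (VtoL4 w) (div_pos hδ hc0)).elim fun _ h => h.elim fun g h =>
    ⟨g, abs_convV_sub_le w hδ h.1 h.2⟩

theorem norm_field_le (u : V Ω) : ‖V.field u‖ ≤ ‖u‖ := norm_fst_le u.1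

theorem norm_partialDeriv_le (u : V Ω) (i : Fin N) : ‖V.partialDeriv u i‖ ≤ ‖u‖ :=
  norm_snd_le u.1 i

/-- The field `x ↦ φ (t, x) e_j`. -/
def testBCF (j : Fin N) (φ : 𝓓(cylinder T Ω, ℝ)) (t : ℝ) : BoundedContinuousFunction (E N) (E N) :=
  BoundedContinuousFunction.ofNormedAddCommGroup (fun x => φ (t, x) • (e j : E N))
    (((φ.contDiff.continuous).comp (by fun_prop : Continuous fun x : E N => (t, x))).smul
      continuous_const)
    (φ.hasCompactSupport.exists_bound_of_continuous φ.contDiff.continuous).choose fun x => by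
      rw [norm_smul, PiLp.norm_single, norm_one, mul_one]
      exact (φ.hasCompactSupport.exists_bound_of_continuous φ.contDiff.continuous).choose_spec _

theorem testBCF_apply (j : Fin N) (φ : 𝓓(cylinder T Ω, ℝ)) (t : ℝ) (x : E N) :
    testBCF j φ t x = φ (t, x) • (e j : E N) := rfl

theorem norm_testBCF_le (j : Fin N) {φ : 𝓓(cylinder T Ω, ℝ)} {M : ℝ} (hM : ∀ z, ‖φ z‖ ≤ M)
    (t : ℝ) : ‖testBCF j φ t‖ ≤ M := by
  refine (BoundedContinuousFunction.norm_le ((norm_nonneg _).trans (hM 0))).2 fun x => ?_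
  rw [testBCF_apply, norm_smul, PiLp.norm_single, norm_one, mul_one]
  exact hM _

theorem continuous_testBCF (j : Fin N) (φ : 𝓓(cylinder T Ω, ℝ)) : Continuous (testBCF j φ) := by
  have hu := φ.hasCompactSupport.uniformContinuous_of_continuous φ.contDiff.continuous
  refine Metric.continuous_iff.2 fun t ε hε => ?_
  obtain ⟨δ, hδ, h⟩ := Metric.uniformContinuous_iff.1 hu (ε / 2) (by positivity)
  refine ⟨δ, hδ, fun s hs => lt_of_le_of_lt ?_ (half_lt_self hε)⟩
  refine (BoundedContinuousFunction.dist_le (by positivity)).2 fun x => ?_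
  have h1 : dist (s, x) (t, x) < δ := by
    rw [Prod.dist_eq, dist_self]
    exact max_lt hs hδ
  rw [testBCF_apply, testBCF_apply, dist_eq_norm, ← sub_smul, norm_smul,
    PiLp.norm_single, norm_one, mul_one, ← dist_eq_norm]
  exact (h h1).le

theorem integrable_conv_test (j : Fin N) (φ : 𝓓(cylinder T Ω, ℝ)) (t : ℝ) (z : L2 Ω) (Y : V Ω) :
    Integrable (fun x => (∑ i, z x i * V.partialDeriv Y i x j) * φ (t, x)) (dom Ω) := by
  have hc : Continuous fun x : E N => φ (t, x) :=
    φ.contDiff.continuous.comp (by fun_prop : Continuous fun x : E N => (t, x))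
  obtain ⟨c, hb⟩ := φ.hasCompactSupport.exists_bound_of_continuous φ.contDiff.continuous
  have hcoord : ∀ (u : L2 Ω) (i : Fin N), MemLp (fun x => u x i) 2 (dom Ω) := fun u i =>
    (EuclideanSpace.proj (𝕜 := ℝ) i : E N →L[ℝ] ℝ).comp_memLp' (Lp.memLp u)
  refine Integrable.mul_bdd (integrable_finsetSum _ fun i _ => ?_) hc.aestronglyMeasurable
    (Eventually.of_forall fun x => hb _)
  exact (hcoord z i).integrable_mul (hcoord (V.partialDeriv Y i) j) (p := 2) (q := 2)

variable [IsFiniteMeasure (dom Ω)]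

/-- The field `x ↦ φ (t, x) e_j` as an element of `Lᵖ`. -/
def testLp (p : ℝ≥0∞) [Fact (1 ≤ p)] (j : Fin N) (φ : 𝓓(cylinder T Ω, ℝ)) (t : ℝ) :
    Lp (E N) p (dom Ω) :=
  BoundedContinuousFunction.toLp p (dom Ω) ℝ (testBCF j φ t)

variable {p : ℝ≥0∞} [Fact (1 ≤ p)]

theorem coeFn_testLp (j : Fin N) (φ : 𝓓(cylinder T Ω, ℝ)) (t : ℝ) :
    ∀ᵐ x ∂(dom Ω), testLp p j φ t x = φ (t, x) • (e j : E N) :=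
  BoundedContinuousFunction.coeFn_toLp p (dom Ω) ℝ (testBCF j φ t)

theorem continuous_testLp (j : Fin N) (φ : 𝓓(cylinder T Ω, ℝ)) : Continuous (testLp p j φ) :=
  (BoundedContinuousFunction.toLp p (dom Ω) ℝ).continuous.comp (continuous_testBCF j φ)

theorem norm_testLp_le (j : Fin N) {φ : 𝓓(cylinder T Ω, ℝ)} {M : ℝ} (hM : ∀ z, ‖φ z‖ ≤ M)
    (t : ℝ) : ‖testLp p j φ t‖
      ≤ ‖(BoundedContinuousFunction.toLp p (dom Ω) ℝ :
        BoundedContinuousFunction (E N) (E N) →L[ℝ] _)‖ * M :=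
  ((BoundedContinuousFunction.toLp p (dom Ω) ℝ).le_opNorm _).trans
    (mul_le_mul_of_nonneg_left (norm_testBCF_le j hM t) (norm_nonneg _))

theorem inner_smul_single (c : ℝ) (j : Fin N) (u : E N) : ⟪c • (e j : E N), u⟫_ℝ = u j * c := by
  rw [real_inner_smul_left, EuclideanSpace.inner_single_left]
  simp [mul_comm]

theorem inner_testLp (j : Fin N) (φ : 𝓓(cylinder T Ω, ℝ)) (t : ℝ) (u : L2 Ω) :
    ⟪testLp 2 j φ t, u⟫_ℝ = ∫ x in (Ω : Set (E N)), u x j * φ (t, x) := by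
  rw [L2.inner_def]
  refine integral_congr_ae ?_
  filter_upwards [coeFn_testLp (p := 2) j φ t] with x hx
  rw [hx, inner_smul_single]

theorem integrable_mul_test (j : Fin N) (φ : 𝓓(cylinder T Ω, ℝ)) (t : ℝ) (u : L2 Ω) :
    Integrable (fun x => u x j * φ (t, x)) (dom Ω) := by
  refine (L2.integrable_inner (𝕜 := ℝ) (testLp 2 j φ t) u).congr ?_
  filter_upwards [coeFn_testLp (p := 2) j φ t] with x hx
  rw [hx, inner_smul_single]

theorem inner_restrictL_testLp (h : ω ≤ Ω) (j : Fin N) (φ : 𝓓(cylinder T Ω, ℝ)) (t : ℝ)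
    (v : L2 ω) : ⟪v, restrictL h (testLp 2 j φ t)⟫_ℝ
      = ∫ x in (ω : Set (E N)), v x j * φ (t, x) := by
  rw [inner_restrictL]
  refine integral_congr_ae ?_
  filter_upwards [(coeFn_testLp (p := 2) j φ t).filter_mono (ae_mono (dom_mono h))] with x hx
  rw [hx, real_inner_comm, inner_smul_single]

theorem convMixed_testLp (j : Fin N) (φ : 𝓓(cylinder T Ω, ℝ)) (t : ℝ) (z : L2 Ω) (Y : V Ω) :
    convMixed Ω z (testLp ∞ j φ t) Y
      = ∫ x in (Ω : Set (E N)), (∑ i, z x i * V.partialDeriv Y i x j) * φ (t, x) := by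
  refine (convMixed_apply _ _ _).trans ((convForm_eq_integral (Eventually.of_forall fun x => rfl)
    (coeFn_testLp j φ t) fun i => Eventually.of_forall fun x => rfl).trans ?_)
  refine integral_congr_ae (Eventually.of_forall fun x => ?_)
  simp only
  rw [Finset.sum_mul]
  refine Finset.sum_congr rfl fun i _ => ?_
  rw [real_inner_comm, inner_smul_single, mul_assoc]
  rfl

/-- The linear part of the momentum equation, tested with `φ e_j` at time `t`. -/
def testFunctional (j : Fin N) (φ : 𝓓(cylinder T Ω, ℝ)) (t : ℝ) : V Ω →L[ℝ] ℝ :=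
  -pairL (fieldL (Ω := Ω)) (testLp 2 j (∂_{((1 : ℝ), (0 : E N))} φ) t)
    + ∑ i, pairL (partialL (Ω := Ω) i) (testLp 2 j (∂_{((0 : ℝ), (e i : E N))} φ) t)

theorem testFunctional_apply (j : Fin N) (φ : 𝓓(cylinder T Ω, ℝ)) (t : ℝ) (Y : V Ω) :
    testFunctional j φ t Y = -⟪testLp 2 j (∂_{((1 : ℝ), (0 : E N))} φ) t, V.field Y⟫_ℝ
      + ∑ i, ⟪testLp 2 j (∂_{((0 : ℝ), (e i : E N))} φ) t, V.partialDeriv Y i⟫_ℝ :=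
  neg_add_sum_apply Finset.univ (pairL (fieldL (Ω := Ω)) _) (fun i => pairL (partialL (Ω := Ω) i) _) Y

theorem continuous_testFunctional (j : Fin N) (φ : 𝓓(cylinder T Ω, ℝ)) :
    Continuous (testFunctional j φ) := by
  have h1 : Continuous fun t => pairL (fieldL (Ω := Ω))
      (testLp 2 j (∂_{((1 : ℝ), (0 : E N))} φ) t) :=
    (pairL (fieldL (Ω := Ω))).continuous.comp (continuous_testLp _ _)
  have h2 : ∀ i : Fin N, Continuous fun t => pairL (partialL (Ω := Ω) i)
      (testLp 2 j (∂_{((0 : ℝ), (e i : E N))} φ) t) := fun i =>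
    (pairL (partialL (Ω := Ω) i)).continuous.comp (continuous_testLp _ _)
  exact Continuous.neg_add_sum (s := Finset.univ) h1 h2

attribute [irreducible] testFunctional

theorem integral_momentum_test (j : Fin N) (φ : 𝓓(cylinder T Ω, ℝ)) (t : ℝ) (z : L2 Ω) (Y : V Ω) :
    ∫ x in (Ω : Set (E N)), (-(V.field Y x j * (∂_{((1 : ℝ), (0 : E N))} φ) (t, x))
        + ∑ i, V.partialDeriv Y i x j * (∂_{((0 : ℝ), (e i : E N))} φ) (t, x)
        + (∑ i, z x i * V.partialDeriv Y i x j) * φ (t, x))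
      = testFunctional j φ t Y + convMixed Ω z (testLp ∞ j φ t) Y := by
  have h1 : Integrable (fun x => -(V.field Y x j * (∂_{((1 : ℝ), (0 : E N))} φ) (t, x))) (dom Ω) :=
    (integrable_mul_test j _ t (V.field Y)).neg
  have h2 : Integrable (fun x => ∑ i, V.partialDeriv Y i x j *
      (∂_{((0 : ℝ), (e i : E N))} φ) (t, x)) (dom Ω) :=
    integrable_finsetSum _ fun i _ => integrable_mul_test j _ t (V.partialDeriv Y i)
  have h3 := integral_add (h1.add h2) (integrable_conv_test j φ t z Y)
  simp only [Pi.add_apply] at h3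
  refine h3.trans (congrArg₂ (· + ·) (Eq.trans ?_ (testFunctional_apply j φ t Y).symm)
    (convMixed_testLp j φ t z Y).symm)
  rw [integral_add h1 h2, integral_neg,
    integral_finsetSum _ fun i _ => integrable_mul_test j _ t (V.partialDeriv Y i)]
  simp_rw [inner_testLp]

theorem norm_testFunctional_le (j : Fin N) {φ : 𝓓(cylinder T Ω, ℝ)} {M : ℝ} (hφ : C1Le φ M)
    (t : ℝ) (Y : V Ω) : |testFunctional j φ t Y|
      ≤ M * (‖(BoundedContinuousFunction.toLp 2 (dom Ω) ℝ :
        BoundedContinuousFunction (E N) (E N) →L[ℝ] _)‖ * (N + 1) * ‖Y‖) := by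
  have hv : ∀ v : ℝ × E N, ‖v‖ ≤ 1 → ∀ z, ‖(∂_{v} φ) z‖ ≤ M := fun v hv z => by
    rw [lineDerivOp_apply_eq_fderiv]
    refine ((fderiv ℝ φ z).le_opNorm v).trans ?_
    have := mul_le_mul (hφ.2 z).2 hv (norm_nonneg _) hφ.nonneg
    rwa [mul_one] at this
  rw [testFunctional_apply]
  exact abs_neg_add_sum_le
    ((abs_real_inner_le_norm _ _).trans (mul_le_mul (norm_testLp_le j (hv _ (by simp)) t)
      (norm_field_le Y) (norm_nonneg _) (mul_nonneg (norm_nonneg _) hφ.nonneg)))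
    fun i => (abs_real_inner_le_norm _ _).trans (mul_le_mul (norm_testLp_le j (hv _ (by simp)) t)
      (norm_partialDeriv_le Y i) (norm_nonneg _) (mul_nonneg (norm_nonneg _) hφ.nonneg))

end Tests

end LerayAlpha

end

noncomputable section

namespace LerayAlpha

set_option maxSynthPendingDepth 3

/-! ### Passage to the limit in the momentum equation -/

section Generic

variable {X A B : Type*} [NormedAddCommGroup X] [NormedSpace ℝ X] [NormedAddCommGroup A]
  [NormedSpace ℝ A] [NormedAddCommGroup B] [NormedSpace ℝ B]

theorem abs_bilin_le (b : X →L[ℝ] X →L[ℝ] ℝ) (x y : X) : |b x y| ≤ ‖b‖ * ‖x‖ * ‖y‖ :=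
  b.le_opNorm₂ x y

theorem abs_trilin_le (b : A →L[ℝ] B →L[ℝ] X →L[ℝ] ℝ) {z : A} {M : ℝ} (hz : ‖z‖ ≤ M) (w : B)
    (y : X) : |b z w y| ≤ ‖b‖ * M * ‖w‖ * ‖y‖ := by
  refine ((b z w).le_opNorm y).trans (mul_le_mul_of_nonneg_right ?_ (norm_nonneg _))
  refine (b.le_opNorm₂ z w).trans ?_
  gcongr

theorem addBilin_apply (b : A →L[ℝ] B →L[ℝ] X →L[ℝ] ℝ) (ℓ : X →L[ℝ] ℝ) (z : A) (w : B) (y : X) :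
    addBilin b ℓ z w y = ℓ y + b z w y := rfl

theorem addBilin_smul_apply (b : A →L[ℝ] B →L[ℝ] X →L[ℝ] ℝ) (ℓ : X →L[ℝ] ℝ) (z : A) (c : ℝ)
    (w : B) (y : X) : addBilin b ℓ z (c • w) y = ℓ y + c * b z w y := by
  rw [addBilin_apply, map_smul, smul_apply, smul_eq_mul]

theorem neg_smul_add_smul_apply (a b : ℝ) (ℓ m : X →L[ℝ] ℝ) (y : X) :
    (-(a • ℓ) + b • m) y = -(a * ℓ y) + b * m y := by
  rw [add_apply, neg_apply, smul_apply, smul_apply, smul_eq_mul, smul_eq_mul]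

theorem Continuous.neg_smul_add_smul {a b : ℝ → ℝ} (ha : Continuous a) (hb : Continuous b)
    (ℓ m : X) : Continuous fun t => -(a t • ℓ) + b t • m :=
  (ha.smul continuous_const).neg.add (hb.smul continuous_const)

theorem Continuous.memLp_timeMeasure {X : Type*} [NormedAddCommGroup X] {f : ℝ → X} (hf : Continuous f) (T : ℝ) :
    MemLp f 2 (timeMeasure T) := by
  obtain ⟨c, hc⟩ := (isCompact_Icc (a := 0) (b := T)).exists_bound_of_continuousOn hf.continuousOn
  refine MemLp.of_bound (hf.continuousOn.aestronglyMeasurable measurableSet_Ioo) c ?_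
  exact (ae_restrict_mem measurableSet_Ioo).mono fun t ht => hc t (Ioo_subset_Icc_self ht)

theorem ae_bound_of_continuous {X : Type*} [NormedAddCommGroup X] {f : ℝ → X} (hf : Continuous f) (T : ℝ) :
    ∃ c, ∀ᵐ t ∂(timeMeasure T), ‖f t‖ ≤ c := by
  obtain ⟨c, hc⟩ := (isCompact_Icc (a := 0) (b := T)).exists_bound_of_continuousOn hf.continuousOn
  exact ⟨c, (ae_restrict_mem measurableSet_Ioo).mono fun t ht => hc t (Ioo_subset_Icc_self ht)⟩

theorem aestronglyMeasurable_bilin_apply {μ : Measure ℝ} (b : A →L[ℝ] B →L[ℝ] X →L[ℝ] ℝ)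
    {f : ℝ → A} {g : ℝ → B} {Y : ℝ → X} (hf : AEStronglyMeasurable f μ)
    (hg : AEStronglyMeasurable g μ) (hY : AEStronglyMeasurable Y μ) :
    AEStronglyMeasurable (fun t => b (f t) (g t) (Y t)) μ :=
  aestronglyMeasurable_bilin (ContinuousLinearMap.id ℝ (X →L[ℝ] ℝ))
    (aestronglyMeasurable_bilin b hf hg) hY

theorem memLp_addBilin (b : A →L[ℝ] B →L[ℝ] X →L[ℝ] ℝ) {T : ℝ} {ℓ : ℝ → X →L[ℝ] ℝ}
    (hℓ : Continuous ℓ) {z : ℝ → A} (hz : MemLp z 2 (timeMeasure T)) {W : ℝ → B}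
    (hW : Continuous W) : MemLp (fun t => addBilin b (ℓ t) (z t) (W t)) 2 (timeMeasure T) := by
  obtain ⟨c, hc⟩ := ae_bound_of_continuous hW T
  exact (Continuous.memLp_timeMeasure hℓ T).add
    (memLp_bilin_of_bound_right b hz hW.aestronglyMeasurable hc)

theorem abs_integral_sub_le {μ : Measure ℝ} {f F r k : ℝ → ℝ} {c : ℝ} (hF : Integrable F μ)
    (hr : AEStronglyMeasurable r μ) (hk : Integrable k μ) (hrk : ∀ᵐ t ∂μ, ‖r t‖ ≤ c * k t)
    (h : ∀ᵐ t ∂μ, f t = F t + r t) : |(∫ t, f t ∂μ) - ∫ t, F t ∂μ| ≤ c * ∫ t, k t ∂μ := by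
  have hri : Integrable r μ := (hk.const_mul c).mono' hr hrk
  rw [integral_congr_ae h, integral_add hF hri, add_sub_cancel_left, ← integral_const_mul]
  exact norm_integral_le_of_norm_le (hk.const_mul c) hrk

theorem weak_arith {d i i' ψ γ γ' κ b m : ℝ} (hi : i' = i) (hγ : γ' = γ) (hb : b = κ) :
    -(d * i) + ψ * (γ + κ) = -(d * i') + ψ * γ' + ψ * m + ψ * (b - m) := by
  rw [hi, hγ, hb]
  ring

theorem norm_mul_le_of_le {a r c δ p q : ℝ} (ha : ‖a‖ ≤ c) (hδ : 0 ≤ δ) (hp : 0 ≤ p)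
    (hpq : p ≤ q) (hr : |r| ≤ δ * (p * q)) : ‖a * r‖ ≤ c * δ * q ^ 2 := by
  have hq := hp.trans hpq
  rw [norm_mul, mul_assoc, sq]
  exact mul_le_mul ha (hr.trans (by gcongr)) (norm_nonneg _) ((norm_nonneg _).trans ha)

/-- Young's inequality: half of `δ y²` pays for the approximation error, the other half for the
terms linear in `y`. -/
theorem momentum_arith {G D δ a g c W y x1 x2 x3 : ℝ} (hδ : 0 < δ) (h1 : |x1| ≤ G * y * W)
    (h2 : |x2 - g| ≤ δ / 2 * (y * y)) (h3 : |g| ≤ a * y) (h4 : |x3| ≤ c)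
    (hD : D = (G * W + a) ^ 2 / (2 * δ) + c) : |-x1 - x2 + x3| ≤ D + δ * y ^ 2 := by
  have h5 : (G * W + a) * y ≤ (G * W + a) ^ 2 / (2 * δ) + δ / 2 * y ^ 2 := by
    have : (G * W + a) ^ 2 / (2 * δ) + δ / 2 * y ^ 2 - (G * W + a) * y
        = (G * W + a - δ * y) ^ 2 / (2 * δ) := by
      field_simp
      ring
    have h6 : 0 ≤ (G * W + a - δ * y) ^ 2 / (2 * δ) := by positivity
    linarith
  rw [abs_le] at *
  constructor <;> nlinarith

end Generic

section Momentum

variable {N : ℕ} {Ω ω : Opens (E N)} {T : ℝ}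

/-- The linear part of the momentum equation in `V'`, tested with `ψ w`. -/
def weakFunctional (ψ : ℝ → ℝ) (w : V Ω) (t : ℝ) : V Ω →L[ℝ] ℝ :=
  -(deriv ψ t • pairL (fieldL (Ω := Ω)) (V.field w)) + ψ t • gradForm (Ω := Ω) w

theorem weakFunctional_apply (ψ : ℝ → ℝ) (w : V Ω) (t : ℝ) (Y : V Ω) :
    weakFunctional ψ w t Y = -(deriv ψ t * ⟪V.field w, V.field Y⟫_ℝ) + ψ t * V.gradInner w Y :=
  (neg_smul_add_smul_apply _ _ _ _ Y).trans
    (congrArg (fun r => -(deriv ψ t * ⟪V.field w, V.field Y⟫_ℝ) + ψ t * r) (gradForm_apply w Y))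

theorem continuous_weakFunctional {ψ : ℝ → ℝ} (hψ : ContDiff ℝ (⊤ : ℕ∞) ψ) (w : V Ω) :
    Continuous (weakFunctional ψ w) :=
  Continuous.neg_smul_add_smul (hψ.continuous_deriv (by simp)) hψ.continuous
    (pairL (fieldL (Ω := Ω)) (V.field w)) (gradForm w)

attribute [irreducible] weakFunctional

/-- The momentum equation in `V'` tested with `ψ w`, where `w` is replaced by the bounded field `g`
in the convection term. -/
def weakTest (ψ : ℝ → ℝ) (w : V Ω) (g : Lp (E N) ∞ (dom Ω)) (t : ℝ) (z : L2 Ω) : V Ω →L[ℝ] ℝ :=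
  addBilin (convMixed Ω) (weakFunctional ψ w t) z (ψ t • g)

theorem memLp_weakTest {z : ℝ → L2 Ω} (hz : MemLp z 2 (timeMeasure T)) (w : V Ω)
    (g : Lp (E N) ∞ (dom Ω)) {ψ : ℝ → ℝ} (hψ : ContDiff ℝ (⊤ : ℕ∞) ψ) :
    MemLp (fun t => weakTest ψ w g t (z t)) 2 (timeMeasure T) :=
  memLp_addBilin (convMixed Ω) (continuous_weakFunctional hψ w) hz
    (hψ.continuous.smul continuous_const)

variable [HasL4Embedding Ω]

theorem abs_momentumFunctional_le (h : ω ≤ Ω) {w : V Ω} {g : Lp (E N) ∞ (dom Ω)} {δ M C : ℝ}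
    (hδ : 0 < δ) (hg : ∀ Z Y : V Ω,
      |convV Ω Z Y w - convMixed Ω (V.field Z) g Y| ≤ δ / 2 * (‖Z‖ * ‖Y‖))
    {Y Z : V Ω} {v : L2 ω} (hZ : ‖Z‖ ≤ ‖Y‖) (hz : ‖V.field Z‖ ≤ M) (hv : ‖v‖ ≤ C) :
    |momentumFunctional h Y Z v w| ≤ ((‖gradForm (Ω := Ω)‖ * ‖w‖
      + ‖convMixed Ω‖ * M * ‖g‖) ^ 2 / (2 * δ) + C * ‖restrictL h (V.field w)‖)
      + δ * ‖Y‖ ^ 2 := by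
  have h1 : |V.gradInner Y w| ≤ ‖gradForm (Ω := Ω)‖ * ‖Y‖ * ‖w‖ :=
    (congrArg abs (gradForm_apply Y w)).symm.trans_le (abs_bilin_le gradForm Y w)
  have h2 : |convV Ω Z Y w - convMixed Ω (V.field Z) g Y| ≤ δ / 2 * (‖Y‖ * ‖Y‖) :=
    (hg Z Y).trans (mul_le_mul_of_nonneg_left (mul_le_mul_of_nonneg_right hZ (norm_nonneg _))
      (half_pos hδ).le)
  have h3 : |convMixed Ω (V.field Z) g Y| ≤ ‖convMixed Ω‖ * M * ‖g‖ * ‖Y‖ :=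
    abs_trilin_le (convMixed Ω) hz g Y
  have h4 : |⟪v, restrictL h (V.field w)⟫_ℝ| ≤ C * ‖restrictL h (V.field w)‖ :=
    (abs_real_inner_le_norm _ _).trans (mul_le_mul_of_nonneg_right hv (norm_nonneg _))
  exact (congrArg abs (momentumFunctional_apply h Y Z v w)).trans_le
    (momentum_arith hδ h1 h2 h3 h4 rfl)

/-- The field `g` depends on `w` and `δ` only, so the constant obtained from the uniform bounds does
not depend on `n`. -/
theorem weaklyEquicontinuous_field [IsFiniteMeasure (dom Ω)] (h : ω ≤ Ω) {M C R : ℝ} {α : ℕ → ℝ}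
    {v : ℕ → Control T ω} {y z : ℕ → ℝ → L2 Ω} {Y Z : ℕ → ℝ → V Ω} (hv : ∀ n, ‖v n‖ ≤ C)
    (hb : ∀ n, LerayBounds h T (α n) M (v n) (y n) (z n) (Y n) (Z n))
    (hR : ∀ n, ∫ t in Ioo 0 T, ‖Y n t‖ ^ 2 ≤ R) (w : V Ω) :
    WeaklyEquicontinuous T y (V.field w) := by
  refine weaklyEquicontinuous_of_integral (fun n => (hb n).hy.1) hR
    (f := fun n τ => momentumFunctional h (Y n τ) (Z n τ) (v n τ) w)
    (fun n s hs t ht => (hb n).weak w s hs t ht) fun δ hδ => ?_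
  obtain ⟨g, hg⟩ := exists_convV_approx w (half_pos hδ)
  refine ⟨(‖gradForm (Ω := Ω)‖ * ‖w‖ + ‖convMixed Ω‖ * M * ‖g‖) ^ 2 / (2 * δ)
    + C * ‖restrictL h (V.field w)‖, fun n => ?_⟩
  filter_upwards [(hb n).norm_le, (hb n).transport_le, (hb n).hz.2, ae_norm_control_le (hv n)]
    with t h1 h2 h3 h4
  exact abs_momentumFunctional_le h hδ hg h1 (h3 ▸ h2) h4

/-- The error made in replacing `w` by `g` in the convection term. -/
def convError (w : V Ω) (g : Lp (E N) ∞ (dom Ω)) (Z Y : V Ω) : ℝ :=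
  convV Ω Z Y w - convMixed Ω (V.field Z) g Y

theorem aestronglyMeasurable_convError {Y Z : ℝ → V Ω} {μ : Measure ℝ}
    (hY : AEStronglyMeasurable Y μ) (hZ : AEStronglyMeasurable Z μ) (w : V Ω)
    (g : Lp (E N) ∞ (dom Ω)) : AEStronglyMeasurable (fun t => convError w g (Z t) (Y t)) μ :=
  (aestronglyMeasurable_bilin_apply (convV Ω) hZ hY aestronglyMeasurable_const).sub
    (aestronglyMeasurable_bilin_apply (convMixed Ω)
      ((fieldL (Ω := Ω)).continuous.comp_aestronglyMeasurable hZ) aestronglyMeasurable_const hY)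

theorem weakTest_apply (ψ : ℝ → ℝ) (w Y Z : V Ω) (g : Lp (E N) ∞ (dom Ω)) (t : ℝ) :
    -(deriv ψ t * ⟪V.field Y, V.field w⟫_ℝ)
        + ψ t * (V.gradInner Y w + convection (V.field Z) Y w)
      = weakTest ψ w g t (V.field Z) Y + ψ t * convError w g Z Y := by
  refine Eq.trans ?_ (congrArg (· + ψ t * convError w g Z Y)
    ((addBilin_smul_apply (convMixed Ω) (weakFunctional ψ w t) (V.field Z) (ψ t) g Y).trans
      (congrArg (· + ψ t * convMixed Ω (V.field Z) g Y) (weakFunctional_apply ψ w t Y))).symm)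
  exact weak_arith (real_inner_comm _ _) (Finset.sum_congr rfl fun i _ => real_inner_comm _ _)
    (convV_eq Z Y w)

theorem exists_convError_le [IsFiniteMeasure (dom Ω)] (w : V Ω) {δ : ℝ} (hδ : 0 < δ) :
    ∃ g : Lp (E N) ∞ (dom Ω), ∀ Z Y : V Ω, |convError w g Z Y| ≤ δ * (‖Z‖ * ‖Y‖) :=
  exists_convV_approx w hδ

attribute [irreducible] convError

/-- Stated for an arbitrary transport field so as to apply both to the sequence and to the limit,
where `z = y`. -/
theorem momentum_split {y z : ℝ → L2 Ω} {Y Z : ℝ → V Ω} (hY : IsL2V T y Y) (hZ : IsL2V T z Z)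
    (hZY : ∀ᵐ t ∂(timeMeasure T), ‖Z t‖ ≤ ‖Y t‖) {w : V Ω} {g : Lp (E N) ∞ (dom Ω)} {δ c : ℝ}
    (hδ : 0 ≤ δ) (hg : ∀ Z Y : V Ω, |convError w g Z Y| ≤ δ * (‖Z‖ * ‖Y‖))
    {ψ : ℝ → ℝ} (hψ : ContDiff ℝ (⊤ : ℕ∞) ψ) (hc : ∀ t, ‖ψ t‖ ≤ c) :
    |(∫ t in Ioo 0 T, (-(deriv ψ t * ⟪y t, V.field w⟫_ℝ)
        + ψ t * (V.gradInner (Y t) w + convection (z t) (Y t) w)))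
      - ∫ t in Ioo 0 T, weakTest ψ w g t (z t) (Y t)|
      ≤ c * δ * ∫ t in Ioo 0 T, ‖Y t‖ ^ 2 := by
  have hz2 : MemLp z 2 (timeMeasure T) :=
    ((fieldL (Ω := Ω)).comp_memLp' hZ.1).ae_eq hZ.2
  refine abs_integral_sub_le (integrable_clm_apply (memLp_weakTest hz2 w g hψ) hY.1)
    (hψ.continuous.aestronglyMeasurable.mul (aestronglyMeasurable_convError hY.1.1 hZ.1.1 w g))
    (integrable_norm_sq hY.1) ?_ ?_
  · filter_upwards [hZY] with t ht
    exact norm_mul_le_of_le (hc t) hδ (norm_nonneg _) ht (hg (Z t) (Y t))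
  · filter_upwards [hY.2, hZ.2] with t h1 h2
    rw [← h1, ← h2]
    exact weakTest_apply ψ w (Y t) (Z t) g t

end Momentum

end LerayAlpha

end

noncomputable section

namespace LerayAlpha

set_option maxSynthPendingDepth 3

theorem testForm_arith {a b M c k m r y w : ℝ} (h1 : |a| ≤ M * (c * y)) (h2 : |b| ≤ m * r * w * y)
    (h3 : w ≤ k * M) (hm : 0 ≤ m) (hr : 0 ≤ r) (hy : 0 ≤ y) :
    |a + b| ≤ M * (c * y + m * k * (r * y)) := by
  have h4 : m * r * w * y ≤ m * r * (k * M) * y := by gcongr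
  refine (abs_add_le _ _).trans ((add_le_add h1 (h2.trans h4)).trans (le_of_eq ?_))
  ring

section Limit

variable {N : ℕ} {Ω ω : Opens (E N)} {T : ℝ}

/-- The convergences that allow to pass to the limit in the momentum equation. -/
structure MomentumLimit (T R : ℝ) (v : ℕ → Control T ω) (y z : ℕ → ℝ → L2 Ω) (Y Z : ℕ → ℝ → V Ω)
    (v' : Control T ω) (y' : ℝ → L2 Ω) (Y' : ℝ → V Ω) : Prop where
  isL2V_y : ∀ n, IsL2V T (y n) (Y n)
  isL2V_z : ∀ n, IsL2V T (z n) (Z n)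
  norm_le : ∀ n, ∀ᵐ t ∂(timeMeasure T), ‖Z n t‖ ≤ ‖Y n t‖
  eLpNorm_le : ∀ n, eLpNorm (Y n) 2 (timeMeasure T) ≤ ENNReal.ofReal R
  isL2V_limit : IsL2V T y' Y'
  weak_Y : WeakTendsto (timeMeasure T) Y Y'
  weak_v : WeakTendsto (timeMeasure T) (fun n t => v n t) (fun t => v' t)
  tendsto_z : TendstoL2 T z y'

theorem IsL2V.memLp {y : ℝ → L2 Ω} {Y : ℝ → V Ω} (h : IsL2V T y Y) : MemLp y 2 (timeMeasure T) :=
  ((fieldL (Ω := Ω)).comp_memLp' h.1).ae_eq h.2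

theorem integral_norm_sq_le {X : Type*} [NormedAddCommGroup X] {Y : ℝ → X} {R : ℝ}
    (hY : MemLp Y 2 (timeMeasure T)) (hR : eLpNorm Y 2 (timeMeasure T) ≤ ENNReal.ofReal R)
    (hR0 : 0 ≤ R) : ∫ t in Ioo 0 T, ‖Y t‖ ^ 2 ≤ R ^ 2 := by
  rw [← sq_eLpNorm_toReal_eq hY]
  exact pow_le_pow_left₀ ENNReal.toReal_nonneg (ENNReal.toReal_le_of_le_ofReal hR0 hR) 2

variable {R : ℝ} {v : ℕ → Control T ω} {y z : ℕ → ℝ → L2 Ω} {Y Z : ℕ → ℝ → V Ω}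
  {v' : Control T ω} {y' : ℝ → L2 Ω} {Y' : ℝ → V Ω}

theorem MomentumLimit.tendsto_functional (L : MomentumLimit T R v y z Y Z v' y' Y')
    {B : Type*} [NormedAddCommGroup B] [NormedSpace ℝ B] (b : L2 Ω →L[ℝ] B →L[ℝ] V Ω →L[ℝ] ℝ)
    {ℓ : ℝ → V Ω →L[ℝ] ℝ} (hℓ : Continuous ℓ) {W : ℝ → B} (hW : Continuous W) :
    Tendsto (fun n => ∫ t in Ioo 0 T, addBilin b (ℓ t) (z n t) (W t) (Y n t)) atTop
      (𝓝 (∫ t in Ioo 0 T, addBilin b (ℓ t) (y' t) (W t) (Y' t))) := by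
  obtain ⟨c, hc⟩ := ae_bound_of_continuous hW T
  exact tendsto_integral_functional (z := z) (z' := y') (ℓ := ℓ) (W := W) b L.weak_Y ENNReal.ofReal_ne_top (fun n => (L.isL2V_y n).1)
    L.eLpNorm_le (fun n => (L.isL2V_z n).memLp) L.isL2V_limit.memLp L.tendsto_z
    (Continuous.memLp_timeMeasure hℓ T) hW.aestronglyMeasurable hc

theorem MomentumLimit.tendsto_control (L : MomentumLimit T R v y z Y Z v' y' Y') {ξ : ℝ → L2 ω}
    (hξ : Continuous ξ) : Tendsto (fun n => ∫ t in Ioo 0 T, ⟪v n t, ξ t⟫_ℝ) atTop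
      (𝓝 (∫ t in Ioo 0 T, ⟪v' t, ξ t⟫_ℝ)) := by
  have := L.weak_v (fun t => innerSL ℝ (ξ t))
    ((innerSL ℝ).comp_memLp' (Continuous.memLp_timeMeasure hξ T))
  simpa only [innerSL_apply_apply, real_inner_comm] using this

theorem control_weak_eq (h : ω ≤ Ω) (v : Control T ω) (w : V Ω) (ψ : ℝ → ℝ) :
    ∫ t in Ioo 0 T, ψ t * ∫ x in (ω : Set (E N)), ⟪v t x, V.field w x⟫_ℝ
      = ∫ t in Ioo 0 T, ⟪v t, ψ t • restrictL h (V.field w)⟫_ℝ := by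
  simp_rw [← inner_restrictL h, real_inner_smul_right]

/-- With `w` replaced by a bounded `g` in the convection term, strong convergence of `z n` and weak
convergence of `Y n` suffice. The replacement costs an amount that is small uniformly in `n` and in
the limit. -/
theorem MomentumLimit.weak [IsFiniteMeasure (dom Ω)] [HasL4Embedding Ω] (h : ω ≤ Ω)
    (L : MomentumLimit T R v y z Y Z v' y' Y') {p : ℕ → 𝓓'(cylinder T Ω, ℝ)}
    (hmom : ∀ n, MomentumEquation T Ω ω (y n) (Y n) (z n) (p n) (v n)) (w : V Ω) {ψ : ℝ → ℝ}
    (hψ : ContDiff ℝ (⊤ : ℕ∞) ψ) (hψc : HasCompactSupport ψ) (hψT : tsupport ψ ⊆ Ioo 0 T) :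
    ∫ t in Ioo 0 T, (-(deriv ψ t * ⟪y' t, V.field w⟫_ℝ)
        + ψ t * (V.gradInner (Y' t) w + convection (y' t) (Y' t) w))
      = ∫ t in Ioo 0 T, ψ t * ∫ x in (ω : Set (E N)), ⟪v' t x, V.field w x⟫_ℝ := by
  have h1 : Tendsto (fun n => ∫ t in Ioo 0 T, (-(deriv ψ t * ⟪y n t, V.field w⟫_ℝ)
      + ψ t * (V.gradInner (Y n t) w + convection (z n t) (Y n t) w))) atTop
      (𝓝 (∫ t in Ioo 0 T, ψ t * ∫ x in (ω : Set (E N)), ⟪v' t x, V.field w x⟫_ℝ)) := by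
    rw [control_weak_eq h]
    refine (L.tendsto_control (ξ := fun t => ψ t • restrictL h (V.field w))
      (hψ.continuous.smul continuous_const)).congr fun n => ?_
    rw [← control_weak_eq h]
    exact ((hmom n).1 w ψ hψ hψc hψT).symm
  refine tendsto_nhds_unique ?_ h1
  obtain ⟨c, hc⟩ := hψc.exists_bound_of_continuous hψ.continuous
  have hc0 : 0 ≤ c := (norm_nonneg _).trans (hc 0)
  -- `S` dominates `∫ ‖Y‖²` for every member of the sequence and for the limit, so one choice of `g`
  -- serves them all.
  set S := |R| ^ 2 + ∫ t in Ioo 0 T, ‖Y' t‖ ^ 2 with hS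
  have hi : 0 ≤ ∫ t in Ioo 0 T, ‖Y' t‖ ^ 2 := integral_nonneg fun t => by positivity
  have hS0 : 0 ≤ S := by positivity
  have hSn : ∀ n, ∫ t in Ioo 0 T, ‖Y n t‖ ^ 2 ≤ S := fun n =>
    (integral_norm_sq_le (L.isL2V_y n).1 ((L.eLpNorm_le n).trans
      (ENNReal.ofReal_le_ofReal (le_abs_self R))) (abs_nonneg R)).trans (le_add_of_nonneg_right hi)
  refine tendsto_of_approx fun ε hε => ?_
  obtain ⟨g, hg'⟩ := exists_convError_le w (show 0 < ε / (c * S + 1) by positivity)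
  have hfin : ∀ r : ℝ, r ≤ S → c * (ε / (c * S + 1)) * r ≤ ε := fun r hr => by
    calc c * (ε / (c * S + 1)) * r ≤ c * (ε / (c * S + 1)) * S :=
          mul_le_mul_of_nonneg_left hr (by positivity)
      _ = ε * (c * S / (c * S + 1)) := by ring
      _ ≤ ε * 1 := by
          refine mul_le_mul_of_nonneg_left ?_ hε.le
          rw [div_le_one (by positivity)]
          linarith
      _ = ε := mul_one ε
  refine ⟨fun n => ∫ t in Ioo 0 T, weakTest ψ w g t (z n t) (Y n t),
    ∫ t in Ioo 0 T, weakTest ψ w g t (y' t) (Y' t),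
    L.tendsto_functional (convMixed Ω) (continuous_weakFunctional hψ w)
      (hψ.continuous.smul continuous_const), fun n => ?_, ?_⟩
  · exact (momentum_split (L.isL2V_y n) (L.isL2V_z n) (L.norm_le n) (by positivity) hg' hψ hc).trans
      (hfin _ (hSn n))
  · exact (momentum_split L.isL2V_limit L.isL2V_limit (Eventually.of_forall fun t => le_rfl)
      (by positivity) hg' hψ hc).trans (hfin _ (le_add_of_nonneg_left (by positivity)))

/-! ### The pressure -/

/-- The momentum equation at time `t` tested with `φ e_j`, without the pressure and the control. -/
def testForm [IsFiniteMeasure (dom Ω)] (j : Fin N) (φ : 𝓓(cylinder T Ω, ℝ)) (t : ℝ) (z : L2 Ω) :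
    V Ω →L[ℝ] ℝ :=
  addBilin (convMixed Ω) (testFunctional j φ t) z (testLp ∞ j φ t)

/-- The momentum equation tested with `φ e_j`, without its pressure term. -/
def momentumDefect [IsFiniteMeasure (dom Ω)] (h : ω ≤ Ω) (v : Control T ω) (z : ℝ → L2 Ω)
    (Y : ℝ → V Ω) (j : Fin N) (φ : 𝓓(cylinder T Ω, ℝ)) : ℝ :=
  (∫ t in Ioo 0 T, ⟪v t, restrictL h (testLp 2 j φ t)⟫_ℝ)
    - ∫ t in Ioo 0 T, testForm j φ t (z t) (Y t)

variable [IsFiniteMeasure (dom Ω)]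

theorem testForm_apply (j : Fin N) (φ : 𝓓(cylinder T Ω, ℝ)) (t : ℝ) (z : L2 Ω) (Y : V Ω) :
    testForm j φ t z Y = testFunctional j φ t Y + convMixed Ω z (testLp ∞ j φ t) Y :=
  addBilin_apply (convMixed Ω) (testFunctional j φ t) z (testLp ∞ j φ t) Y

/-- Used in both directions: to read off the gradients of the approximate pressures, and to
recognize the equation once the limit pressure is built. -/
theorem momentum_iff_defect (h : ω ≤ Ω) (v : Control T ω) {y : ℝ → L2 Ω} (z : ℝ → L2 Ω)
    {Y : ℝ → V Ω} (hY : IsL2V T y Y) (j : Fin N) (φ : 𝓓(cylinder T Ω, ℝ)) (c : ℝ) :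
    (∫ t in Ioo 0 T, ∫ x in (Ω : Set (E N)),
        (-(y t x j * (∂_{((1 : ℝ), (0 : E N))} φ) (t, x))
          + ∑ i, V.partialDeriv (Y t) i x j * (∂_{((0 : ℝ), (e i : E N))} φ) (t, x)
          + (∑ i, z t x i * V.partialDeriv (Y t) i x j) * φ (t, x))) + c
      = (∫ t in Ioo 0 T, ∫ x in (ω : Set (E N)), v t x j * φ (t, x))
      ↔ c = momentumDefect h v z Y j φ := by
  have e1 : ∫ t in Ioo 0 T, ∫ x in (Ω : Set (E N)),
        (-(y t x j * (∂_{((1 : ℝ), (0 : E N))} φ) (t, x))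
          + ∑ i, V.partialDeriv (Y t) i x j * (∂_{((0 : ℝ), (e i : E N))} φ) (t, x)
          + (∑ i, z t x i * V.partialDeriv (Y t) i x j) * φ (t, x))
      = ∫ t in Ioo 0 T, testForm j φ t (z t) (Y t) := by
    refine integral_congr_ae ?_
    filter_upwards [hY.2] with t ht
    rw [← ht]
    exact (integral_momentum_test j φ t (z t) (Y t)).trans (testForm_apply j φ t (z t) (Y t)).symm
  have e2 : ∫ t in Ioo 0 T, ∫ x in (ω : Set (E N)), v t x j * φ (t, x)
      = ∫ t in Ioo 0 T, ⟪v t, restrictL h (testLp 2 j φ t)⟫_ℝ :=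
    integral_congr_ae (Eventually.of_forall fun t => (inner_restrictL_testLp h j φ t (v t)).symm)
  rw [e1, e2, momentumDefect, eq_sub_iff_add_eq, add_comm]

theorem norm_inner_test_le (h : ω ≤ Ω) (v : L2 ω) (j : Fin N) {φ : 𝓓(cylinder T Ω, ℝ)} {M : ℝ}
    (hφ : C1Le φ M) (t : ℝ) : ‖⟪v, restrictL h (testLp 2 j φ t)⟫_ℝ‖
      ≤ M * (‖(BoundedContinuousFunction.toLp 2 (dom Ω) ℝ :
        BoundedContinuousFunction (E N) (E N) →L[ℝ] _)‖ * ‖v‖) := by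
  refine (norm_inner_le_norm _ _).trans ((mul_le_mul_of_nonneg_left
    ((norm_restrictL_le h _).trans (norm_testLp_le (p := 2) j (fun z => (hφ.2 z).1) t))
    (norm_nonneg _)).trans (le_of_eq ?_))
  ring

theorem norm_testForm_le (j : Fin N) {φ : 𝓓(cylinder T Ω, ℝ)} {M : ℝ} (hφ : C1Le φ M) (t : ℝ)
    (z : L2 Ω) (Y : V Ω) : ‖testForm j φ t z Y‖
      ≤ M * (‖(BoundedContinuousFunction.toLp 2 (dom Ω) ℝ :
        BoundedContinuousFunction (E N) (E N) →L[ℝ] _)‖ * (N + 1) * ‖Y‖ + ‖convMixed Ω‖ *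
          ‖(BoundedContinuousFunction.toLp ∞ (dom Ω) ℝ :
            BoundedContinuousFunction (E N) (E N) →L[ℝ] _)‖ * (‖z‖ * ‖Y‖)) :=
  (congrArg abs (testForm_apply j φ t z Y)).trans_le
    (testForm_arith (norm_testFunctional_le j hφ t Y)
      (abs_trilin_le (convMixed Ω) (le_refl ‖z‖) (testLp ∞ j φ t) Y)
      (norm_testLp_le (p := ∞) j (fun z => (hφ.2 z).1) t)
      (norm_nonneg (convMixed Ω)) (norm_nonneg _) (norm_nonneg _))

theorem integral_bound {μ : Measure ℝ} {X A B : Type*} [NormedAddCommGroup X]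
    [NormedAddCommGroup A] [NormedAddCommGroup B] {Y : ℝ → X} {z : ℝ → A} {v : ℝ → B}
    [IsFiniteMeasure μ] (hY : MemLp Y 2 μ) (hz : MemLp z 2 μ) (hv : MemLp v 2 μ) {a b c : ℝ}
    (ha : 0 ≤ a) (hb : 0 ≤ b) (hc : 0 ≤ c) : ∃ C, 0 ≤ C ∧ ∀ (f g : ℝ → ℝ) (M : ℝ),
      (∀ t, ‖f t‖ ≤ M * (a * ‖v t‖)) → (∀ t, ‖g t‖ ≤ M * (b * ‖Y t‖ + c * (‖z t‖ * ‖Y t‖))) →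
      |(∫ t, f t ∂μ) - ∫ t, g t ∂μ| ≤ C * M := by
  have hk1 : Integrable (fun t => a * ‖v t‖) μ := (hv.integrable (by norm_num)).norm.const_mul a
  have hk2 : Integrable (fun t => b * ‖Y t‖ + c * (‖z t‖ * ‖Y t‖)) μ :=
    ((hY.integrable (by norm_num)).norm.const_mul _).add
      ((hz.norm.integrable_mul hY.norm (p := 2) (q := 2)).const_mul _)
  refine ⟨(∫ t, a * ‖v t‖ ∂μ) + ∫ t, (b * ‖Y t‖ + c * (‖z t‖ * ‖Y t‖)) ∂μ,
    add_nonneg (integral_nonneg fun t => by positivity)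
      (integral_nonneg fun t => by positivity), fun f g M b1 b2 => ?_⟩
  have e1 := norm_integral_le_of_norm_le (hk1.const_mul M) (Eventually.of_forall b1)
  have e2 := norm_integral_le_of_norm_le (hk2.const_mul M) (Eventually.of_forall b2)
  rw [integral_const_mul, mul_comm] at e1 e2
  rw [add_mul]
  exact (abs_sub _ _).trans (add_le_add e1 e2)

/-- The constant depends on the velocity and the control but not on `φ`, so the defect is a
distribution of order one, as `GradLim` demands. -/
theorem abs_momentumDefect_le (h : ω ≤ Ω) (v : Control T ω) {z : ℝ → L2 Ω} {Y : ℝ → V Ω}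
    (hz : MemLp z 2 (timeMeasure T)) (hY : MemLp Y 2 (timeMeasure T)) :
    ∃ C, 0 ≤ C ∧ ∀ (j : Fin N) (φ : 𝓓(cylinder T Ω, ℝ)) (M : ℝ), C1Le φ M →
      |momentumDefect h v z Y j φ| ≤ C * M :=
  (integral_bound hY hz (memLp_control v) (norm_nonneg _)
    (mul_nonneg (norm_nonneg _) (by positivity))
    (mul_nonneg (norm_nonneg (convMixed Ω)) (norm_nonneg _))).imp fun C hC =>
      ⟨hC.1, fun j φ M hφ => hC.2 _ _ M (fun t => norm_inner_test_le h (v t) j hφ t)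
        fun t => norm_testForm_le j hφ t (z t) (Y t)⟩

theorem MomentumLimit.gradLim (h : ω ≤ Ω) (L : MomentumLimit T R v y z Y Z v' y' Y')
    {p : ℕ → 𝓓'(cylinder T Ω, ℝ)}
    (hmom : ∀ n, MomentumEquation T Ω ω (y n) (Y n) (z n) (p n) (v n)) :
    ∃ C, GradLim p (momentumDefect h v' y' Y') C := by
  obtain ⟨C, hC, hb⟩ := abs_momentumDefect_le h v' L.isL2V_limit.memLp L.isL2V_limit.1
  refine ⟨C, hC, fun j φ => ⟨?_, hb j φ⟩⟩
  have h1 : ∀ n, (∂_{((0 : ℝ), (e j : E N))} (p n)) φ = momentumDefect h (v n) (z n) (Y n) j φ :=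
    fun n => (momentum_iff_defect h (v n) (z n) (L.isL2V_y n) j φ _).1 ((hmom n).2 j φ)
  simp_rw [h1]
  exact (L.tendsto_control ((restrictL h).continuous.comp (continuous_testLp j φ))).sub
    (L.tendsto_functional (convMixed Ω) (continuous_testFunctional j φ) (continuous_testLp j φ))

end Limit

end LerayAlpha

end

noncomputable section

namespace LerayAlpha

set_option maxSynthPendingDepth 3

/-! ### Extraction of a convergent subsequence -/

section Extraction

variable {N : ℕ} {Ω ω : Opens (E N)} {T : ℝ}

/-- The almost everywhere information extends to every time by continuity, tested against the
orthogonal complement. It confines `y` to the closure of `V` in `L²`, so that density of `V` in `H`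
is not needed. -/
theorem mem_closure_range_field (hT : 0 < T) {y : ℝ → L2 Ω} {Y : ℝ → V Ω}
    (hy : ContinuousOn y (Icc 0 T)) (hY : IsL2V T y Y) {t : ℝ} (ht : t ∈ Icc 0 T) :
    y t ∈ (LinearMap.range (fieldL (Ω := Ω)).toLinearMap).topologicalClosure := by
  set K := (LinearMap.range (fieldL (Ω := Ω)).toLinearMap).topologicalClosure
  have : CompleteSpace K := Submodule.isClosed_topologicalClosure _ |>.completeSpace_coe
  rw [← K.orthogonal_orthogonal]
  refine (Submodule.mem_orthogonal' _ _).2 fun u hu => ?_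
  have h1 : (fun t => ⟪y t, u⟫_ℝ) =ᵐ[volume.restrict (Icc 0 T)] fun _ => 0 := by
    rw [← restrict_Ioo_eq_restrict_Icc]
    filter_upwards [hY.2] with t ht
    rw [← ht]
    exact (Submodule.mem_orthogonal _ _).1 hu _
      (Submodule.le_topologicalClosure _ (LinearMap.mem_range_self _ (Y t)))
  exact Measure.eqOn_Icc_of_ae_eq volume hT.ne h1 (hy.inner continuousOn_const)
    continuousOn_const ht

/-- The gradient of a compactly supported smooth `q` belongs to `L²(Ω)`, so the conditions defining
`H` are weakly closed. -/
theorem mem_H_of_weak_limit {u : ℕ → L2 Ω} {u' : L2 Ω} (hu : ∀ n, u n ∈ H Ω)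
    (h : ∀ w, Tendsto (fun n => ⟪u n, w⟫_ℝ) atTop (𝓝 ⟪u', w⟫_ℝ)) : u' ∈ H Ω := by
  intro q hq hqc
  have hg : Continuous (gradient q) :=
    (InnerProductSpace.toDual ℝ (E N)).symm.continuous.comp (hq.continuous_fderiv (by simp))
  have hgc : HasCompactSupport (gradient q) :=
    (hqc.fderiv (𝕜 := ℝ)).comp_left (map_zero (InnerProductSpace.toDual ℝ (E N)).symm)
  have hm : MemLp (gradient q) 2 (dom Ω) := (hg.memLp_of_hasCompactSupport hgc).restrict _
  have key : ∀ u : L2 Ω, ⟪u, hm.toLp⟫_ℝ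
      = ∫ x in (Ω : Set (E N)), ⟪u x, gradient q x⟫_ℝ := fun u => by
    rw [L2.inner_def]
    refine integral_congr_ae ?_
    filter_upwards [hm.coeFn_toLp] with x hx
    rw [hx]
  rw [← key]
  refine tendsto_nhds_unique (h hm.toLp) ?_
  simp_rw [key, fun n => hu n q hq hqc]
  exact tendsto_const_nhds

theorem WeakTendsto.congr_ae {X : Type*} [NormedAddCommGroup X] [NormedSpace ℝ X] {μ : Measure ℝ}
    {Y : ℕ → ℝ → X} {Y' Y'' : ℝ → X} (h : WeakTendsto μ Y Y') (hY : Y' =ᵐ[μ] Y'') :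
    WeakTendsto μ Y Y'' := fun ℓ hℓ => by
  have e : ∫ t, ℓ t (Y' t) ∂μ = ∫ t, ℓ t (Y'' t) ∂μ := integral_congr_ae (hY.mono fun t ht => by
    simp only
    rw [ht])
  rw [← e]
  exact h ℓ hℓ

/-- The weak `L²` limit inherits the essential bound, hence lies in `L^∞`, and the convergence
extends from `L²` to `L¹` test functions. -/
theorem exists_control_limit {C : ℝ} (hC : 0 ≤ C) {v : ℕ → Control T ω} (hv : ∀ n, ‖v n‖ ≤ C)
    {v2 : ℝ → L2 ω} (hv2 : MemLp v2 2 (timeMeasure T))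
    (hw : WeakTendsto (timeMeasure T) (fun n t => v n t) v2) :
    ∃ v' : Control T ω, WeakTendsto (timeMeasure T) (fun n t => v n t) (fun t => v' t) ∧
      TendstoWeakStar v v' := by
  have hb := ae_norm_le_of_weak hC (fun n => memLp_control (v n)) hv2
    (fun n => ae_norm_control_le (hv n)) hw
  have hm : MemLp v2 ∞ (timeMeasure T) := memLp_top_of_bound hv2.1 C hb
  have hw' := hw.congr_ae hm.coeFn_toLp.symm
  exact ⟨hm.toLp, hw', fun g => tendsto_integral_inner_of_integrable hC
    (fun n => memLp_control (v n)) (memLp_control _) (fun n => ae_norm_control_le (hv n)) hw'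
    (Lp.memLp g)⟩

/-- A single extraction makes countably many scalar sequences converge: inner products of each
sequence with its own terms, for `Y`, for `v`, and for `y` at rational times. By
`exists_weak_limit_of_self` this suffices for weak convergence. -/
theorem exists_subseq_weak {M C : ℝ} {v : ℕ → Control T ω} {y : ℕ → ℝ → L2 Ω} {Y : ℕ → ℝ → V Ω}
    (hv : ∀ n, ‖v n‖ ≤ C) (hY : ∀ n, MemLp (Y n) 2 (timeMeasure T))
    (hYM : ∀ n, eLpNorm (Y n) 2 (timeMeasure T) ≤ ENNReal.ofReal M)
    (hy : ∀ n, ∀ t ∈ Icc 0 T, ‖y n t‖ ≤ M) :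
    ∃ k : ℕ → ℕ, StrictMono k ∧
      (∃ Y', MemLp Y' 2 (timeMeasure T) ∧ WeakTendsto (timeMeasure T) (fun n => Y (k n)) Y') ∧
      (∃ v', MemLp v' 2 (timeMeasure T) ∧
        WeakTendsto (timeMeasure T) (fun n t => v (k n) t) v') ∧
      ∀ q : ℚ, (q : ℝ) ∈ Icc 0 T → ∀ h, ∃ l, Tendsto (fun n => ⟪y (k n) q, h⟫_ℝ) atTop (𝓝 l) := by
  have hV : ∀ n, MemLp (fun t => v n t) 2 (timeMeasure T) := fun n => memLp_control (v n)
  have hVn : ∀ n, eLpNorm (fun t => v n t) 2 (timeMeasure T)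
      ≤ eLpNorm (fun _ : ℝ => C) 2 (timeMeasure T) := fun n =>
    eLpNorm_mono_ae ((ae_norm_control_le (hv n)).mono fun t ht => ht.trans (le_abs_self C))
  have hVR : eLpNorm (fun _ : ℝ => C) 2 (timeMeasure T) ≠ ∞ := (memLp_const C).2.ne
  obtain ⟨k, hk, hlim⟩ := exists_subseq_forall_tendsto (ι := ℕ ⊕ ℕ ⊕ ℚ × ℕ)
    (Sum.elim (fun m n => ⟪(hY n).toLp, (hY m).toLp⟫_ℝ)
      (Sum.elim (fun m n => ⟪(hV n).toLp, (hV m).toLp⟫_ℝ)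
        (fun qm n => if ((qm.1 : ℚ) : ℝ) ∈ Icc 0 T then ⟪y n qm.1, y qm.2 qm.1⟫_ℝ else 0))) (by
    rintro (m | m | ⟨q, m⟩)
    · exact ⟨_, fun n => abs_inner_toLp_le ENNReal.ofReal_ne_top hY hYM n m⟩
    · exact ⟨_, fun n => abs_inner_toLp_le hVR hV hVn n m⟩
    · refine ⟨M * M, fun n => ?_⟩
      simp only [Sum.elim_inr]
      split_ifs with hq
      · exact (abs_real_inner_le_norm _ _).trans (mul_le_mul (hy n _ hq) (hy m _ hq)
          (norm_nonneg _) ((norm_nonneg _).trans (hy n _ hq)))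
      · rw [abs_zero]
        exact mul_self_nonneg M)
  refine ⟨k, hk, exists_weakTendsto ENNReal.ofReal_ne_top hY hYM fun m => hlim (Sum.inl m),
    exists_weakTendsto hVR hV hVn fun m => hlim (Sum.inr (Sum.inl m)), fun q hq h => ?_⟩
  obtain ⟨y', hy'⟩ := exists_weak_limit_of_self (x := fun n => y (k n) q) (fun n => hy (k n) _ hq)
    (ξ := fun m => y m q) (fun m => by
      have := hlim (Sum.inr (Sum.inr (q, m)))
      simpa only [Sum.elim_inr, if_pos hq] using this) fun n => mem_range_self (k n)
  exact ⟨_, hy' h⟩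

theorem tendstoL2_add {y z : ℕ → ℝ → L2 Ω} {y' : ℝ → L2 Ω}
    (hy : ∀ n, MemLp (y n) 2 (timeMeasure T)) (hz : ∀ n, MemLp (z n) 2 (timeMeasure T))
    (hy' : MemLp y' 2 (timeMeasure T)) (h : TendstoL2 T y y')
    (hzy : Tendsto (fun n => eLpNorm (fun t => z n t - y n t) 2 (timeMeasure T)) atTop (𝓝 0)) :
    TendstoL2 T z y' := by
  have h1 := hzy.add h
  rw [add_zero] at h1
  refine tendsto_of_tendsto_of_tendsto_of_le_of_le tendsto_const_nhds h1 (fun _ => bot_le)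
    fun n => ?_
  have := eLpNorm_add_le ((hz n).sub (hy n)).1 ((hy n).sub hy').1 (p := 2) (by norm_num)
  refine (le_of_eq (congrArg (fun f => eLpNorm f 2 (timeMeasure T)) (funext fun t => ?_))).trans this
  simp

theorem exists_limit [IsFiniteMeasure (dom Ω)] [HasL4Embedding Ω] (h : ω ≤ Ω) (hT : 0 < T)
    {M C : ℝ} (hM : 0 ≤ M) (hC : 0 ≤ C) {α : ℕ → ℝ} (hα0 : Tendsto α atTop (𝓝 0))
    {v : ℕ → Control T ω} (hv : ∀ n, ‖v n‖ ≤ C) {y z : ℕ → ℝ → L2 Ω} {Y Z : ℕ → ℝ → V Ω}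
    (hb : ∀ n, LerayBounds h T (α n) M (v n) (y n) (z n) (Y n) (Z n)) :
    ∃ (k : ℕ → ℕ) (v' : Control T ω) (y' : ℝ → L2 Ω) (Y' : ℝ → V Ω), StrictMono k ∧
      TendstoWeakStar (fun n => v (k n)) v' ∧ TendstoL2 T (fun n => y (k n)) y' ∧
      MomentumLimit T M (fun n => v (k n)) (fun n => y (k n)) (fun n => z (k n))
        (fun n => Y (k n)) (fun n => Z (k n)) v' y' Y' ∧
      (∀ w, ContinuousOn (fun t => ⟪y' t, w⟫_ℝ) (Icc 0 T)) ∧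
      ∀ t ∈ Icc 0 T, ∀ w, Tendsto (fun n => ⟪y (k n) t, w⟫_ℝ) atTop (𝓝 ⟪y' t, w⟫_ℝ) := by
  obtain ⟨k, hk, ⟨Y', hY', hYw⟩, ⟨v2, hv2, hvw⟩, hQ⟩ := exists_subseq_weak hv
    (fun n => (hb n).hy.1) (fun n => (hb n).eLpNorm_le) (fun n => (hb n).bound)
  obtain ⟨v', hv', hstar⟩ := exists_control_limit hC (fun n => hv (k n)) hv2 hvw
  have hE : ∀ w, WeaklyEquicontinuous T (fun n => y (k n)) w :=
    weaklyEquicontinuous_of_mem (fun n => (hb (k n)).bound)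
      (K := LinearMap.range (fieldL (Ω := Ω)).toLinearMap)
      (by
        rintro _ ⟨w, rfl⟩
        exact weaklyEquicontinuous_field h (fun n => hv (k n)) (fun n => hb (k n))
          (fun n => integral_norm_sq_le (hb (k n)).hy.1 (hb (k n)).eLpNorm_le hM) w)
      fun n t ht => mem_closure_range_field hT (hb (k n)).continuousOn (hb (k n)).hy ht
  obtain ⟨y', hy'⟩ := exists_weak_limit_path hT (fun n => (hb (k n)).bound) hE hQ
  have hcont : ∀ w, ContinuousOn (fun t => ⟪y' t, w⟫_ℝ) (Icc 0 T) := fun w =>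
    continuousOn_inner_of_weak_limit (hE w) fun t ht => hy' t ht w
  -- Finiteness of the exponent gives the second countability of `L²(Ω)` required by
  -- `ae_eq_of_weakTendsto`.
  have : Fact ((2 : ℝ≥0∞) ≠ ∞) := ⟨by norm_num⟩
  have hyY' : IsL2V T y' Y' := ⟨hY', ae_eq_of_weakTendsto (fieldL (Ω := Ω))
    (fun n => (hb (k n)).hy.1) hY' hYw (fun n => (hb (k n)).hy.2) (fun n => (hb (k n)).bound)
    hcont hy'⟩
  have hyL : TendstoL2 T (fun n => y (k n)) y' := by
    refine tendsto_eLpNorm_of_compactness (fieldL (Ω := Ω)) (fun n => (hb (k n)).hy.1) hY'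
      ENNReal.ofReal_ne_top (fun n => (hb (k n)).eLpNorm_le) (fun n => (hb (k n)).hy.2) hyY'.2
      (fun n => (hb (k n)).bound) hy' fun ε hε => ?_
    obtain ⟨r, hr⟩ := exists_norm_le_add_norm_ballAverageL (Ω := Ω) hε
    exact ⟨ballAverageL Ω r, fun x => hr x.1 (toH10 x).2,
      fun u u' M hM hu => tendsto_ballAverageL r hM hu⟩
  -- The filter estimate `‖z - y‖ ≤ α ‖Y‖`, with `Y` bounded in `L²` and `α` tending to zero.
  have hzy : Tendsto (fun n => eLpNorm (fun t => z (k n) t - y (k n) t) 2 (timeMeasure T))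
      atTop (𝓝 0) := by
    have h1 : Tendsto (fun n => ENNReal.ofReal (α (k n)) * ENNReal.ofReal M) atTop (𝓝 0) := by
      have h2 := (ENNReal.continuous_ofReal.tendsto 0).comp (hα0.comp hk.tendsto_atTop)
      rw [ENNReal.ofReal_zero] at h2
      have := ENNReal.Tendsto.mul_const h2 (Or.inr (ENNReal.ofReal_ne_top (r := M)))
      rwa [zero_mul] at this
    refine tendsto_of_tendsto_of_tendsto_of_le_of_le tendsto_const_nhds h1 (fun _ => bot_le)
      fun n => ?_
    exact (eLpNorm_le_mul_eLpNorm_of_ae_le_mul (hb (k n)).norm_sub_le 2).trans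
      (mul_le_mul_right (hb (k n)).eLpNorm_le _)
  exact ⟨k, v', y', Y', hk, hstar, hyL, ⟨fun n => (hb (k n)).hy, fun n => (hb (k n)).hz,
    fun n => (hb (k n)).norm_le, fun n => (hb (k n)).eLpNorm_le, hyY', hYw, hv',
    tendstoL2_add (fun n => (hb (k n)).hy.memLp) (fun n => (hb (k n)).hz.memLp) hyY'.memLp hyL
      hzy⟩, hcont, hy'⟩

end Extraction

end LerayAlpha

end

/-! ### Conclusion: convergence to a null controlled Navier–Stokes state -/

theorem mainTheorem3 {N : ℕ} (hN : N = 2 ∨ N = 3)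
    (Ω : Opens (LerayAlpha.E N))
    (hΩb : Bornology.IsBounded (Ω : Set (LerayAlpha.E N)))
    (hΩc : IsConnected (Ω : Set (LerayAlpha.E N)))
    (hΩ : LerayAlpha.HasC2Boundary Ω)
    (ω : Opens (LerayAlpha.E N)) (hω : ω ≤ Ω)
    (hω' : (ω : Set (LerayAlpha.E N)).Nonempty)
    (T : ℝ) (hT : 0 < T)
    (y₀ : LerayAlpha.L2 Ω) (hy₀ : y₀ ∈ LerayAlpha.H Ω)
    (C : ℝ) (α : ℕ → ℝ) (hα : ∀ n, 0 < α n) (hα0 : Tendsto α atTop (𝓝 0))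
    (v : ℕ → LerayAlpha.Control T ω) (hv : ∀ n, ‖v n‖ ≤ C)
    (y z : ℕ → ℝ → LerayAlpha.L2 Ω)
    (p π : ℕ → 𝓓'(LerayAlpha.cylinder T Ω, ℝ))
    (hstate : ∀ n, LerayAlpha.IsLerayState T Ω ω (α n) y₀ (v n) (y n) (p n) (z n) (π n))
    (hnull : ∀ n, y n T = 0) :
    ∃ (k : ℕ → ℕ) (v' : LerayAlpha.Control T ω) (y' : ℝ → LerayAlpha.L2 Ω)
      (p' : 𝓓'(LerayAlpha.cylinder T Ω, ℝ)),
      StrictMono k ∧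
      LerayAlpha.TendstoWeakStar (fun n => v (k n)) v' ∧
      LerayAlpha.TendstoL2 T (fun n => z (k n)) y' ∧
      LerayAlpha.TendstoL2 T (fun n => y (k n)) y' ∧
      LerayAlpha.IsNavierStokesState T Ω ω y₀ v' y' p' ∧
      y' T = 0 := by
  have hfin : IsFiniteMeasure (LerayAlpha.dom Ω) :=
    isFiniteMeasure_restrict.2 hΩb.measure_lt_top.ne
  have hL4 : LerayAlpha.HasL4Embedding Ω := ⟨LerayAlpha.exists_eLpNorm_four_le hN hΩb⟩
  have hC : 0 ≤ C := (norm_nonneg _).trans (hv 0)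
  obtain ⟨M, hM, hM'⟩ := LerayAlpha.exists_lerayBounds hω hT y₀ hC
  choose Y Z hb hmom using fun n => hM' (α n) (v n) (y n) (z n) (p n) (π n) (hα n) (hv n) (hstate n)
  obtain ⟨k, v', y', Y', hk, hstar, hyL, L, hcont, hy'⟩ :=
    LerayAlpha.exists_limit hω hT hM hC hα0 hv hb
  obtain ⟨D, hD⟩ := L.gradLim hω (fun n => hmom (k n))
  obtain ⟨p', hp'⟩ := hD.exists_distribution hΩc
  -- Weak convergence holds at every single time, endpoints included, so values common to all `y n`
  -- at a given time pass to `y'`; this serves at `0` and at `T`.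
  have hend : ∀ t ∈ Icc 0 T, ∀ u, (∀ n, y n t = u) → y' t = u := fun t ht u hu => by
    refine ext_inner_right ℝ fun w => tendsto_nhds_unique (hy' t ht w) ?_
    simp_rw [hu]
    exact tendsto_const_nhds
  refine ⟨k, v', y', p', hk, hstar, L.tendsto_z, hyL, ⟨hcont, fun t ht => ?_, ?_, Y',
    L.isL2V_limit, fun w ψ h1 h2 h3 => L.weak hω (fun n => hmom (k n)) w h1 h2 h3,
    fun j φ => ?_⟩, ?_⟩
  · exact LerayAlpha.mem_H_of_weak_limit (fun n => (hstate (k n)).mem_H t ht) (hy' t ht)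
  · exact hend 0 ⟨le_rfl, hT.le⟩ y₀ fun n => (hstate n).initial
  · exact (LerayAlpha.momentum_iff_defect hω v' y' L.isL2V_limit j φ _).2 (hp' j φ)
  · exact hend T ⟨hT.le, le_rfl⟩ 0 hnull
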